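/- **Setting.** Let $\mathbb F$ be a field or skew field of characteristic $\ne 2$ with an involution $a\mapsto\bar a$ (an additive bijection with $\overline{ab}=\bar b\,\bar a$, $\bar{\bar a}=a$; possibly the identity). All vector spaces are finite dimensional right vector spaces over $\mathbb F$. A sesquilinear form $B\colon U\times V\to\mathbb F$ is semilinear in the first argument and linear in the second. $V^*$ is the space of semilinear maps $\varphi\colon V\to\mathbb F$, $\varphi(va)=\bar a\varphi(v)$; $V$ is identified with $V^{**}$ by $v\mapsto(\varphi\mapsto\overline{\varphi(v)})$; and $A^*\colon V^*\to U^*$, $A^*\varphi=\varphi A$, for a linear map $A\colon U\to V$. A *dograph* $D$ is a graph with vertices $1,\dots,n$ and any number of oriented edges $\alpha\colon i\to j$, nonoriented edges $\beta\colon i - j$ ($i\le j$), and doubly oriented edges $\gamma\colon i\leftrightarrow j$ ($i\le j$). A *representation* $\mathcal A$ of $D$ consists of vector spaces $\mathcal A_i$, linear maps $\mathcal A_\alpha\colon \mathcal A_i\to \mathcal A_j$, and sesquilinear forms $\mathcal A_\beta\colon \mathcal A_i\times \mathcal A_j\to\mathbb F$ and $\mathcal A_\gamma\colon \mathcal A_i^*\times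 \mathcal A_j^*\to\mathbb F$. Isomorphisms are families of linear bijections $f_i$ that transform all the maps and forms of one representation to those of the other; direct sums are formed componentwise. The quiver $\underline D$ has the vertices $i,i^*$ for each vertex $i$ of $D$, and the arrows $\alpha\colon i\to j$, $\alpha^*\colon j^*\to i^*$; $\beta\colon j\to i^*$, $\beta^*\colon i\to j^*$; $\gamma\colon j^*\to i$, $\gamma^*\colon i^*\to j$ for the edges of $D$ as above; put $i^{**}=i$, $\alpha^{**}=\alpha$. For a representation $\mathcal M$ of $\underline D$, the adjoint $\mathcal M^\circ$ is given by $\mathcal M^\circ_v=(\mathcal M_{v^*})^*$, $\mathcal M^\circ_\alpha=(\mathcal M_{\alpha^*})^*$; for a morphism $f$, $f^\circ_v=(f_{v^*})^*$. Each representation $\mathcal A$ of $D$ gives the selfadjoint representation $\underline{\mathcal A}$ of $\underline D$ with the spaces $\mathcal A_i$ at $i$ and $\mathcal A_i^*$ at $i^*$; the maps $\mathcal A_\alpha$ and $\mathcal A_\alpha^*$; the map $v\mapsto B(?,v)$ for $\beta$ and $u\mapsto\overline{B(u,?)}$ for $\beta^*$, where $B=\mathcal A_\beta$; and in the same way the maps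 for $\gamma$ and $\gamma^*$ from $\mathcal A_\gamma$. The form $\mathcal A_\beta$ is identified with the map $\mathcal A_j\to \mathcal A_i^*$, and $\mathcal A_\gamma$ with the map $\mathcal A_j^*\to \mathcal A_i$. A *dograph with relations* is a dograph $D$ with a finite set of relations $\sum_k c_kp_k=0$ on $\underline D$, where the $c_k$ are in the center of $\mathbb F$ and the $p_k$ are oriented paths (possibly of length $0$) with the same initial and the same final vertex; its representations are the representations $\mathcal A$ of $D$ for which $\underline{\mathcal A}$ satisfies the relations. Representations of the quiver with relations $\underline D$ have to satisfy the relations and the adjoint relations $\sum_k\bar c_kp_k^*=0$. A representation of $\underline D$ is called indecomposable if it is nonzero and is not isomorphic to a direct sum of two nonzero representations. Let $\operatorname{ind}_0(\underline D)$ be a set of indecomposable representations $\underline{\mathcal A}$ of the quiver with relations $\underline D$ such that each indecomposable representation of it that is isomorphic to a selfadjoint one is isomorphic to exactly one $\underline{\mathcal A}\in\operatorname{ind}_0(\underline D)$. Let $\operatorname{ind}_1(\underline D)$ be a set of indecomposable representations of it that are not isomorphic to selfadjoint ones, such that for each such representation $\mathcal N$ there is exactly one $\mathcal M\in\operatorname{ind}_1(\underline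 D)$ with $\mathcal N\simeq\mathcal M$ or $\mathcal N\simeq\mathcal M^\circ$. For a representation $\mathcal M$ of $\underline D$, let $\mathcal M^+$ be the representation of $D$ with $\mathcal M^+_i=\mathcal M_i\oplus\mathcal M_{i^*}^*$ and $$\mathcal M^+_\alpha=\begin{bmatrix}\mathcal M_\alpha&0\\0&\mathcal M_{\alpha^*}^*\end{bmatrix},\quad \mathcal M^+_\beta=\begin{bmatrix}0&\mathcal M_{\beta^*}^*\\ \mathcal M_\beta&0\end{bmatrix},\quad \mathcal M^+_\gamma=\begin{bmatrix}0&\mathcal M_\gamma\\ \mathcal M_{\gamma^*}^*&0\end{bmatrix}.$$ For $\underline{\mathcal A}\in\operatorname{ind}_0(\underline D)$ let $\mathbb T(\mathcal A)=\operatorname{End}(\underline{\mathcal A})/\operatorname{Rad}$, where $\operatorname{Rad}$ is the radical of the ring $\operatorname{End}(\underline{\mathcal A})$, with the involution $(f+\operatorname{Rad})^\circ=f^\circ+\operatorname{Rad}$. For a selfadjoint automorphism $f=f^\circ$ of $\underline{\mathcal A}$, let $\mathcal A^f$ be obtained from $\mathcal A$ by replacing each $\mathcal A_\beta$ by $\mathcal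 A_\beta f_j$ and each $\mathcal A_\gamma$ by $f_i^{-1}\mathcal A_\gamma$. Fix for each nonzero $a=a^\circ\in\mathbb T(\mathcal A)$ a selfadjoint automorphism $f_a\in a$ and put $\mathcal A^a=\mathcal A^{f_a}$. For a Hermitian form $\varphi(x)=x_1^\circ a_1x_1+\dots+x_r^\circ a_rx_r$ with $r\ge1$ and $0\ne a_k=a_k^\circ\in\mathbb T(\mathcal A)$ put $\mathcal A^{\varphi}=\mathcal A^{a_1}\oplus\dots\oplus\mathcal A^{a_r}$. **Theorem 3.1.** For each $\underline{\mathcal A}\in\operatorname{ind}_0(\underline D)$ the ring $\mathbb T(\mathcal A)$ is a field or skew field, and each nonzero $a=a^\circ\in\mathbb T(\mathcal A)$ contains a selfadjoint automorphism of $\underline{\mathcal A}$. For any choice of the automorphisms $f_a$, every representation of the dograph $D$ with relations is isomorphic to a direct sum $$\mathcal M_1^+\oplus\dots\oplus\mathcal M_p^+\oplus\mathcal A_1^{\varphi_1}\oplus\dots\oplus\mathcal A_q^{\varphi_q},\qquad p,q\ge 0,$$ where $\mathcal M_i\in\operatorname{ind}_1(\underline D)$, $\underline{\mathcal A}_j\in\operatorname{ind}_0(\underline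 D)$, $\mathcal A_j\ne\mathcal A_{j'}$ if $j\ne j'$, and each $\varphi_j$ is a Hermitian form over $\mathbb T(\mathcal A_j)$ as above. This sum is determined uniquely up to permutation of summands and replacement of $\mathcal A_j^{\varphi_j}$ by $\mathcal A_j^{\psi_j}$, where $\psi_j$ is a Hermitian form over $\mathbb T(\mathcal A_j)$ equivalent to $\varphi_j$: two such direct sums are isomorphic if and only if they can be obtained from each other in this way. -/

import Mathlib

open MulOpposite

universe u w

noncomputable section

/-! ## Right vector spaces, *dual spaces, sesquilinear forms

`F` is a field or skew field with involution `a ↦ star a`.  A finite dimensional right vector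
space over `F` is a finite module over `Fᵐᵒᵖ`; the vector `v a` is `op a • v`. -/

section StarDual

variable {F : Type u} [DivisionRing F] [StarRing F]

/-- The involution, seen as a ring homomorphism `Fᵐᵒᵖ → F`. -/
def conjOp (F : Type u) [DivisionRing F] [StarRing F] : Fᵐᵒᵖ →+* F where
  toFun a := star (unop a)
  map_one' := by simp
  map_mul' a b := by simp
  map_zero' := by simp
  map_add' a b := by simp

@[simp] theorem conjOp_apply (a : Fᵐᵒᵖ) : conjOp F a = star (unop a) := rfl

/-- The *dual space `V^*`: the semilinear maps `φ : V → F`, `φ (v a) = star a * φ v`,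
with the right scalar multiplication `(φ a) v = φ v * a`. -/
abbrev StarDual (F : Type u) [DivisionRing F] [StarRing F] (V : Type u) [AddCommGroup V]
    [Module Fᵐᵒᵖ V] : Type u :=
  V →ₛₗ[conjOp F] F

/-- Sesquilinear forms `B : U × V → F`, semilinear in the first and linear in the second
argument: `B (u a) (v b) = star a * B u v * b`. -/
abbrev SesqForm (F : Type u) [DivisionRing F] [StarRing F] (U V : Type u) [AddCommGroup U]
    [Module Fᵐᵒᵖ U] [AddCommGroup V] [Module Fᵐᵒᵖ V] : Type u :=
  U →ₛₗ[conjOp F] (V →ₗ[Fᵐᵒᵖ] F)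

variable {U V W : Type u} [AddCommGroup U] [Module Fᵐᵒᵖ U] [AddCommGroup V] [Module Fᵐᵒᵖ V]
  [AddCommGroup W] [Module Fᵐᵒᵖ W]

/-- The *adjoint map `A^* : V^* → U^*`, `A^* φ = φ ∘ A`, of `A : U → V`. -/
def starMap (A : U →ₗ[Fᵐᵒᵖ] V) : StarDual F V →ₗ[Fᵐᵒᵖ] StarDual F U where
  toFun φ := φ.comp A
  map_add' _ _ := rfl
  map_smul' _ _ := rfl

@[simp] theorem starMap_apply (A : U →ₗ[Fᵐᵒᵖ] V) (φ : StarDual F V) (x : U) :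
    starMap A φ x = φ (A x) := rfl

/-- The canonical map `V → V^{**}`, `v ↦ (φ ↦ star (φ v))`. -/
def starEval (F : Type u) [DivisionRing F] [StarRing F] (V : Type u) [AddCommGroup V]
    [Module Fᵐᵒᵖ V] : V →ₗ[Fᵐᵒᵖ] StarDual F (StarDual F V) where
  toFun v :=
    { toFun := fun φ => star (φ v)
      map_add' := fun φ ψ => by simp
      map_smul' := fun a φ => by simp }
  map_add' v w := LinearMap.ext fun φ => by
    change star (φ (v + w)) = star (φ v) + star (φ w)
    simp
  map_smul' a v := LinearMap.ext fun φ => by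
    change star (φ (a • v)) = star (φ v) * unop a
    simp

@[simp] theorem starEval_apply (v : V) (φ : StarDual F V) : starEval F V v φ = star (φ v) := rfl

section Finite

variable [Module.Finite Fᵐᵒᵖ V]

/-- The coordinate functionals of a basis of `V`, as elements of `V^*`. -/
def starCoord (F : Type u) [DivisionRing F] [StarRing F] (V : Type u) [AddCommGroup V]
    [Module Fᵐᵒᵖ V] [Module.Finite Fᵐᵒᵖ V] (i : Fin (Module.finrank Fᵐᵒᵖ V)) : StarDual F V where
  toFun v := star (unop ((Module.finBasis Fᵐᵒᵖ V).repr v i))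
  map_add' v w := by simp
  map_smul' a v := by simp

theorem starCoord_apply (i : Fin (Module.finrank Fᵐᵒᵖ V)) (v : V) :
    starCoord F V i v = star (unop ((Module.finBasis Fᵐᵒᵖ V).repr v i)) := rfl

theorem starDual_eq_sum (φ : StarDual F V) :
    φ = ∑ i, op (φ (Module.finBasis Fᵐᵒᵖ V i)) • starCoord F V i := by
  ext v
  conv_lhs => rw [← (Module.finBasis Fᵐᵒᵖ V).sum_repr v]
  rw [map_sum, LinearMap.sum_apply]
  refine Finset.sum_congr rfl fun i _ => ?_
  rw [LinearMap.map_smulₛₗ]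
  rfl

instance StarDual.finite : Module.Finite Fᵐᵒᵖ (StarDual F V) := by
  refine Module.Finite.of_surjective
    (Fintype.linearCombination Fᵐᵒᵖ (starCoord F V)) fun φ => ?_
  exact ⟨fun i => op (φ (Module.finBasis Fᵐᵒᵖ V i)), by
    rw [Fintype.linearCombination_apply]; exact (starDual_eq_sum φ).symm⟩

theorem starEval_bijective : Function.Bijective (starEval F V) := by
  constructor
  · rw [← LinearMap.ker_eq_bot, LinearMap.ker_eq_bot']
    intro v hv
    apply (Module.finBasis Fᵐᵒᵖ V).repr.injective
    ext i
    have h := LinearMap.congr_fun hv (starCoord F V i)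
    simpa [starCoord_apply] using h
  · intro Φ
    refine ⟨∑ i, op (Φ (starCoord F V i)) • Module.finBasis Fᵐᵒᵖ V i, ?_⟩
    ext φ
    conv_rhs => rw [starDual_eq_sum φ]
    simp [map_sum]

/-- The identification of `V` with `V^{**}`. -/
def starEvalEquiv (F : Type u) [DivisionRing F] [StarRing F] (V : Type u) [AddCommGroup V]
    [Module Fᵐᵒᵖ V] [Module.Finite Fᵐᵒᵖ V] : V ≃ₗ[Fᵐᵒᵖ] StarDual F (StarDual F V) :=
  LinearEquiv.ofBijective (starEval F V) starEval_bijective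

@[simp] theorem starEvalEquiv_apply (v : V) (φ : StarDual F V) :
    starEvalEquiv F V v φ = star (φ v) := rfl

@[simp] theorem apply_starEvalEquiv_symm (Φ : StarDual F (StarDual F V)) (φ : StarDual F V) :
    φ ((starEvalEquiv F V).symm Φ) = star (Φ φ) := by
  obtain ⟨v, rfl⟩ := (starEvalEquiv F V).surjective Φ
  simp

theorem eq_of_starDual {v w : V} (h : ∀ φ : StarDual F V, φ v = φ w) : v = w := by
  apply (starEvalEquiv F V).injective
  ext φ
  simp [h φ]

end Finite

/-- The map `V → U^*`, `v ↦ B (?, v)`, of a sesquilinear form `B : U × V → F`. -/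
def SesqForm.toMap (B : SesqForm F U V) : V →ₗ[Fᵐᵒᵖ] StarDual F U where
  toFun v :=
    { toFun := fun x => B x v
      map_add' := fun x y => by simp
      map_smul' := fun a x => by simp }
  map_add' v w := LinearMap.ext fun x => map_add (B x) v w
  map_smul' a v := LinearMap.ext fun x => map_smul (B x) a v

@[simp] theorem SesqForm.toMap_apply (B : SesqForm F U V) (x : U) (v : V) :
    B.toMap v x = B x v := rfl

/-- The map `U → V^*`, `u ↦ star (B (u, ?))`, of a sesquilinear form `B : U × V → F`. -/
def SesqForm.toMapStar (B : SesqForm F U V) : U →ₗ[Fᵐᵒᵖ] StarDual F V where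
  toFun x :=
    { toFun := fun v => star (B x v)
      map_add' := fun x y => by simp
      map_smul' := fun a x => by simp }
  map_add' v w := LinearMap.ext fun x => by
    change star (B (v + w) x) = star (B v x) + star (B w x)
    simp
  map_smul' a v := LinearMap.ext fun x => by
    change star (B (a • v) x) = star (B v x) * unop a
    simp

@[simp] theorem SesqForm.toMapStar_apply (B : SesqForm F U V) (x : U) (v : V) :
    B.toMapStar x v = star (B x v) := rfl

/-- The sesquilinear form `(u, v) ↦ g v u` of a map `g : V → U^*`. -/
def SesqForm.ofMap (g : V →ₗ[Fᵐᵒᵖ] StarDual F U) : SesqForm F U V where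
  toFun x :=
    { toFun := fun v => g v x
      map_add' := fun v w => by simp
      map_smul' := fun a v => by simp }
  map_add' x y := by ext v; simp
  map_smul' a x := by ext v; simp

@[simp] theorem SesqForm.ofMap_apply (g : V →ₗ[Fᵐᵒᵖ] StarDual F U) (x : U) (v : V) :
    SesqForm.ofMap g x v = g v x := rfl

end StarDual

/-! ## Dographs and their representations -/

/-- A dograph: a graph with vertices `1, …, n` and any number of oriented edges `i ⟶ j`,
nonoriented edges `i — j` (`i ≤ j`) and doubly oriented edges `i ⟷ j` (`i ≤ j`). -/
structure Dograph where
  n : ℕ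
  Arrow : Type w
  arrSrc : Arrow → Fin n
  arrTgt : Arrow → Fin n
  Line : Type w
  lineFst : Line → Fin n
  lineSnd : Line → Fin n
  line_le : ∀ b, lineFst b ≤ lineSnd b
  Biarrow : Type w
  biFst : Biarrow → Fin n
  biSnd : Biarrow → Fin n
  bi_le : ∀ c, biFst c ≤ biSnd c

namespace Dograph

/-- A representation of a dograph by finite dimensional right vector spaces over `F`. -/
structure Rep (D : Dograph.{w}) (F : Type u) [DivisionRing F] [StarRing F] where
  V : Fin D.n → Type u
  [addCommGroup : ∀ i, AddCommGroup (V i)]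
  [module : ∀ i, Module Fᵐᵒᵖ (V i)]
  [finite : ∀ i, Module.Finite Fᵐᵒᵖ (V i)]
  arr : ∀ a : D.Arrow, V (D.arrSrc a) →ₗ[Fᵐᵒᵖ] V (D.arrTgt a)
  line : ∀ b : D.Line, SesqForm F (V (D.lineFst b)) (V (D.lineSnd b))
  bi : ∀ c : D.Biarrow, SesqForm F (StarDual F (V (D.biFst c))) (StarDual F (V (D.biSnd c)))

attribute [instance] Rep.addCommGroup Rep.module Rep.finite

variable {D : Dograph.{w}} {F : Type u} [DivisionRing F] [StarRing F]

/-- Isomorphism of representations of a dograph. -/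
def Rep.Isomorphic (A B : D.Rep F) : Prop :=
  ∃ f : ∀ i, A.V i ≃ₗ[Fᵐᵒᵖ] B.V i,
    (∀ (a : D.Arrow) (x : A.V (D.arrSrc a)), f _ (A.arr a x) = B.arr a (f _ x)) ∧
    (∀ (b : D.Line) (x : A.V (D.lineFst b)) (y : A.V (D.lineSnd b)),
      A.line b x y = B.line b (f _ x) (f _ y)) ∧
    (∀ (c : D.Biarrow) (x : StarDual F (B.V (D.biFst c))) (y : StarDual F (B.V (D.biSnd c))),
      A.bi c (starMap (f _).toLinearMap x) (starMap (f _).toLinearMap y) = B.bi c x y)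

/-- The direct sum of a finite family of representations of a dograph. -/
def Rep.directSum {ι : Type} [Fintype ι] [DecidableEq ι] (X : ι → D.Rep F) : D.Rep F where
  V i := ∀ k, (X k).V i
  arr a := LinearMap.pi fun k => (X k).arr a ∘ₗ LinearMap.proj k
  line b := SesqForm.ofMap <| ∑ k, starMap (LinearMap.proj k) ∘ₗ
    ((X k).line b).toMap ∘ₗ LinearMap.proj k
  bi c := SesqForm.ofMap <| ∑ k, 
    starMap (starMap (LinearMap.single Fᵐᵒᵖ (fun k => (X k).V (D.biFst c)) k)) ∘ₗ
    ((X k).bi c).toMap ∘ₗ starMap (LinearMap.single Fᵐᵒᵖ (fun k => (X k).V (D.biSnd c)) k)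

/-! ## The quiver with involution of a dograph -/

/-- The vertices of the quiver `D̲`: the vertices `i` and `i^*` for each vertex `i` of `D`. -/
inductive QVert (D : Dograph.{w}) : Type
  | vert (i : Fin D.n)
  | dual (i : Fin D.n)

/-- The involution `i ↦ i^*` on the vertices. -/
def QVert.inv : QVert D → QVert D
  | .vert i => .dual i
  | .dual i => .vert i

/-- The arrows of the quiver `D̲`. -/
inductive QArrow (D : Dograph.{w}) : QVert D → QVert D → Type w
  /-- `α : i → j` -/
  | arr (a : D.Arrow) : QArrow D (.vert (D.arrSrc a)) (.vert (D.arrTgt a))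
  /-- `α^* : j^* → i^*` -/
  | arrDual (a : D.Arrow) : QArrow D (.dual (D.arrTgt a)) (.dual (D.arrSrc a))
  /-- `β : j → i^*` -/
  | line (b : D.Line) : QArrow D (.vert (D.lineSnd b)) (.dual (D.lineFst b))
  /-- `β^* : i → j^*` -/
  | lineDual (b : D.Line) : QArrow D (.vert (D.lineFst b)) (.dual (D.lineSnd b))
  /-- `γ : j^* → i` -/
  | bi (c : D.Biarrow) : QArrow D (.dual (D.biSnd c)) (.vert (D.biFst c))
  /-- `γ^* : i^* → j` -/
  | biDual (c : D.Biarrow) : QArrow D (.dual (D.biFst c)) (.vert (D.biSnd c))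

instance : Quiver.{w} (QVert D) := ⟨QArrow D⟩

/-- The involution `(α : u → v) ↦ (α^* : v^* → u^*)` on the arrows. -/
def QArrow.inv : ∀ {s t : QVert D}, (s ⟶ t) → (t.inv ⟶ s.inv)
  | _, _, .arr a => QArrow.arrDual a
  | _, _, .arrDual a => QArrow.arr a
  | _, _, .line b => QArrow.lineDual b
  | _, _, .lineDual b => QArrow.line b
  | _, _, .bi c => QArrow.biDual c
  | _, _, .biDual c => QArrow.bi c

/-- The involution on oriented paths: `α_p ⋯ α_1 ↦ α_1^* ⋯ α_p^*`. -/
def pathInv {s : QVert D} : ∀ {t : QVert D}, Quiver.Path s t → Quiver.Path t.inv s.inv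
  | _, .nil => .nil
  | _, .cons p a => (Quiver.Hom.toPath (QArrow.inv a)).comp (pathInv p)

/-! ## Representations of the quiver -/

/-- A representation of the quiver `D̲` by finite dimensional right vector spaces. -/
structure QRep (D : Dograph.{w}) (F : Type u) [DivisionRing F] [StarRing F] where
  V : QVert D → Type u
  [addCommGroup : ∀ s, AddCommGroup (V s)]
  [module : ∀ s, Module Fᵐᵒᵖ (V s)]
  [finite : ∀ s, Module.Finite Fᵐᵒᵖ (V s)]
  map : ∀ {s t : QVert D}, (s ⟶ t) → (V s →ₗ[Fᵐᵒᵖ] V t)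

attribute [instance] QRep.addCommGroup QRep.module QRep.finite

/-- Isomorphism of representations of the quiver. -/
def QRep.Isomorphic (M N : D.QRep F) : Prop :=
  ∃ f : ∀ s, M.V s ≃ₗ[Fᵐᵒᵖ] N.V s,
    ∀ {s t : QVert D} (a : s ⟶ t) (x : M.V s), f t (M.map a x) = N.map a (f s x)

/-- The direct sum of two representations of the quiver. -/
def QRep.prod (M N : D.QRep F) : D.QRep F where
  V s := M.V s × N.V s
  map a := (M.map a).prodMap (N.map a)

/-- All the spaces of the representation are zero. -/
def QRep.IsZero (M : D.QRep F) : Prop := ∀ s, Subsingleton (M.V s)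

/-- Indecomposable (in particular nonzero) representations of the quiver. -/
def QRep.Indecomposable (M : D.QRep F) : Prop :=
  ¬ M.IsZero ∧ ∀ B C : D.QRep F, M.Isomorphic (B.prod C) → B.IsZero ∨ C.IsZero

/-- The adjoint representation `M°`: `M°_s = (M_{s^*})^*` and `M°_α = (M_{α^*})^*`. -/
def QRep.adjoint (M : D.QRep F) : D.QRep F where
  V s := StarDual F (M.V s.inv)
  map a := starMap (M.map (QArrow.inv a))

/-- The linear map `M_{α_p} ⋯ M_{α_1}` along an oriented path. -/
def QRep.evalPath (M : D.QRep F) {s : QVert D} :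
    ∀ {t : QVert D}, Quiver.Path s t → (M.V s →ₗ[Fᵐᵒᵖ] M.V t)
  | _, .nil => LinearMap.id
  | _, .cons p a => M.map a ∘ₗ M.evalPath p

/-- The endomorphism ring of a representation of the quiver (multiplication is composition). -/
def QRep.End (M : D.QRep F) : Subring (∀ s, Module.End Fᵐᵒᵖ (M.V s)) where
  carrier := {f | ∀ (s t : QVert D) (a : s ⟶ t), f t ∘ₗ M.map a = M.map a ∘ₗ f s}
  mul_mem' {f g} hf hg s t a := by
    have h1 := hf s t a
    have h2 := hg s t a
    simp only [Pi.mul_apply, Module.End.mul_eq_comp]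
    rw [LinearMap.comp_assoc, h2, ← LinearMap.comp_assoc, h1, LinearMap.comp_assoc]
  one_mem' s t a := rfl
  add_mem' {f g} hf hg s t a := by
    simp only [Pi.add_apply, LinearMap.add_comp, LinearMap.comp_add, hf s t a, hg s t a]
  zero_mem' s t a := by simp
  neg_mem' {f} hf s t a := by
    simp only [Pi.neg_apply, LinearMap.neg_comp, LinearMap.comp_neg, hf s t a]

/-! ## Relations -/

/-- A relation `∑ c_i p_i = 0` on the quiver: a formal linear combination, with coefficients in
the center of `F`, of oriented paths (possibly of length 0) with common initial and final
vertices. -/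
structure Relation (D : Dograph.{w}) (F : Type u) [DivisionRing F] where
  src : QVert D
  tgt : QVert D
  coeff : Quiver.Path src tgt →₀ Subring.center F

/-- `M` satisfies the relation `∑ c_i p_i = 0`. -/
def QRep.SatisfiesRel (M : D.QRep F) (r : D.Relation F) : Prop :=
  ∀ x : M.V r.src, (r.coeff.sum fun p c => op (c : F) • M.evalPath p x) = 0

/-- `M` satisfies the adjoint relation `∑ star c_i p_i^* = 0`. -/
def QRep.SatisfiesAdjointRel (M : D.QRep F) (r : D.Relation F) : Prop :=
  ∀ x : M.V r.tgt.inv, (r.coeff.sum fun p c => op (star (c : F)) • M.evalPath (pathInv p) x) = 0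

/-- `M` satisfies the relations `R` and their adjoint relations. -/
def QRep.Satisfies (M : D.QRep F) (R : Finset (D.Relation F)) : Prop :=
  ∀ r ∈ R, M.SatisfiesRel r ∧ M.SatisfiesAdjointRel r

/-! ## The selfadjoint representation `A̲` of the quiver given by a representation `A` of `D` -/

/-- The spaces `V_i` and `V_i^*`. -/
def Rep.underV (A : D.Rep F) : QVert D → Type u
  | .vert i => A.V i
  | .dual i => StarDual F (A.V i)

instance (A : D.Rep F) : ∀ s, AddCommGroup (A.underV s)
  | .vert i => inferInstanceAs (AddCommGroup (A.V i))
  | .dual i => inferInstanceAs (AddCommGroup (StarDual F (A.V i)))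

instance (A : D.Rep F) : ∀ s, Module Fᵐᵒᵖ (A.underV s)
  | .vert i => inferInstanceAs (Module Fᵐᵒᵖ (A.V i))
  | .dual i => inferInstanceAs (Module Fᵐᵒᵖ (StarDual F (A.V i)))

instance (A : D.Rep F) : ∀ s, Module.Finite Fᵐᵒᵖ (A.underV s)
  | .vert i => inferInstanceAs (Module.Finite Fᵐᵒᵖ (A.V i))
  | .dual i => inferInstanceAs (Module.Finite Fᵐᵒᵖ (StarDual F (A.V i)))

/-- The maps of `A̲`: `A_α`, `A_α^*`, `B : v ↦ B (?, v)`, `B^* : u ↦ star (B (u, ?))`,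
`C : v ↦ C (?, v) ∈ U^{**} = U` and `C^* : u ↦ star (C (u, ?)) ∈ V^{**} = V`. -/
def Rep.underMap (A : D.Rep F) :
    ∀ {s t : QVert D}, (s ⟶ t) → (A.underV s →ₗ[Fᵐᵒᵖ] A.underV t)
  | _, _, .arr a => A.arr a
  | _, _, .arrDual a => starMap (A.arr a)
  | _, _, .line b => (A.line b).toMap
  | _, _, .lineDual b => (A.line b).toMapStar
  | _, _, .bi c => (starEvalEquiv F (A.V (D.biFst c))).symm.toLinearMap ∘ₗ (A.bi c).toMap
  | _, _, .biDual c =>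
      (starEvalEquiv F (A.V (D.biSnd c))).symm.toLinearMap ∘ₗ (A.bi c).toMapStar

/-- The selfadjoint representation `A̲` of the quiver. -/
def Rep.under (A : D.Rep F) : D.QRep F where
  V := A.underV
  map := A.underMap

/-- `A` is a representation of the dograph with relations `R`. -/
def Rep.Satisfies (A : D.Rep F) (R : Finset (D.Relation F)) : Prop :=
  ∀ r ∈ R, A.under.SatisfiesRel r

/-! ## The involution on `End A̲` and on `T(A) = End A̲ / Rad` -/

/-- The component `f_i : V_i → V_i` of a family of maps `f_s : A̲_s → A̲_s`. -/
def Rep.atVert {A : D.Rep F} (f : ∀ s, Module.End Fᵐᵒᵖ (A.under.V s)) (i : Fin D.n) :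
    A.V i →ₗ[Fᵐᵒᵖ] A.V i :=
  f (.vert i)

/-- The component `f_{i^*} : V_i^* → V_i^*` of a family of maps `f_s : A̲_s → A̲_s`. -/
def Rep.atDual {A : D.Rep F} (f : ∀ s, Module.End Fᵐᵒᵖ (A.under.V s)) (i : Fin D.n) :
    StarDual F (A.V i) →ₗ[Fᵐᵒᵖ] StarDual F (A.V i) :=
  f (.dual i)

theorem Rep.family_ext {A : D.Rep F} {f g : ∀ s, Module.End Fᵐᵒᵖ (A.under.V s)}
    (h1 : ∀ i, Rep.atVert f i = Rep.atVert g i) (h2 : ∀ i, Rep.atDual f i = Rep.atDual g i) :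
    f = g := by
  funext s
  cases s with
  | vert i => exact h1 i
  | dual i => exact h2 i

/-- The adjoint `f°` of a family of maps `f_s : A̲_s → A̲_s`, `f°_s = (f_{s^*})^*`, where
`V_i^{**}` is identified with `V_i`. -/
def Rep.endStar {A : D.Rep F} (f : ∀ s, Module.End Fᵐᵒᵖ (A.under.V s)) :
    ∀ s, Module.End Fᵐᵒᵖ (A.under.V s)
  | .vert i => (starEvalEquiv F (A.V i)).symm.toLinearMap ∘ₗ starMap (Rep.atDual f i) ∘ₗ
      (starEvalEquiv F (A.V i)).toLinearMap
  | .dual i => starMap (Rep.atVert f i)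

theorem Rep.apply_endStar {A : D.Rep F} (f : ∀ s, Module.End Fᵐᵒᵖ (A.under.V s))
    (i : Fin D.n) (x : A.V i) (φ : StarDual F (A.V i)) :
    φ (Rep.atVert (Rep.endStar f) i x) = Rep.atDual f i φ x := by
  change φ ((starEvalEquiv F (A.V i)).symm _) = _
  rw [apply_starEvalEquiv_symm]
  change star (star (Rep.atDual f i φ x)) = _
  rw [star_star]

theorem Rep.endStar_apply {A : D.Rep F} (f : ∀ s, Module.End Fᵐᵒᵖ (A.under.V s))
    (i : Fin D.n) (x : A.V i) (φ : StarDual F (A.V i)) :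
    Rep.atDual (Rep.endStar f) i φ x = φ (Rep.atVert f i x) := rfl

theorem Rep.endStar_mem {A : D.Rep F} {f : ∀ s, Module.End Fᵐᵒᵖ (A.under.V s)}
    (hf : f ∈ A.under.End) : Rep.endStar f ∈ A.under.End := by
  have arr : ∀ a x, Rep.atVert f _ (A.arr a x) = A.arr a (Rep.atVert f _ x) :=
    fun a x => LinearMap.congr_fun (hf _ _ (QArrow.arr a)) x
  have arrDual : ∀ a φ, Rep.atDual f _ (starMap (A.arr a) φ) =
      starMap (A.arr a) (Rep.atDual f _ φ) :=
    fun a x => LinearMap.congr_fun (hf _ _ (QArrow.arrDual a)) x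
  have line : ∀ b x, Rep.atDual f _ ((A.line b).toMap x) = (A.line b).toMap (Rep.atVert f _ x) :=
    fun a x => LinearMap.congr_fun (hf _ _ (QArrow.line a)) x
  have lineDual : ∀ b x, Rep.atDual f _ ((A.line b).toMapStar x) =
      (A.line b).toMapStar (Rep.atVert f _ x) :=
    fun a x => LinearMap.congr_fun (hf _ _ (QArrow.lineDual a)) x
  have bi : ∀ c φ, Rep.atVert f _ ((starEvalEquiv F _).symm ((A.bi c).toMap φ)) =
      (starEvalEquiv F _).symm ((A.bi c).toMap (Rep.atDual f _ φ)) :=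
    fun a x => LinearMap.congr_fun (hf _ _ (QArrow.bi a)) x
  have biDual : ∀ c φ, Rep.atVert f _ ((starEvalEquiv F _).symm ((A.bi c).toMapStar φ)) =
      (starEvalEquiv F _).symm ((A.bi c).toMapStar (Rep.atDual f _ φ)) :=
    fun a x => LinearMap.congr_fun (hf _ _ (QArrow.biDual a)) x
  suffices h : ∀ s t (a : QArrow D s t),
      Rep.endStar f t ∘ₗ A.under.map a = A.under.map a ∘ₗ Rep.endStar f s from h
  intro s t a
  cases a with
  | arr a =>
    refine LinearMap.ext fun (x : A.V _) => eq_of_starDual (F := F) (V := A.V _) fun φ => ?_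
    change φ (Rep.atVert (Rep.endStar f) _ (A.arr a x)) =
      (starMap (A.arr a) φ) (Rep.atVert (Rep.endStar f) _ x)
    rw [Rep.apply_endStar, Rep.apply_endStar, arrDual]
    rfl
  | arrDual a =>
    refine LinearMap.ext fun (φ : StarDual F (A.V _)) => LinearMap.ext fun x => ?_
    change φ (A.arr a (Rep.atVert f _ x)) = φ (Rep.atVert f _ (A.arr a x))
    rw [arr]
  | line b =>
    refine LinearMap.ext fun (y : A.V _) => LinearMap.ext fun (x : A.V _) => ?_
    change A.line b (Rep.atVert f _ x) y = A.line b x (Rep.atVert (Rep.endStar f) _ y)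
    have h := Rep.apply_endStar f _ y ((A.line b).toMapStar x)
    rw [lineDual] at h
    simpa using h.symm
  | lineDual b =>
    refine LinearMap.ext fun (y : A.V _) => LinearMap.ext fun (x : A.V _) => ?_
    change star (A.line b y (Rep.atVert f _ x)) =
      star (A.line b (Rep.atVert (Rep.endStar f) _ y) x)
    have h := Rep.apply_endStar f _ y ((A.line b).toMap x)
    rw [line] at h
    exact congrArg star h.symm
  | bi c =>
    refine LinearMap.ext fun (ψ : StarDual F (A.V _)) =>
      eq_of_starDual (F := F) (V := A.V _) fun φ => ?_
    change φ (Rep.atVert (Rep.endStar f) _ ((starEvalEquiv F _).symm ((A.bi c).toMap ψ))) =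
      φ ((starEvalEquiv F _).symm ((A.bi c).toMap (Rep.atDual (Rep.endStar f) _ ψ)))
    rw [Rep.apply_endStar, apply_starEvalEquiv_symm, apply_starEvalEquiv_symm]
    have h := congrArg ψ (biDual c φ)
    rw [apply_starEvalEquiv_symm] at h
    have h2 := Rep.endStar_apply f _ ((starEvalEquiv F _).symm ((A.bi c).toMapStar φ)) ψ
    rw [h, apply_starEvalEquiv_symm] at h2
    simpa using congrArg star h2.symm
  | biDual c =>
    refine LinearMap.ext fun (ψ : StarDual F (A.V _)) =>
      eq_of_starDual (F := F) (V := A.V _) fun φ => ?_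
    change φ (Rep.atVert (Rep.endStar f) _ ((starEvalEquiv F _).symm ((A.bi c).toMapStar ψ))) =
      φ ((starEvalEquiv F _).symm ((A.bi c).toMapStar (Rep.atDual (Rep.endStar f) _ ψ)))
    rw [Rep.apply_endStar, apply_starEvalEquiv_symm, apply_starEvalEquiv_symm]
    have h := congrArg ψ (bi c φ)
    rw [apply_starEvalEquiv_symm] at h
    have h2 := Rep.endStar_apply f _ ((starEvalEquiv F _).symm ((A.bi c).toMap φ)) ψ
    rw [h, apply_starEvalEquiv_symm] at h2
    simpa using congrArg star h2.symm

theorem Rep.endStar_add {A : D.Rep F} (f g : ∀ s, Module.End Fᵐᵒᵖ (A.under.V s)) :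
    Rep.endStar (f + g) = Rep.endStar f + Rep.endStar g := by
  refine Rep.family_ext (fun i => ?_) (fun i => ?_)
  · refine LinearMap.ext fun x => eq_of_starDual (F := F) fun φ => ?_
    have h : ∀ f g : ∀ s, Module.End Fᵐᵒᵖ (A.under.V s), Rep.atVert (f + g) i x =
      Rep.atVert f i x + Rep.atVert g i x := fun f g => rfl
    have h' : Rep.atDual (f + g) i φ = Rep.atDual f i φ + Rep.atDual g i φ := rfl
    rw [h, map_add, Rep.apply_endStar, Rep.apply_endStar, Rep.apply_endStar, h']
    rfl
  · refine LinearMap.ext fun φ => LinearMap.ext fun x => ?_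
    have h : ∀ f g : ∀ s, Module.End Fᵐᵒᵖ (A.under.V s), Rep.atDual (f + g) i φ =
      Rep.atDual f i φ + Rep.atDual g i φ := fun f g => rfl
    have h' : Rep.atVert (f + g) i x = Rep.atVert f i x + Rep.atVert g i x := rfl
    rw [h, Rep.endStar_apply, h', map_add]
    rfl

/-- The involution `f ↦ f°` on `End A̲`. -/
instance Rep.endStarRing (A : D.Rep F) : StarRing A.under.End where
  star f := ⟨Rep.endStar f.1, Rep.endStar_mem f.2⟩
  star_involutive f := Subtype.ext <| Rep.family_ext
    (fun i => LinearMap.ext fun x => eq_of_starDual (F := F) fun φ => by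
      change φ (Rep.atVert (Rep.endStar (Rep.endStar f.1)) i x) = φ (Rep.atVert f.1 i x)
      rw [Rep.apply_endStar, Rep.endStar_apply])
    (fun i => LinearMap.ext fun φ => LinearMap.ext fun x => by
      change Rep.atDual (Rep.endStar (Rep.endStar f.1)) i φ x = Rep.atDual f.1 i φ x
      rw [Rep.endStar_apply, Rep.apply_endStar])
  star_mul f g := Subtype.ext <| Rep.family_ext
    (fun i => LinearMap.ext fun x => eq_of_starDual (F := F) fun φ => by
      change φ (Rep.atVert (Rep.endStar (f.1 * g.1)) i x) =
        φ (Rep.atVert (Rep.endStar g.1) i (Rep.atVert (Rep.endStar f.1) i x))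
      rw [Rep.apply_endStar, Rep.apply_endStar, Rep.apply_endStar]
      rfl)
    (fun i => rfl)
  star_add f g := Subtype.ext (Rep.endStar_add f.1 g.1)

section Radical

variable {S : Type*} [Ring S]

theorem exists_right_inv_of_mem_jacobson {x : S} (hx : x ∈ Ring.jacobson S) :
    ∃ z, (1 + x) * z = 1 := by
  have key : ∀ y ∈ Ring.jacobson S, ∃ z, z * (1 + y) = 1 := fun y hy => by
    obtain ⟨z, hz⟩ := Ideal.mem_jacobson_iff.1 (Ideal.jacobson_bot (R := S) ▸ hy) 1
    exact ⟨z, by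
      rw [Ideal.mem_bot, mul_one, sub_eq_zero] at hz
      rw [mul_add, mul_one, add_comm]; exact hz⟩
  obtain ⟨z, hz⟩ := key x hx
  have hz' : z = 1 + -(z * x) := by
    rw [mul_add, mul_one] at hz
    rw [← hz]; abel
  obtain ⟨w, hw⟩ := key _ ((Ring.jacobson S).neg_mem ((Ring.jacobson S).mul_mem_left z hx))
  rw [← hz'] at hw
  have : w = 1 + x := left_inv_eq_right_inv hw hz
  exact ⟨z, this ▸ hw⟩

theorem star_mem_jacobson [StarRing S] {x : S} (hx : x ∈ Ring.jacobson S) :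
    star x ∈ Ring.jacobson S := by
  rw [← Ideal.jacobson_bot]
  refine Ideal.mem_jacobson_iff.2 fun y => ?_
  obtain ⟨z, hz⟩ := exists_right_inv_of_mem_jacobson
    ((Ring.jacobson S).mul_mem_right (star y) hx)
  refine ⟨star z, ?_⟩
  have h := congrArg star hz
  rw [star_mul, star_add, star_mul, star_star, star_one, mul_add, mul_one] at h
  rw [Ideal.mem_bot, sub_eq_zero, ← h, mul_assoc, add_comm]

end Radical

/-- `T(A) = End A̲ / Rad`, where `Rad` is the (Jacobson) radical. -/
def Rep.T (A : D.Rep F) : Type u := A.under.End ⧸ Ring.jacobson A.under.End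

instance Rep.tRing (A : D.Rep F) : Ring A.T :=
  inferInstanceAs (Ring (A.under.End ⧸ Ring.jacobson A.under.End))

/-- The class `f + Rad` in `T(A)`. -/
def Rep.toT (A : D.Rep F) : A.under.End →+* A.T := Ideal.Quotient.mk (Ring.jacobson A.under.End)

theorem Rep.toT_surjective (A : D.Rep F) : Function.Surjective A.toT :=
  Ideal.Quotient.mk_surjective

/-- The involution `(f + Rad)° = f° + Rad` on `T(A)`. -/
instance Rep.tStarRing (A : D.Rep F) : StarRing A.T where
  star := Quotient.map' star fun f g h => by
    rw [Submodule.quotientRel_def] at h ⊢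
    rw [← star_sub]
    exact star_mem_jacobson h
  star_involutive a := by
    obtain ⟨f, rfl⟩ := A.toT_surjective a
    exact congrArg A.toT (star_star f)
  star_mul a b := by
    obtain ⟨f, rfl⟩ := A.toT_surjective a
    obtain ⟨g, rfl⟩ := A.toT_surjective b
    exact congrArg A.toT (star_mul f g)
  star_add a b := by
    obtain ⟨f, rfl⟩ := A.toT_surjective a
    obtain ⟨g, rfl⟩ := A.toT_surjective b
    exact congrArg A.toT (star_add f g)

theorem Rep.star_toT (A : D.Rep F) (f : A.under.End) : star (A.toT f) = A.toT (star f) := rfl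

/-! ## Hermitian forms -/

/-- A Hermitian form `φ(x) = x_1° a_1 x_1 + ⋯ + x_r° a_r x_r`, `0 ≠ a_i = a_i°`, `r ≥ 1`. -/
structure HermForm (T : Type u) [Ring T] [StarRing T] where
  r : ℕ
  r_pos : 0 < r
  a : Fin r → T
  a_ne_zero : ∀ i, a i ≠ 0
  star_a : ∀ i, star (a i) = a i

/-- The values `φ(x, y) = x_1° a_1 y_1 + ⋯ + x_r° a_r y_r`. -/
def HermForm.val {T : Type u} [Ring T] [StarRing T] (φ : HermForm T) (x y : Fin φ.r → T) : T :=
  ∑ i, star (x i) * φ.a i * y i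

/-- Two Hermitian forms are equivalent if a bijective linear map of right spaces `T^r → T^s`
carries one to the other. -/
def HermForm.Equivalent {T : Type u} [Ring T] [StarRing T] (φ ψ : HermForm T) : Prop :=
  ∃ e : (Fin φ.r → T) ≃ₗ[Tᵐᵒᵖ] (Fin ψ.r → T), ∀ x y, ψ.val (e x) (e y) = φ.val x y

/-! ## The representations `M^+`, `A^f` and `A^φ` of `D` -/

/-- The representation `M^+` of `D`: `M^+_i = M_i ⊕ (M_{i^*})^*`, with the maps given by the
block matrices `[M_α, 0; 0, (M_{α^*})^*]`, the forms `V_i × V_j → F` given by the maps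
`[0, (M_{β^*})^*; M_β, 0] : M_j ⊕ (M_{j^*})^* → (M_i)^* ⊕ M_{i^*} = (V_i)^*`
and the forms `V_i^* × V_j^* → F` given by the maps
`[0, M_γ; (M_{γ^*})^*, 0] : V_j^* = (M_j)^* ⊕ M_{j^*} → M_i ⊕ (M_{i^*})^* = V_i^{**}`. -/
def QRep.plus (M : D.QRep F) : D.Rep F where
  V i := M.V (.vert i) × StarDual F (M.V (.dual i))
  arr a := (M.map (QArrow.arr a)).prodMap (starMap (M.map (QArrow.arrDual a)))
  line b := SesqForm.ofMap <|
    starMap (LinearMap.fst _ _ _) ∘ₗ starMap (M.map (QArrow.lineDual b)) ∘ₗ LinearMap.snd _ _ _ +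
    starMap (LinearMap.snd _ _ _) ∘ₗ (starEvalEquiv F _).toLinearMap ∘ₗ
      M.map (QArrow.line b) ∘ₗ LinearMap.fst _ _ _
  bi c := SesqForm.ofMap <| (starEvalEquiv F _).toLinearMap ∘ₗ
    LinearMap.prod
      (M.map (QArrow.bi c) ∘ₗ (starEvalEquiv F _).symm.toLinearMap ∘ₗ
        starMap (LinearMap.inr Fᵐᵒᵖ (M.V (.vert (D.biSnd c))) _))
      (starMap (M.map (QArrow.biDual c)) ∘ₗ
        starMap (LinearMap.inl Fᵐᵒᵖ _ (StarDual F (M.V (.dual (D.biSnd c))))))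

/-- The representation `A^f`, for an automorphism `f` of `A̲`: the forms `A_β`, `A_γ`, seen as
maps `V_j → V_i^*` and `V_j^* → V_i`, are replaced by `A_β f_j` and `f_i⁻¹ A_γ`. -/
def Rep.twist (A : D.Rep F) (f : (A.under.End)ˣ) : D.Rep F where
  V := A.V
  arr := A.arr
  line b := SesqForm.ofMap <| (A.line b).toMap ∘ₗ Rep.atVert (f : A.under.End).1 _
  bi c := SesqForm.ofMap <| (starEvalEquiv F _).toLinearMap ∘ₗ
    Rep.atVert ((f⁻¹ : (A.under.End)ˣ) : A.under.End).1 _ ∘ₗ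
    (starEvalEquiv F _).symm.toLinearMap ∘ₗ (A.bi c).toMap

/-- `f` chooses for every `A ∈ ind₀` and every nonzero `a = a°` in `T(A)` a selfadjoint
automorphism `f_a = f_a°` of `A̲` in the class `a`. -/
def IsOrbitChoice (ind₀ : Set (D.Rep F)) (f : ∀ A : D.Rep F, A.T → (A.under.End)ˣ) : Prop :=
  ∀ A ∈ ind₀, ∀ a : A.T, a ≠ 0 → star a = a →
    star (f A a : A.under.End) = f A a ∧ A.toT (f A a) = a

/-- `A^φ = A^{a_1} ⊕ ⋯ ⊕ A^{a_r}`, where `A^a = A^{f_a}`. -/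
def Rep.hermSum (f : ∀ A : D.Rep F, A.T → (A.under.End)ˣ) (A : D.Rep F) (φ : HermForm A.T) :
    D.Rep F :=
  Rep.directSum fun k => A.twist (f A (φ.a k))

/-! ## The sets `ind₀` and `ind₁`, and the direct sums -/

/-- `M` is isomorphic to a selfadjoint representation. -/
def QRep.IsoSelfadjoint (M : D.QRep F) : Prop := ∃ A : D.Rep F, M.Isomorphic A.under

/-- `ind₀` (given by the representations `A` of `D` such that `A̲` is in it) and `ind₁` are
obtained from a maximal set of nonisomorphic indecomposable representations of the quiver with
relations: every indecomposable representation which is isomorphic to a selfadjoint one is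
isomorphic to `A̲` for exactly one `A ∈ ind₀`; and from each pair `{M, M°}` of the remaining
ones, up to isomorphism, exactly one is selected in `ind₁`. -/
structure IsIndPair (R : Finset (D.Relation F)) (ind₀ : Set (D.Rep F)) (ind₁ : Set (D.QRep F)) :
    Prop where
  indec₀ : ∀ A ∈ ind₀, A.under.Indecomposable ∧ A.Satisfies R
  indec₁ : ∀ M ∈ ind₁, M.Indecomposable ∧ M.Satisfies R ∧ ¬ M.IsoSelfadjoint
  existsUnique₀ : ∀ N : D.QRep F, N.Indecomposable → N.Satisfies R → N.IsoSelfadjoint →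
    ∃! A, A ∈ ind₀ ∧ N.Isomorphic A.under
  existsUnique₁ : ∀ N : D.QRep F, N.Indecomposable → N.Satisfies R → ¬ N.IsoSelfadjoint →
    ∃! M, M ∈ ind₁ ∧ (N.Isomorphic M ∨ N.Isomorphic M.adjoint)

/-- The summands `M_1, …, M_p ∈ ind₁` and `A_1, …, A_q ∈ ind₀` (distinct), with Hermitian forms
`φ_j` over `T(A_j)`. -/
structure Decomp (ind₀ : Set (D.Rep F)) (ind₁ : Set (D.QRep F)) where
  p : ℕ
  M : Fin p → D.QRep F
  M_mem : ∀ i, M i ∈ ind₁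
  q : ℕ
  A : Fin q → D.Rep F
  A_mem : ∀ j, A j ∈ ind₀
  A_injective : Function.Injective A
  φ : ∀ j, HermForm (A j).T

variable {ind₀ : Set (D.Rep F)} {ind₁ : Set (D.QRep F)}

/-- The direct sum `M_1^+ ⊕ ⋯ ⊕ M_p^+ ⊕ A_1^{φ_1} ⊕ ⋯ ⊕ A_q^{φ_q}`. -/
def Decomp.sum (f : ∀ A : D.Rep F, A.T → (A.under.End)ˣ) (d : Decomp ind₀ ind₁) : D.Rep F :=
  Rep.directSum (ι := Fin d.p ⊕ Fin d.q)
    (Sum.elim (fun i => (d.M i).plus) fun j => (d.A j).hermSum f (d.φ j))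

/-- The pairs `(A, φ)` and `(B, ψ)` satisfy `A = B`, and `φ` is equivalent to `ψ`. -/
inductive SameTerm : ∀ A B : D.Rep F, HermForm A.T → HermForm B.T → Prop
  | mk (A : D.Rep F) (φ ψ : HermForm A.T) (h : φ.Equivalent ψ) : SameTerm A A φ ψ

/-- The summands of `d` and `d'` agree up to permutation and replacement of the forms `φ_j` by
equivalent ones. -/
def Decomp.Same (d d' : Decomp ind₀ ind₁) : Prop :=
  (∃ σ : Fin d.p ≃ Fin d'.p, ∀ i, d.M i = d'.M (σ i)) ∧
  ∃ τ : Fin d.q ≃ Fin d'.q, ∀ j, SameTerm (d.A j) (d'.A (τ j)) (d.φ j) (d'.φ (τ j))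

end Dograph

end

/-! The assignment `A ↦ A.under` turns representations of the dograph into objects of an additive
category with an involution `dag` on morphisms. Under it, isomorphisms of dograph representations
are exactly the unitary morphisms, `u ≫ dag u = 𝟙` and `dag u ≫ u = 𝟙` (`isomorphic_iff_uiso`), and
orthogonal summands are exactly the ranges of selfadjoint idempotents (`exists_isometry`). The
theorem thus becomes a classification of Hermitian objects up to unitary equivalence.

Spaces are finite dimensional, so Fitting's lemma makes the endomorphism ring of an indecomposable
representation local. The radical morphisms `IsRad` then form an ideal, and radical endomorphisms of
any object are nilpotent. Since `2` is invertible, a selfadjoint `1 + r` with `r` nilpotent has a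
selfadjoint square root. Hence a morphism that is unitary modulo the radical can be corrected, as in
polar decomposition, to a unitary one (`uiso_of_isRad`). Everything may therefore be computed modulo
the radical.

Existence: choose an indecomposable summand `L` of `X.under`. If `L` is isomorphic to some
`A.under`, polarization gives `i : A.under ⟶ X.under` with `i ≫ dag i` invertible, which embeds a
twist `A^f` as an orthogonal summand; only the class of `f` in `T(A)` matters (`uiso_twist`). If `L`
is not isomorphic to a selfadjoint representation, the form of `X` restricted to `L` is radical. The
idempotent onto `L` can then be conjugated to one orthogonal to its adjoint, and the sum of the two
cuts out a copy of `M^+` (`exists_plus_inc`). Induction on the dimension of the orthogonal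
complement finishes.

Uniqueness: `Hom(L, X)` modulo the radical is a finite dimensional space over the division ring `End
L / Rad`, and its dimension counts the occurrences of `L`. This determines the summands `M^+`. For
`L = A.under` the space carries the Hermitian form `(g, h) ↦ h ≫ dag g`, which unitary isomorphisms
preserve and which is `φ` in suitable coordinates; so the class of `φ` is an invariant. Conversely
an equivalence of forms lifts to a morphism that is unitary modulo the radical, hence to an
isomorphism (`IsHermFrame.uiso`). -/

noncomputable section

open CategoryTheory

namespace Dograph

variable {D : Dograph.{w}} {F : Type u} [DivisionRing F] [StarRing F]

/-! ### The category of representations of the quiver -/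

/-- The additive group of morphisms `M → N`. -/
def QRep.homs (M N : D.QRep F) : AddSubgroup (∀ s, M.V s →ₗ[Fᵐᵒᵖ] N.V s) where
  carrier := {f | ∀ (s t : QVert D) (a : s ⟶ t), f t ∘ₗ M.map a = N.map a ∘ₗ f s}
  add_mem' {f g} hf hg s t a := by
    simp only [Pi.add_apply, LinearMap.add_comp, LinearMap.comp_add, hf s t a, hg s t a]
  zero_mem' s t a := by simp
  neg_mem' {f} hf s t a := by
    simp only [Pi.neg_apply, LinearMap.neg_comp, LinearMap.comp_neg, hf s t a]

instance : Category.{u} (D.QRep F) where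
  Hom M N := M.homs N
  id M := ⟨fun _ => LinearMap.id, fun _ _ _ => rfl⟩
  comp {M N P} f g := ⟨fun s => g.1 s ∘ₗ f.1 s, fun s t a => by
    rw [LinearMap.comp_assoc, f.2 s t a, ← LinearMap.comp_assoc, g.2 s t a,
      LinearMap.comp_assoc]⟩

instance (M N : D.QRep F) : AddCommGroup (M ⟶ N) := inferInstanceAs (AddCommGroup (M.homs N))

/-- The component of a morphism at a vertex. -/
def QRep.app {M N : D.QRep F} (f : M ⟶ N) (s : QVert D) : M.V s →ₗ[Fᵐᵒᵖ] N.V s := f.1 s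

/-- A morphism from its components. -/
def QRep.homMk {M N : D.QRep F} (f : ∀ s, M.V s →ₗ[Fᵐᵒᵖ] N.V s)
    (hf : ∀ {s t : QVert D} (a : s ⟶ t) (x : M.V s), f t (M.map a x) = N.map a (f s x)) : M ⟶ N :=
  ⟨f, fun _ _ a => LinearMap.ext fun x => hf a x⟩

open QRep

@[simp] theorem QRep.app_homMk {M N : D.QRep F} (f : ∀ s, M.V s →ₗ[Fᵐᵒᵖ] N.V s)
    (hf : ∀ {s t : QVert D} (a : s ⟶ t) (x : M.V s), f t (M.map a x) = N.map a (f s x)) (s) :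
    app (homMk f hf) s = f s := rfl

theorem QRep.app_map {M N : D.QRep F} (f : M ⟶ N) {s t : QVert D} (a : s ⟶ t) (x : M.V s) :
    app f t (M.map a x) = N.map a (app f s x) := LinearMap.congr_fun (f.2 s t a) x

@[ext] theorem QRep.hom_ext {M N : D.QRep F} {f g : M ⟶ N} (h : ∀ s x, app f s x = app g s x) :
    f = g := Subtype.ext <| funext fun s => LinearMap.ext fun x => h s x

@[simp] theorem QRep.app_id (M : D.QRep F) (s) (x : M.V s) : app (𝟙 M) s x = x := rfl
@[simp] theorem QRep.app_comp {M N P : D.QRep F} (f : M ⟶ N) (g : N ⟶ P) (s) (x : M.V s) :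
    app (f ≫ g) s x = app g s (app f s x) := rfl
@[simp] theorem QRep.app_add {M N : D.QRep F} (f g : M ⟶ N) (s) (x : M.V s) :
    app (f + g) s x = app f s x + app g s x := rfl
@[simp] theorem QRep.app_zero {M N : D.QRep F} (s) (x : M.V s) :
    app (0 : M ⟶ N) s x = 0 := rfl

instance : Preadditive (D.QRep F) where
  homGroup _ _ := inferInstance
  add_comp _ _ _ f g h := by ext s x; simp
  comp_add _ _ _ f g h := by ext s x; simp

/-- An isomorphism from its components. -/
def QRep.isoMk {M N : D.QRep F} (f : ∀ s, M.V s ≃ₗ[Fᵐᵒᵖ] N.V s)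
    (hf : ∀ {s t : QVert D} (a : s ⟶ t) (x : M.V s), f t (M.map a x) = N.map a (f s x)) :
    M ≅ N where
  hom := homMk (fun s => (f s).toLinearMap) hf
  inv := homMk (fun s => (f s).symm.toLinearMap) fun {s t} a y => by
    apply (f t).injective
    simp [hf]
  hom_inv_id := by ext s x; simp
  inv_hom_id := by ext s x; simp

@[simp] theorem QRep.app_hom_inv {M N : D.QRep F} (e : M ≅ N) (s) (x : M.V s) :
    app e.inv s (app e.hom s x) = x := by rw [← app_comp]; simp
@[simp] theorem QRep.app_inv_hom {M N : D.QRep F} (e : M ≅ N) (s) (x : N.V s) :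
    app e.hom s (app e.inv s x) = x := by rw [← app_comp]; simp

/-- The components of an isomorphism. -/
def QRep.isoApp {M N : D.QRep F} (e : M ≅ N) (s : QVert D) : M.V s ≃ₗ[Fᵐᵒᵖ] N.V s :=
  LinearEquiv.ofLinearMap (app e.hom s) (app e.inv s) (by ext x; simp) (by ext x; simp)

theorem QRep.isomorphic_iff {M N : D.QRep F} : M.Isomorphic N ↔ Nonempty (M ≅ N) :=
  ⟨fun ⟨f, hf⟩ => ⟨isoMk f hf⟩, fun ⟨e⟩ => ⟨isoApp e, fun a x => app_map e.hom a x⟩⟩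

theorem QRep.isIso_of_bijective {M N : D.QRep F} (f : M ⟶ N)
    (hf : ∀ s, Function.Bijective (app f s)) : IsIso f := by
  have : f = (isoMk (fun s => LinearEquiv.ofBijective (app f s) (hf s))
    (fun a x => app_map f a x)).hom := by ext; rfl
  rw [this]; infer_instance

/-- The endomorphism ring as a ring of morphisms. -/
def QRep.ofEnd (M : D.QRep F) : M.End ≃+* CategoryTheory.End M where
  toFun f := ⟨f.1, f.2⟩
  invFun f := ⟨f.1, f.2⟩
  left_inv _ := rfl
  right_inv _ := rfl
  map_mul' _ _ := rfl
  map_add' _ _ := rfl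

/-- An element of the endomorphism ring as a morphism. -/
def QRep.toHom (M : D.QRep F) (f : M.End) : M ⟶ M := M.ofEnd f

/-- A morphism as an element of the endomorphism ring. -/
def QRep.ofHom (M : D.QRep F) (f : M ⟶ M) : M.End := M.ofEnd.symm f

section toHom
variable {M : D.QRep F}

@[simp] theorem QRep.toHom_ofHom (f : M ⟶ M) : M.toHom (M.ofHom f) = f := rfl
@[simp] theorem QRep.ofHom_toHom (f : M.End) : M.ofHom (M.toHom f) = f := rfl
theorem QRep.toHom_injective : Function.Injective M.toHom := M.ofEnd.injective
theorem QRep.toHom_mul (f g : M.End) : M.toHom (f * g) = M.toHom g ≫ M.toHom f := rfl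
theorem QRep.toHom_add (f g : M.End) : M.toHom (f + g) = M.toHom f + M.toHom g := rfl
theorem QRep.toHom_zero : M.toHom 0 = 0 := rfl
theorem QRep.toHom_one : M.toHom 1 = 𝟙 M := rfl
theorem QRep.toHom_sum {κ : Type*} (s : Finset κ) (f : κ → M.End) :
    M.toHom (∑ k ∈ s, f k) = ∑ k ∈ s, M.toHom (f k) :=
  map_sum (⟨⟨M.toHom, rfl⟩, fun _ _ => rfl⟩ : M.End →+ (M ⟶ M)) f s

theorem QRep.isUnit_iff_isIso_toHom (f : M.End) : IsUnit f ↔ IsIso (M.toHom f) := by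
  refine Iff.trans ?_ (CategoryTheory.isUnit_iff_isIso (M.ofEnd f))
  exact (MulEquiv.isUnit_map M.ofEnd).symm

theorem QRep.isNilpotent_iff_ofEnd (f : M.End) :
    IsNilpotent f ↔ IsNilpotent (M.ofEnd f) :=
  (IsNilpotent.map_iff (f := M.ofEnd) M.ofEnd.injective).symm

theorem QRep.toHom_inv_comp (f : (M.End)ˣ) :
    M.toHom (f⁻¹ : (M.End)ˣ) ≫ M.toHom f = 𝟙 M := by
  rw [← toHom_mul, Units.mul_inv, toHom_one]

theorem QRep.toHom_comp_inv (f : (M.End)ˣ) :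
    M.toHom f ≫ M.toHom (f⁻¹ : (M.End)ˣ) = 𝟙 M := by
  rw [← toHom_mul, Units.inv_mul, toHom_one]

end toHom

/-! ### Duality -/

/-- The adjoint of a morphism. -/
def QRep.adj {M N : D.QRep F} (f : M ⟶ N) : N.adjoint ⟶ M.adjoint :=
  homMk (fun s => starMap (app f s.inv)) fun {s _} a (φ : StarDual F (N.V s.inv)) =>
    LinearMap.ext fun x => congrArg φ (app_map f (QArrow.inv a) x).symm

@[simp] theorem QRep.adj_id (M : D.QRep F) : adj (𝟙 M) = 𝟙 M.adjoint := rfl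
@[simp] theorem QRep.adj_comp {M N P : D.QRep F} (f : M ⟶ N) (g : N ⟶ P) :
    adj (f ≫ g) = adj g ≫ adj f := rfl
@[simp] theorem QRep.adj_add {M N : D.QRep F} (f g : M ⟶ N) : adj (f + g) = adj f + adj g := by
  ext s (φ : StarDual F (N.V s.inv))
  exact LinearMap.ext fun x => map_add φ _ _
@[simp] theorem QRep.adj_zero {M N : D.QRep F} : adj (0 : M ⟶ N) = 0 := by
  ext s (φ : StarDual F (N.V s.inv))
  exact LinearMap.ext fun x => map_zero φ

theorem QRep.adj_injective {M N : D.QRep F} {f g : M ⟶ N} (h : adj f = adj g) : f = g := by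
  have key : ∀ (s : QVert D) (x : M.V s.inv), app f s.inv x = app g s.inv x := fun s x =>
    eq_of_starDual (F := F) fun φ => by
      have h1 : starMap (app f s.inv) φ = starMap (app g s.inv) φ :=
        congrArg (fun k : N.adjoint ⟶ M.adjoint => app k s φ) h
      exact LinearMap.congr_fun h1 x
  ext s x
  cases s with
  | vert i => exact key (.dual i) x
  | dual i => exact key (.vert i) x

/-- The isomorphism of contragredients. -/
def QRep.adjIso {M N : D.QRep F} (e : M ≅ N) : N.adjoint ≅ M.adjoint where
  hom := adj e.hom
  inv := adj e.inv
  hom_inv_id := by rw [← adj_comp, e.inv_hom_id, adj_id]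
  inv_hom_id := by rw [← adj_comp, e.hom_inv_id, adj_id]

/-- The components of the isomorphism `M ≅ M°°`. -/
def QRep.biadjApp (M : D.QRep F) : ∀ s, M.V s ≃ₗ[Fᵐᵒᵖ] M.adjoint.adjoint.V s
  | .vert i => starEvalEquiv F (M.V (.vert i))
  | .dual i => starEvalEquiv F (M.V (.dual i))

/-- The isomorphism `M ≅ M°°`. -/
def QRep.biadj (M : D.QRep F) : M ≅ M.adjoint.adjoint :=
  isoMk M.biadjApp fun {s t} a x => by
    change QArrow D s t at a
    cases a <;> rfl

theorem QRep.biadj_natural {M N : D.QRep F} (f : M ⟶ N) :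
    f ≫ N.biadj.hom = M.biadj.hom ≫ adj (adj f) := by
  ext s x
  cases s <;> rfl

/-- The components of the isomorphism `A̲ ≅ A̲°`. -/
def Rep.selfDualApp (A : D.Rep F) : ∀ s, A.under.V s ≃ₗ[Fᵐᵒᵖ] A.under.adjoint.V s
  | .vert i => starEvalEquiv F (A.V i)
  | .dual i => LinearEquiv.refl Fᵐᵒᵖ (StarDual F (A.V i))

/-- The identification of `A̲` with its adjoint. -/
def Rep.selfDual (A : D.Rep F) : A.under ≅ A.under.adjoint :=
  isoMk A.selfDualApp fun {s t} a x => by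
    change QArrow D s t at a
    cases a with
    | arr a => rfl
    | arrDual a => rfl
    | line b =>
      refine LinearMap.ext fun (y : A.V _) => ?_
      exact (star_star _).symm
    | lineDual b => rfl
    | bi c =>
      refine LinearMap.ext fun (y : StarDual F (A.V _)) => ?_
      change StarDual F (A.V _) at x
      change star (y ((starEvalEquiv F _).symm ((A.bi c).toMap x))) =
        x ((starEvalEquiv F _).symm ((A.bi c).toMapStar y))
      rw [apply_starEvalEquiv_symm, apply_starEvalEquiv_symm]
      simp
    | biDual c =>
      refine LinearMap.ext fun (y : StarDual F (A.V _)) => ?_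
      change StarDual F (A.V _) at x
      change star (y ((starEvalEquiv F _).symm ((A.bi c).toMapStar x))) =
        x ((starEvalEquiv F _).symm ((A.bi c).toMap y))
      rw [apply_starEvalEquiv_symm, apply_starEvalEquiv_symm]
      simp

/-- The identification of `A̲` with its adjoint is symmetric with respect to `M ≅ M°°`; this is
exactly what makes `dag` involutive. -/
theorem Rep.selfDual_adj (A : D.Rep F) :
    A.under.biadj.hom ≫ adj A.selfDual.hom = A.selfDual.hom := by
  ext s x
  cases s with
  | vert i => rfl
  | dual i =>
    change StarDual F (A.V i) at x
    exact LinearMap.ext fun (y : A.V i) => star_star (x y)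

/-! ### The involution on morphisms between selfadjoint representations -/

/-- The involution `f ↦ f°` for morphisms between selfadjoint representations. -/
def dag {A B : D.Rep F} (f : A.under ⟶ B.under) : B.under ⟶ A.under :=
  B.selfDual.hom ≫ adj f ≫ A.selfDual.inv

@[simp] theorem dag_id (A : D.Rep F) : dag (𝟙 A.under) = 𝟙 _ := by simp [dag]

@[simp] theorem dag_comp {A B C : D.Rep F} (f : A.under ⟶ B.under) (g : B.under ⟶ C.under) :
    dag (f ≫ g) = dag g ≫ dag f := by simp [dag]

@[simp] theorem dag_add {A B : D.Rep F} (f g : A.under ⟶ B.under) :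
    dag (f + g) = dag f + dag g := by simp [dag]

@[simp] theorem dag_zero {A B : D.Rep F} : dag (0 : A.under ⟶ B.under) = 0 := by simp [dag]

@[simp] theorem dag_dag {A B : D.Rep F} (f : A.under ⟶ B.under) : dag (dag f) = f := by
  have h : adj B.selfDual.hom = B.under.biadj.inv ≫ B.selfDual.hom := by
    rw [Iso.eq_inv_comp, B.selfDual_adj]
  have h' : adj A.selfDual.inv = A.selfDual.inv ≫ A.under.biadj.hom := by
    rw [Iso.eq_inv_comp, ← A.selfDual_adj, Category.assoc, ← adj_comp]
    simp
  have h2 := biadj_natural f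
  rw [← Iso.inv_comp_eq] at h2
  simp only [dag, adj_comp, Category.assoc]
  rw [h, h', ← reassoc_of% h2]
  simp

/-- `dag` as an additive map. -/
def dagHom (A B : D.Rep F) : (A.under ⟶ B.under) →+ (B.under ⟶ A.under) where
  toFun := dag
  map_zero' := dag_zero
  map_add' := dag_add

@[simp] theorem dag_sub {A B : D.Rep F} (f g : A.under ⟶ B.under) : dag (f - g) = dag f - dag g :=
  map_sub (dagHom A B) f g

theorem dag_sum {A B : D.Rep F} {κ : Type*} (s : Finset κ) (f : κ → (A.under ⟶ B.under)) :
    dag (∑ k ∈ s, f k) = ∑ k ∈ s, dag (f k) := map_sum (dagHom A B) f s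

/-- The component of a morphism `A̲ → B̲` at a vertex of the dograph. -/
def vert {A B : D.Rep F} (f : A.under ⟶ B.under) (i : Fin D.n) : A.V i →ₗ[Fᵐᵒᵖ] B.V i :=
  app f (.vert i)

/-- The component of a morphism `A̲ → B̲` at a dual vertex. -/
def dualVert {A B : D.Rep F} (f : A.under ⟶ B.under) (i : Fin D.n) :
    StarDual F (A.V i) →ₗ[Fᵐᵒᵖ] StarDual F (B.V i) :=
  app f (.dual i)

/-- Hence a morphism of selfadjoint representations amounts to the pair `vert f`, `vert (dag f)`.
`under_ext` and `mkHom` are based on this, and dual vertices need no further attention. -/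
theorem dualVert_eq {A B : D.Rep F} (f : A.under ⟶ B.under) (i : Fin D.n) :
    dualVert f i = starMap (vert (dag f) i) := by
  conv_lhs => rw [← dag_dag f]
  refine LinearMap.ext fun φ => LinearMap.ext fun x => ?_
  change φ _ = φ _
  rfl

theorem apply_vert_dag {A B : D.Rep F} (f : A.under ⟶ B.under) (i : Fin D.n) (x : B.V i)
    (φ : StarDual F (A.V i)) : φ (vert (dag f) i x) = dualVert f i φ x := by
  rw [dualVert_eq]; rfl

@[simp] theorem vert_id (A : D.Rep F) (i) (x : A.V i) : vert (𝟙 A.under) i x = x := rfl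
@[simp] theorem vert_comp {A B C : D.Rep F} (f : A.under ⟶ B.under) (g : B.under ⟶ C.under) (i)
    (x : A.V i) : vert (f ≫ g) i x = vert g i (vert f i x) := rfl
@[simp] theorem vert_add {A B : D.Rep F} (f g : A.under ⟶ B.under) (i) (x : A.V i) :
    vert (f + g) i x = vert f i x + vert g i x := rfl
@[simp] theorem vert_zero {A B : D.Rep F} (i) (x : A.V i) :
    vert (0 : A.under ⟶ B.under) i x = 0 := rfl

theorem vert_sum {A B : D.Rep F} {κ : Type*} (s : Finset κ) (f : κ → (A.under ⟶ B.under)) (i)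
    (x : A.V i) : vert (∑ k ∈ s, f k) i x = ∑ k ∈ s, vert (f k) i x :=
  map_sum (⟨⟨fun g => vert g i x, rfl⟩, fun _ _ => rfl⟩ : (A.under ⟶ B.under) →+ B.V i) f s

theorem under_ext {A B : D.Rep F} {f g : A.under ⟶ B.under} (h : ∀ i x, vert f i x = vert g i x)
    (h' : ∀ i x, vert (dag f) i x = vert (dag g) i x) : f = g := by
  ext s x
  cases s with
  | vert i => exact h i x
  | dual i =>
    refine LinearMap.ext fun y => ?_
    change StarDual F (A.V i) at x
    change dualVert f i x y = dualVert g i x y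
    rw [← apply_vert_dag, ← apply_vert_dag, h']

/-- A morphism `A̲ → B̲` from its components `j` at the vertices and the components `p` of its
adjoint. -/
def mkHom {A B : D.Rep F} (j : ∀ i, A.V i →ₗ[Fᵐᵒᵖ] B.V i) (p : ∀ i, B.V i →ₗ[Fᵐᵒᵖ] A.V i)
    (h1 : ∀ a x, j _ (A.arr a x) = B.arr a (j _ x))
    (h2 : ∀ a y, p _ (B.arr a y) = A.arr a (p _ y))
    (h3 : ∀ b x y, B.line b (j _ x) y = A.line b x (p _ y))
    (h4 : ∀ b x y, B.line b x (j _ y) = A.line b (p _ x) y)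
    (h5 : ∀ c φ ψ, A.bi c (starMap (j _) φ) ψ = B.bi c φ (starMap (p _) ψ))
    (h6 : ∀ c φ ψ, A.bi c φ (starMap (j _) ψ) = B.bi c (starMap (p _) φ) ψ) :
    A.under ⟶ B.under :=
  homMk (fun s => match s with
      | .vert i => j i
      | .dual i => starMap (p i)) fun {s t} a x => by
    change QArrow D s t at a
    cases a with
    | arr a => exact h1 a x
    | arrDual a =>
      change StarDual F (A.V _) at x
      exact LinearMap.ext fun y => congrArg x (h2 a y).symm
    | line b => exact LinearMap.ext fun y => (h4 b y x).symm
    | lineDual b => exact LinearMap.ext fun y => congrArg star (h3 b x y).symm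
    | bi c =>
      refine eq_of_starDual (F := F) (V := B.V _) fun φ => ?_
      change starMap (j _) φ ((starEvalEquiv F _).symm ((A.bi c).toMap x)) =
        φ ((starEvalEquiv F _).symm ((B.bi c).toMap (starMap (p _) x)))
      rw [apply_starEvalEquiv_symm, apply_starEvalEquiv_symm]
      exact congrArg star (h5 c φ x)
    | biDual c =>
      refine eq_of_starDual (F := F) (V := B.V _) fun φ => ?_
      change starMap (j _) φ ((starEvalEquiv F _).symm ((A.bi c).toMapStar x)) =
        φ ((starEvalEquiv F _).symm ((B.bi c).toMapStar (starMap (p _) x)))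
      rw [apply_starEvalEquiv_symm, apply_starEvalEquiv_symm]
      exact congrArg (fun z => star (star z)) (h6 c x φ)

section mkHom
variable {A B : D.Rep F} {j : ∀ i, A.V i →ₗ[Fᵐᵒᵖ] B.V i} {p : ∀ i, B.V i →ₗ[Fᵐᵒᵖ] A.V i}
    {h1 : ∀ a x, j _ (A.arr a x) = B.arr a (j _ x)}
    {h2 : ∀ a y, p _ (B.arr a y) = A.arr a (p _ y)}
    {h3 : ∀ b x y, B.line b (j _ x) y = A.line b x (p _ y)}
    {h4 : ∀ b x y, B.line b x (j _ y) = A.line b (p _ x) y}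
    {h5 : ∀ c φ ψ, A.bi c (starMap (j _) φ) ψ = B.bi c φ (starMap (p _) ψ)}
    {h6 : ∀ c φ ψ, A.bi c φ (starMap (j _) ψ) = B.bi c (starMap (p _) φ) ψ}

@[simp] theorem vert_mkHom (i x) : vert (mkHom j p h1 h2 h3 h4 h5 h6) i x = j i x := rfl

@[simp] theorem vert_dag_mkHom (i x) : vert (dag (mkHom j p h1 h2 h3 h4 h5 h6)) i x = p i x :=
  eq_of_starDual (F := F) fun φ => by rw [apply_vert_dag]; rfl

end mkHom

theorem exists_hom {A B : D.Rep F} (j : ∀ i, A.V i →ₗ[Fᵐᵒᵖ] B.V i)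
    (p : ∀ i, B.V i →ₗ[Fᵐᵒᵖ] A.V i)
    (h1 : ∀ a x, j _ (A.arr a x) = B.arr a (j _ x))
    (h2 : ∀ a y, p _ (B.arr a y) = A.arr a (p _ y))
    (h3 : ∀ b x y, B.line b (j _ x) y = A.line b x (p _ y))
    (h4 : ∀ b x y, B.line b x (j _ y) = A.line b (p _ x) y)
    (h5 : ∀ c φ ψ, A.bi c (starMap (j _) φ) ψ = B.bi c φ (starMap (p _) ψ))
    (h6 : ∀ c φ ψ, A.bi c φ (starMap (j _) ψ) = B.bi c (starMap (p _) φ) ψ) :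
    ∃ f : A.under ⟶ B.under, (∀ i x, vert f i x = j i x) ∧ ∀ i x, vert (dag f) i x = p i x :=
  ⟨mkHom j p h1 h2 h3 h4 h5 h6, fun _ _ => vert_mkHom _ _, fun _ _ => vert_dag_mkHom _ _⟩

section components
variable {A B : D.Rep F} (f : A.under ⟶ B.under)

theorem vert_arr (a : D.Arrow) (x) : vert f _ (A.arr a x) = B.arr a (vert f _ x) :=
  app_map f (QArrow.arr a) x

/-- Commuting with the arrow `β` means that `vert f` and `vert (dag f)` are adjoint with respect to
the forms. The next three lemmas read `β^*`, `γ` and `γ^*` in the same way. -/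
theorem line_vert_right (b : D.Line) (x : B.V (D.lineFst b)) (y : A.V (D.lineSnd b)) :
    B.line b x (vert f _ y) = A.line b (vert (dag f) _ x) y := by
  have := LinearMap.congr_fun (app_map f (QArrow.line b) y) x
  change dualVert f _ ((A.line b).toMap y) x = _ at this
  rw [← apply_vert_dag] at this
  exact this.symm

theorem line_vert_left (b : D.Line) (x : A.V (D.lineFst b)) (y : B.V (D.lineSnd b)) :
    B.line b (vert f _ x) y = A.line b x (vert (dag f) _ y) := by
  have := LinearMap.congr_fun (app_map f (QArrow.lineDual b) x) y
  change dualVert f _ ((A.line b).toMapStar x) y = _ at this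
  rw [← apply_vert_dag] at this
  exact star_injective this.symm

theorem bi_vert_left (c : D.Biarrow) (φ : StarDual F (B.V (D.biFst c)))
    (ψ : StarDual F (A.V (D.biSnd c))) :
    A.bi c (starMap (vert f _) φ) ψ = B.bi c φ (starMap (vert (dag f) _) ψ) := by
  have := congrArg φ (app_map f (QArrow.bi c) ψ)
  change starMap (vert f _) φ ((starEvalEquiv F _).symm ((A.bi c).toMap ψ)) =
        φ ((starEvalEquiv F _).symm ((B.bi c).toMap (dualVert f _ ψ))) at this
  rw [apply_starEvalEquiv_symm, apply_starEvalEquiv_symm, dualVert_eq] at this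
  exact star_injective this

theorem bi_vert_right (c : D.Biarrow) (φ : StarDual F (A.V (D.biFst c)))
    (ψ : StarDual F (B.V (D.biSnd c))) :
    A.bi c φ (starMap (vert f _) ψ) = B.bi c (starMap (vert (dag f) _) φ) ψ := by
  have := congrArg ψ (app_map f (QArrow.biDual c) φ)
  change starMap (vert f _) ψ ((starEvalEquiv F _).symm ((A.bi c).toMapStar φ)) =
        ψ ((starEvalEquiv F _).symm ((B.bi c).toMapStar (dualVert f _ φ))) at this
  rw [apply_starEvalEquiv_symm, apply_starEvalEquiv_symm, dualVert_eq] at this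
  simpa using this

end components

/-- Lets ring-theoretic facts about `End A̲` with its involution be applied to morphisms with `dag`.
-/
theorem toHom_star {A : D.Rep F} (f : A.under.End) :
    A.under.toHom (star f) = dag (A.under.toHom f) := by
  refine under_ext (fun i x => ?_) (fun i x => ?_)
  · refine eq_of_starDual (F := F) fun φ => ?_
    rw [apply_vert_dag]
    exact Rep.apply_endStar f.1 i x φ
  · rw [dag_dag]
    refine eq_of_starDual (F := F) fun φ => ?_
    rw [apply_vert_dag]
    rfl

/-- Isomorphisms of representations of the dograph are unitary morphisms. -/
def Uiso (A B : D.Rep F) : Prop :=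
  ∃ u : A.under ⟶ B.under, u ≫ dag u = 𝟙 _ ∧ dag u ≫ u = 𝟙 _

/-- If `u` is unitary, then `vert (dag u)` is inverse to `vert u`, and the adjointness relations
turn into invariance of the forms. Conversely the inverse maps of an isomorphism serve as the
adjoint components. -/
theorem isomorphic_iff_uiso {A B : D.Rep F} : A.Isomorphic B ↔ Uiso A B := by
  constructor
  · rintro ⟨f, hf1, hf2, hf3⟩
    have hs : ∀ i (φ : StarDual F (A.V i)),
        starMap (f i).toLinearMap (starMap (f i).symm.toLinearMap φ) = φ := fun i φ => by
      ext x; simp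
    refine ⟨mkHom (fun i => (f i).toLinearMap) (fun i => (f i).symm.toLinearMap) hf1 ?_ ?_ ?_ ?_ ?_,
      under_ext (fun i x => ?_) fun i x => ?_, under_ext (fun i x => ?_) fun i x => ?_⟩
    · intro a y
      apply (f _).injective
      simp [hf1]
    · intro b x y
      simp [hf2]
    · intro b x y
      simp [hf2]
    · intro c φ ψ
      rw [← hf3, hs]
    · intro c φ ψ
      rw [← hf3, hs]
    all_goals simp
  · rintro ⟨u, h1, h2⟩
    have e1 : ∀ i x, vert (dag u) i (vert u i x) = x := fun i x => by
      rw [← vert_comp, h1]; rfl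
    have e2 : ∀ i x, vert u i (vert (dag u) i x) = x := fun i x => by
      rw [← vert_comp, h2]; rfl
    refine ⟨fun i => LinearEquiv.ofLinearMap (vert u i) (vert (dag u) i)
      (LinearMap.ext (e2 i)) (LinearMap.ext (e1 i)), ?_, ?_, ?_⟩
    · intro a x
      exact vert_arr u a x
    · intro b x y
      change _ = B.line b (vert u _ x) (vert u _ y)
      rw [line_vert_left, e1]
    · intro c φ ψ
      change A.bi c (starMap (vert u _) φ) (starMap (vert u _) ψ) = _
      rw [bi_vert_left]
      congr 1
      ext x
      simp [e2]

theorem Uiso.refl (A : D.Rep F) : Uiso A A := ⟨𝟙 _, by simp, by simp⟩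

theorem Uiso.symm {A B : D.Rep F} : Uiso A B → Uiso B A := fun ⟨u, h1, h2⟩ =>
  ⟨dag u, by simpa using h2, by simpa using h1⟩

theorem Uiso.iso {A B : D.Rep F} : Uiso A B → Nonempty (A.under ≅ B.under) :=
  fun ⟨u, h1, h2⟩ => ⟨⟨u, dag u, h1, h2⟩⟩

/-! ### Direct summands and idempotents -/

/-- The vertices of the quiver are two copies of those of the dograph. -/
def QVert.equivSum (D : Dograph.{w}) : Fin D.n ⊕ Fin D.n ≃ QVert D where
  toFun := Sum.elim .vert .dual
  invFun
    | .vert i => .inl i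
    | .dual i => .inr i
  left_inv := by rintro (i | i) <;> rfl
  right_inv := by rintro (i | i) <;> rfl

instance : Fintype (QVert D) := Fintype.ofEquiv _ (QVert.equivSum D)

theorem QRep.isZero_iff {M : D.QRep F} : M.IsZero ↔ 𝟙 M = 0 :=
  ⟨fun h => by ext s x; exact (h s).elim _ _, fun h s => ⟨fun x y => by
    rw [← app_id M s x, ← app_id M s y, h]; simp⟩⟩

theorem QRep.exists_split {M : D.QRep F} (e : M ⟶ M) (he : e ≫ e = e) :
    ∃ (N : D.QRep F) (j : N ⟶ M) (p : M ⟶ N), j ≫ p = 𝟙 N ∧ p ≫ j = e := by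
  have h1 : ∀ {s t : QVert D} (a : s ⟶ t), ∀ x ∈ LinearMap.range (app e s),
      M.map a x ∈ LinearMap.range (app e t) := by
    rintro s t a _ ⟨x, rfl⟩
    exact ⟨M.map a x, app_map e a x⟩
  let N : D.QRep F := { V := fun s => LinearMap.range (app e s)
                        map := fun {s t} a => (M.map a).restrict (h1 a) }
  refine ⟨N, homMk (fun s => (LinearMap.range (app e s)).subtype) fun a x => rfl,
    homMk (fun s => (app e s).rangeRestrict) fun a x => Subtype.ext (app_map e a x), ?_, ?_⟩
  · refine hom_ext fun s => ?_
    rintro ⟨_, x, rfl⟩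
    exact Subtype.ext (p := (· ∈ LinearMap.range (app e s)))
      (congrArg (fun k : M ⟶ M => app k s x) he)
  · rfl

/-- A decomposition of a representation of the quiver, from inclusions and projections. -/
def QRep.prodIso {M N₁ N₂ : D.QRep F} {j₁ : N₁ ⟶ M} {p₁ : M ⟶ N₁} {j₂ : N₂ ⟶ M} {p₂ : M ⟶ N₂}
    (h₁ : j₁ ≫ p₁ = 𝟙 _) (h₂ : j₂ ≫ p₂ = 𝟙 _) (h : p₁ ≫ j₁ + p₂ ≫ j₂ = 𝟙 M) :
    M ≅ N₁.prod N₂ where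
  hom := homMk (fun s => (app p₁ s).prod (app p₂ s)) fun a x =>
    Prod.ext (app_map p₁ a x) (app_map p₂ a x)
  inv := homMk (fun s => (app j₁ s).coprod (app j₂ s)) fun a x => by
    change app j₁ _ (N₁.map a x.1) + app j₂ _ (N₂.map a x.2) = M.map a (app j₁ _ x.1 + app j₂ _ x.2)
    rw [app_map, app_map, map_add]
  hom_inv_id := by
    rw [← h]
    rfl
  inv_hom_id := by
    -- Placing the total identity between `j₁` and `p₂` gives `j₁p₂ + j₁p₂ = j₁p₂`.
    have h12 : j₁ ≫ p₂ = 0 := by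
      have := congrArg (fun z => j₁ ≫ z ≫ p₂) h
      simp only [Preadditive.add_comp, Preadditive.comp_add, Category.assoc, h₂,
        Category.comp_id, Category.id_comp, reassoc_of% h₁] at this
      simpa using this
    have h21 : j₂ ≫ p₁ = 0 := by
      have := congrArg (fun z => j₂ ≫ z ≫ p₁) h
      simp only [Preadditive.add_comp, Preadditive.comp_add, Category.assoc, h₁,
        Category.comp_id, Category.id_comp, reassoc_of% h₂] at this
      simpa using this
    ext s ⟨x, y⟩
    change (app p₁ s (app j₁ s x + app j₂ s y), app p₂ s (app j₁ s x + app j₂ s y)) = (x, y)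
    rw [map_add, map_add, ← app_comp, ← app_comp, ← app_comp, ← app_comp, h₁, h₂, h12, h21]
    simp

/-- The first inclusion. -/
def QRep.inl (M N : D.QRep F) : M ⟶ M.prod N :=
  homMk (fun s => LinearMap.inl Fᵐᵒᵖ (M.V s) (N.V s)) fun a x => by
    change (M.map a x, (0 : N.V _)) = (M.map a x, N.map a 0)
    rw [map_zero]

/-- The second inclusion. -/
def QRep.inr (M N : D.QRep F) : N ⟶ M.prod N :=
  homMk (fun s => LinearMap.inr Fᵐᵒᵖ (M.V s) (N.V s)) fun a x => by
    change ((0 : M.V _), N.map a x) = (M.map a 0, N.map a x)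
    rw [map_zero]

/-- The first projection. -/
def QRep.fst (M N : D.QRep F) : M.prod N ⟶ M :=
  homMk (fun s => LinearMap.fst Fᵐᵒᵖ (M.V s) (N.V s)) fun _ _ => rfl

/-- The second projection. -/
def QRep.snd (M N : D.QRep F) : M.prod N ⟶ N :=
  homMk (fun s => LinearMap.snd Fᵐᵒᵖ (M.V s) (N.V s)) fun _ _ => rfl

theorem QRep.inl_fst (M N : D.QRep F) : inl M N ≫ fst M N = 𝟙 _ := rfl
theorem QRep.inr_snd (M N : D.QRep F) : inr M N ≫ snd M N = 𝟙 _ := rfl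
theorem QRep.inl_snd (M N : D.QRep F) : inl M N ≫ snd M N = 0 := rfl
theorem QRep.inr_fst (M N : D.QRep F) : inr M N ≫ fst M N = 0 := rfl
-- Idempotents split, so `e` and `1 - e` give a direct sum decomposition, and every decomposition
-- arises this way.
theorem QRep.indecomposable_iff {M : D.QRep F} :
    M.Indecomposable ↔ 𝟙 M ≠ 0 ∧ ∀ e : M ⟶ M, e ≫ e = e → e = 0 ∨ e = 𝟙 M := by
  rw [Indecomposable, isZero_iff]
  refine and_congr_right fun _ => ⟨fun h e he => ?_, fun h B C hBC => ?_⟩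
  · obtain ⟨N₁, j₁, p₁, h₁, rfl⟩ := exists_split e he
    obtain ⟨N₂, j₂, p₂, h₂, h₂'⟩ := exists_split (𝟙 M - p₁ ≫ j₁) (by
      simp only [Preadditive.sub_comp, Preadditive.comp_sub, he]; simp)
    have hz := h N₁ N₂ (isomorphic_iff.2 ⟨prodIso h₁ h₂ (by rw [h₂']; abel)⟩)
    rw [isZero_iff, isZero_iff] at hz
    rcases hz with hz | hz
    · left
      rw [← Category.comp_id p₁, hz]; simp
    · right
      rw [eq_comm, ← sub_eq_zero, ← h₂', ← Category.comp_id p₂, hz]; simp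
  · obtain ⟨φ⟩ := isomorphic_iff.1 hBC
    have := h (φ.hom ≫ fst B C ≫ inl B C ≫ φ.inv) (by simp [reassoc_of% inl_fst B C])
    rw [isZero_iff, isZero_iff]
    rcases this with h0 | h1
    · left
      have := congrArg (fun z => inl B C ≫ φ.inv ≫ z ≫ φ.hom ≫ fst B C) h0
      simpa [reassoc_of% inl_fst B C, inl_fst] using this
    · right
      have := congrArg (fun z => inr B C ≫ φ.inv ≫ z ≫ φ.hom ≫ snd B C) h1
      simpa [reassoc_of% inr_fst B C, inr_snd] using this.symm

theorem QRep.Indecomposable.of_iso {M N : D.QRep F} (hM : M.Indecomposable) (φ : M ≅ N) :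
    N.Indecomposable := by
  rw [indecomposable_iff] at hM ⊢
  refine ⟨fun h => hM.1 ?_, fun e he => ?_⟩
  · rw [← φ.hom_inv_id, ← Category.id_comp φ.inv, h]; simp
  · have := hM.2 (φ.hom ≫ e ≫ φ.inv) (by simp [reassoc_of% he])
    rcases this with h | h
    · left
      simpa using congrArg (fun z => φ.inv ≫ z ≫ φ.hom) h
    · right
      simpa using congrArg (fun z => φ.inv ≫ z ≫ φ.hom) h

/-- `adj` sends idempotents of `M°` to idempotents of `M°° ≅ M`, where only the trivial ones exist.
-/
theorem QRep.Indecomposable.adjoint {M : D.QRep F} (hM : M.Indecomposable) :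
    M.adjoint.Indecomposable := by
  have h := indecomposable_iff.1 (hM.of_iso M.biadj)
  rw [indecomposable_iff]
  refine ⟨fun h0 => h.1 ?_, fun e he => ?_⟩
  · rw [← adj_id, h0, adj_zero]
  · rcases h.2 (adj e) (by rw [← adj_comp, he]) with h | h
    · exact Or.inl (adj_injective (by simpa using h))
    · exact Or.inr (adj_injective (by simpa using h))

/-- The total dimension. -/
def QRep.dim (M : D.QRep F) : ℕ := ∑ s, Module.finrank Fᵐᵒᵖ (M.V s)

theorem QRep.dim_eq_of_iso {M N : D.QRep F} (φ : M ≅ N) : M.dim = N.dim :=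
  Finset.sum_congr rfl fun s _ => (isoApp φ s).finrank_eq

theorem QRep.dim_prod (M N : D.QRep F) : (M.prod N).dim = M.dim + N.dim := by
  rw [dim, dim, dim, ← Finset.sum_add_distrib]
  exact Finset.sum_congr rfl fun s _ => Module.finrank_prod

theorem QRep.dim_eq_zero {M : D.QRep F} : M.dim = 0 ↔ M.IsZero := by
  simp only [dim, Finset.sum_eq_zero_iff, Finset.mem_univ, true_implies, IsZero]
  exact forall_congr' fun s => Module.finrank_zero_iff

theorem QRep.exists_indecomposable_summand {M : D.QRep F} (hM : 𝟙 M ≠ 0) :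
    ∃ (L : D.QRep F) (j : L ⟶ M) (p : M ⟶ L), L.Indecomposable ∧ j ≫ p = 𝟙 L := by
  induction hn : M.dim using Nat.strong_induction_on generalizing M with
  | _ n ih =>
    by_cases hi : M.Indecomposable
    · exact ⟨M, 𝟙 M, 𝟙 M, hi, by simp⟩
    · have : ∃ B C : D.QRep F, M.Isomorphic (B.prod C) ∧ ¬ B.IsZero ∧ ¬ C.IsZero := by
        by_contra! h
        exact hi ⟨fun h => hM (isZero_iff.1 h), fun B C hBC => or_iff_not_imp_left.2 (h B C hBC)⟩
      obtain ⟨B, C, hBC, hB, hC⟩ := this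
      obtain ⟨φ⟩ := isomorphic_iff.1 hBC
      have hd := dim_eq_of_iso φ
      rw [dim_prod] at hd
      rw [← dim_eq_zero] at hC
      obtain ⟨L, j, p, hL, hjp⟩ := ih B.dim (by omega) (fun h => hB (isZero_iff.2 h)) rfl
      exact ⟨L, j ≫ inl B C ≫ φ.inv, φ.hom ≫ fst B C ≫ p, hL, by
        simp [reassoc_of% inl_fst B C, hjp]⟩

/-! ### Fitting's lemma -/

theorem QRep.app_pow {M : D.QRep F} (f : CategoryTheory.End M) (n : ℕ) (s) :
    app (f ^ n : CategoryTheory.End M) s = (app f s) ^ n := by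
  induction n with
  | zero => rfl
  | succ n ih =>
    rw [pow_succ, pow_succ, ← ih]
    rfl

/-- Fitting's lemma: for large `n` each space is the direct sum of the range and the kernel of `f ^
n`, and `e` is the projection on the range along the kernel. On the range `f ^ n` is injective, and
on the kernel `1 - e` is the identity. -/
theorem QRep.exists_fitting {M : D.QRep F} (f : CategoryTheory.End M) :
    ∃ (n : ℕ) (e : CategoryTheory.End M), 1 ≤ n ∧ e * e = e ∧ f ^ n * e = f ^ n ∧
      IsUnit (f ^ n + (1 - e)) := by
  -- There are finitely many vertices, so one exponent serves all of them.
  have h : ∀ᶠ n in Filter.atTop, (∀ s, IsCompl (LinearMap.ker ((app f s) ^ n))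
      (LinearMap.range ((app f s) ^ n))) ∧ 1 ≤ n :=
    (Filter.eventually_all.2 fun s =>
      LinearMap.eventually_isCompl_ker_pow_range_pow (app f s)).and (Filter.eventually_ge_atTop 1)
  obtain ⟨n, hn, h1⟩ := h.exists
  simp only [← app_pow] at hn
  set g : CategoryTheory.End M := f ^ n with hg
  have hn' := fun s => (hn s).symm
  have hp1 : ∀ s, ∀ x ∈ LinearMap.range (app g s), Submodule.projection _ _ (hn' s) x = x :=
    fun s x hx =>
    Submodule.projection_apply_of_mem_left (hn' s) hx
  have hp0 : ∀ s, ∀ x ∈ LinearMap.ker (app g s), Submodule.projection _ _ (hn' s) x = 0 :=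
    fun s x hx =>
    (Submodule.projection_apply_eq_zero_iff (hn' s)).2 hx
  have hdec : ∀ s (x : M.V s), ∃ y z, app g s z = 0 ∧ x = app g s y + z := fun s x => by
    have : x ∈ LinearMap.range (app g s) ⊔ LinearMap.ker (app g s) := by
      rw [(hn' s).sup_eq_top]; trivial
    obtain ⟨_, ⟨y, rfl⟩, z, hz, rfl⟩ := Submodule.mem_sup.1 this
    exact ⟨y, z, hz, rfl⟩
  -- The projections commute with the structure maps because these maps preserve the ranges and the
  -- kernels of `g`.
  let e : CategoryTheory.End M := homMk
      (fun s => Submodule.projection _ _ (hn' s)) fun {s t} a x => by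
    obtain ⟨y, z, hz, rfl⟩ := hdec s x
    rw [map_add, map_add, map_add, hp1 s _ ⟨y, rfl⟩, hp0 s z hz, ← app_map, hp1 t _ ⟨_, rfl⟩,
      hp0 t _ (by rw [LinearMap.mem_ker, app_map, hz, map_zero]), add_zero, add_zero, app_map]
  have he1 : ∀ s y, app e s (app g s y) = app g s y := fun s y => hp1 s _ ⟨y, rfl⟩
  have he0 : ∀ s z, app g s z = 0 → app e s z = 0 := fun s z hz => hp0 s z hz
  refine ⟨n, e, h1, ?_, ?_, ?_⟩
  · refine hom_ext fun s x => ?_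
    change app e s (app e s x) = app e s x
    obtain ⟨y, z, hz, rfl⟩ := hdec s x
    rw [map_add, he1, he0 s z hz, add_zero, he1]
  · refine hom_ext fun s x => ?_
    change app g s (app e s x) = app g s x
    obtain ⟨y, z, hz, rfl⟩ := hdec s x
    rw [map_add, he1, he0 s z hz, add_zero, map_add, hz, add_zero]
  · refine (isUnit_iff_isIso _).2 ?_
    refine isIso_of_bijective _ fun s => ?_
    have hinj : Function.Injective (app (g + (1 - e) : CategoryTheory.End M) s) := by
      rw [injective_iff_map_eq_zero]
      intro x hx
      change app g s x + (x - app e s x) = 0 at hx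
      obtain ⟨y, z, hz, rfl⟩ := hdec s x
      rw [map_add, map_add, he1, he0 s z hz, hz, add_zero, add_zero, add_sub_cancel_left] at hx
      have hz2 : z = app g s (-(app g s y)) := by rw [map_neg]; exact eq_neg_of_add_eq_zero_right hx
      have hz0 : z = 0 := by
        rw [← he0 s z hz]
        conv_lhs => rw [hz2]
        rw [← he1, ← hz2]
      rw [hz0, add_zero] at hx
      have := he0 s _ hx
      rw [he1] at this
      rw [this, hz0, add_zero]
    exact ⟨hinj, LinearMap.injective_iff_surjective.1 hinj⟩

/-- The Fitting idempotent of `f` is trivial: if it is `0`, then `f ^ n = 0`; if it is `1`, then `f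
^ n` is a unit. -/
theorem QRep.Indecomposable.isUnit_or_isNilpotent {M : D.QRep F} (hM : M.Indecomposable)
    (f : CategoryTheory.End M) : IsUnit f ∨ IsNilpotent f := by
  obtain ⟨n, e, hn, he, hfe, hu⟩ := exists_fitting f
  rcases (indecomposable_iff.1 hM).2 e he with h | h
  · right
    change e = (0 : CategoryTheory.End M) at h
    exact ⟨n, by rw [← hfe, h, mul_zero]⟩
  · left
    change e = (1 : CategoryTheory.End M) at h
    rw [h, sub_self, add_zero] at hu
    exact (isUnit_pow_iff (by omega)).1 hu

/-- The endomorphism ring is local: after normalizing the sum to `1`, one summand is a unit or is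
nilpotent, and in the latter case the other one is `1` minus a nilpotent. -/
theorem QRep.Indecomposable.isUnit_or_isUnit {M : D.QRep F} (hM : M.Indecomposable)
    {f g : CategoryTheory.End M} (h : IsUnit (f + g)) : IsUnit f ∨ IsUnit g := by
  obtain ⟨v, hv⟩ := h
  have h1 : (↑v⁻¹ * f : CategoryTheory.End M) + ↑v⁻¹ * g = 1 := by
    rw [← mul_add, ← hv, Units.inv_mul]
  rcases hM.isUnit_or_isNilpotent (↑v⁻¹ * f) with h | h
  · exact Or.inl ((Units.isUnit_units_mul _ _).1 h)
  · right
    have := h.isUnit_one_sub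
    rw [← h1, add_sub_cancel_left] at this
    exact (Units.isUnit_units_mul _ _).1 this

/-! ### The radical of the category -/

/-- The radical morphisms: no composition `L → X → Y → L` is an isomorphism, where `L` is
indecomposable. -/
def QRep.IsRad {X Y : D.QRep F} (f : X ⟶ Y) : Prop :=
  ∀ (L : D.QRep F), L.Indecomposable → ∀ (a : L ⟶ X) (b : Y ⟶ L), ¬ IsIso (a ≫ f ≫ b)

theorem QRep.IsRad.comp_left {X Y Z : D.QRep F} {f : Y ⟶ Z} (hf : IsRad f) (g : X ⟶ Y) :
    IsRad (g ≫ f) := fun L hL a b h => hf L hL (a ≫ g) b (by simpa using h)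

theorem QRep.IsRad.comp_right {X Y Z : D.QRep F} {f : X ⟶ Y} (hf : IsRad f) (g : Y ⟶ Z) :
    IsRad (f ≫ g) := fun L hL a b h => hf L hL a (g ≫ b) (by simpa using h)

/-- Locality of `End L` enters here; together with the two composition lemmas it makes the radical
an ideal of the category. -/
theorem QRep.IsRad.add {X Y : D.QRep F} {f g : X ⟶ Y} (hf : IsRad f) (hg : IsRad g) :
    IsRad (f + g) := fun L hL a b h => by
  let f' : CategoryTheory.End L := a ≫ f ≫ b
  let g' : CategoryTheory.End L := a ≫ g ≫ b
  have h' : IsUnit (f' + g') := by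
    rw [isUnit_iff_isIso]
    have : a ≫ (f + g) ≫ b = a ≫ f ≫ b + a ≫ g ≫ b := by simp
    rwa [this] at h
  rcases hL.isUnit_or_isUnit h' with h | h
  · exact hf L hL a b ((isUnit_iff_isIso _).1 h)
  · exact hg L hL a b ((isUnit_iff_isIso _).1 h)

theorem QRep.IsRad.neg {X Y : D.QRep F} {f : X ⟶ Y} (hf : IsRad f) : IsRad (-f) := by
  have := hf.comp_left (-𝟙 X)
  simpa using this

theorem QRep.IsRad.sub {X Y : D.QRep F} {f g : X ⟶ Y} (hf : IsRad f) (hg : IsRad g) :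
    IsRad (f - g) := by
  rw [sub_eq_add_neg]; exact hf.add hg.neg

theorem QRep.not_isIso_zero {L : D.QRep F} (hL : L.Indecomposable) :
    ¬ IsIso (0 : L ⟶ L) := fun h => (indecomposable_iff.1 hL).1 (by
  rw [← IsIso.hom_inv_id (0 : L ⟶ L), Limits.zero_comp])

theorem QRep.isRad_zero {X Y : D.QRep F} : IsRad (0 : X ⟶ Y) := fun L hL a b h =>
  not_isIso_zero hL (by simpa using h)

theorem QRep.isRad_sum {X Y : D.QRep F} {κ : Type*} (s : Finset κ) (f : κ → (X ⟶ Y))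
    (h : ∀ k ∈ s, IsRad (f k)) : IsRad (∑ k ∈ s, f k) :=
  Finset.sum_induction _ IsRad (fun _ _ => IsRad.add) isRad_zero h

/-- A nonzero range of `e` would have an indecomposable summand, whose identity would factor through
`e`. -/
theorem QRep.IsRad.eq_zero_of_idempotent {X : D.QRep F} {e : X ⟶ X} (he : IsRad e)
    (h : e ≫ e = e) : e = 0 := by
  obtain ⟨N, j, p, hjp, rfl⟩ := exists_split e h
  by_cases hN : 𝟙 N = 0
  · rw [← Category.id_comp j, hN]; simp
  · obtain ⟨L, a, b, hL, hab⟩ := exists_indecomposable_summand hN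
    refine absurd ?_ (he L hL (a ≫ j) (p ≫ b))
    have : (a ≫ j) ≫ (p ≫ j) ≫ p ≫ b = 𝟙 L := by
      simp [reassoc_of% hjp, hab]
    rw [this]
    infer_instance

theorem QRep.IsRad.pow {X : D.QRep F} {f : CategoryTheory.End X}
    (hf : IsRad (X := X) (Y := X) f) {n : ℕ}
    (hn : 1 ≤ n) : IsRad (X := X) (Y := X) (f ^ n : CategoryTheory.End X) := by
  obtain ⟨n, rfl⟩ := Nat.exists_eq_add_of_le' hn
  rw [pow_succ]
  exact hf.comp_right _

/-- The Fitting idempotent of `f` is a multiple of `f ^ n` with `n ≥ 1`, so it is radical and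
therefore zero. No indecomposability of `X` is needed. -/
theorem QRep.IsRad.isNilpotent {X : D.QRep F} {f : CategoryTheory.End X}
    (hf : IsRad (X := X) (Y := X) f) :
    IsNilpotent f := by
  obtain ⟨n, e, hn, he, hfe, v, hv⟩ := exists_fitting f
  have h1 : (↑v : CategoryTheory.End X) * e = f ^ n := by
    rw [hv, add_mul, sub_mul, one_mul, he, sub_self, add_zero, hfe]
  have h2 : e = ↑v⁻¹ * f ^ n := by rw [← h1, Units.inv_mul_cancel_left]
  have h3 : IsRad (X := X) (Y := X) e := by
    rw [h2]
    exact (hf.pow hn).comp_right _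
  have h4 : e = (0 : CategoryTheory.End X) := h3.eq_zero_of_idempotent he
  exact ⟨n, by rw [← hfe, h4, mul_zero]⟩

/-- After rescaling `c`, the composition `c' ≫ a` is a nonzero idempotent of `M`, hence the
identity. -/
theorem QRep.Indecomposable.isIso_of_isIso_comp {L M : D.QRep F} (hL : L.Indecomposable)
    (hM : M.Indecomposable) (a : L ⟶ M) (c : M ⟶ L) [IsIso (a ≫ c)] : IsIso a ∧ IsIso c := by
  set c' := c ≫ inv (a ≫ c) with hc'
  have h1 : a ≫ c' = 𝟙 L := by rw [hc', ← Category.assoc, IsIso.hom_inv_id]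
  have h2 : c' ≫ a = 𝟙 M := by
    refine ((indecomposable_iff.1 hM).2 (c' ≫ a) (by simp [reassoc_of% h1])).resolve_left
      fun h => (indecomposable_iff.1 hL).1 ?_
    have := congrArg (fun z => a ≫ z ≫ c') h
    simpa [reassoc_of% h1, h1] using this
  have ha : IsIso a := ⟨c', h1, h2⟩
  exact ⟨ha, IsIso.of_isIso_comp_left a c⟩

/-- If `a ≫ f ≫ b` is an isomorphism of `L`, then `a` and `f ≫ b` are isomorphisms by
indecomposability of `M`. So `f ≫ b ≫ a` is one as well, and this forces `f` to be invertible. -/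
theorem QRep.isRad_of_not_isIso {M N : D.QRep F} (hM : M.Indecomposable) (hN : N.Indecomposable)
    {f : M ⟶ N} (hf : ¬ IsIso f) : IsRad f := fun L hL a b h => hf <| by
  have h1 := hL.isIso_of_isIso_comp hM a (f ≫ b)
  have h2 := h1.1
  have h3 := h1.2
  have h4 : IsIso (f ≫ b ≫ a) := by
    rw [← Category.assoc]; infer_instance
  exact (hM.isIso_of_isIso_comp hN f (b ≫ a)).1

theorem QRep.Indecomposable.isRad_iff {M : D.QRep F} (hM : M.Indecomposable) {f : M ⟶ M} :
    IsRad f ↔ ¬ IsIso f :=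
  ⟨fun h hf => h M hM (𝟙 M) (𝟙 M) (by simpa using hf), isRad_of_not_isIso hM hM⟩

theorem QRep.isRad_of_isEmpty_iso {M N : D.QRep F} (hM : M.Indecomposable)
    (hN : N.Indecomposable) (h : ¬ Nonempty (M ≅ N)) (f : M ⟶ N) : IsRad f :=
  isRad_of_not_isIso hM hN fun _ => h ⟨asIso f⟩

/-! ### Division by two -/

/-- The multiplication by `1 / 2`. -/
def QRep.half (M : D.QRep F) : CategoryTheory.End M :=
  homMk (fun s =>
    { toFun := fun x => MulOpposite.op (2⁻¹ : F) • x
      map_add' := fun x y => smul_add _ _ _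
      -- Multiplication by a scalar is linear only if the scalar is central; `2⁻¹` is central
      -- because `2` is.
      map_smul' := fun c x => by
        rw [RingHom.id_apply, smul_smul, smul_smul]
        congr 1
        apply MulOpposite.unop_injective
        rw [MulOpposite.unop_mul, MulOpposite.unop_mul, MulOpposite.unop_op]
        exact (Commute.inv_right₀ (Commute.ofNat_right (MulOpposite.unop c) 2)).eq })
    fun a x => (map_smul (M.map a) _ x).symm

theorem QRep.isUnit_two (h2 : (2 : F) ≠ 0) (M : D.QRep F) : IsUnit (2 : CategoryTheory.End M) := by
  have h : (2 : CategoryTheory.End M) * M.half = 1 := by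
    rw [two_mul]
    refine hom_ext fun s x => ?_
    change MulOpposite.op (2⁻¹ : F) • x + MulOpposite.op (2⁻¹ : F) • x = x
    rw [← add_smul, ← MulOpposite.op_add, ← two_mul, mul_inv_cancel₀ h2, MulOpposite.op_one,
      one_smul]
  exact ⟨⟨2, M.half, h, by rw [← h]; exact (Commute.ofNat_right _ 2)⟩, rfl⟩

end Dograph

/-! ### Square roots in rings with involution -/

section SquareRoot

open Polynomial

/-- The approximations of the generating function of the Catalan numbers. -/
def catalanApprox : ℕ → ℤ[X]
  | 0 => 0
  | n + 1 => 1 + X * catalanApprox n ^ 2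

/-- For `P ↦ 1 + X P²`, the difference of two values is `X (P - Q) (P + Q)`, so each iteration gains
a factor `X`. At a nilpotent argument the iteration becomes an exact solution of `C = 1 + z C²`. -/
theorem X_pow_dvd_catalanApprox (n : ℕ) :
    (X : ℤ[X]) ^ n ∣ catalanApprox (n + 1) - catalanApprox n := by
  induction n with
  | zero => simp
  | succ n ih =>
    have : catalanApprox (n + 1 + 1) - catalanApprox (n + 1) =
        X * (catalanApprox (n + 1) - catalanApprox n) *
          (catalanApprox (n + 1) + catalanApprox n) := by
      conv_lhs => rw [catalanApprox]
      conv_lhs =>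
        enter [2]
        rw [catalanApprox]
      ring
    rw [this, pow_succ']
    exact Dvd.dvd.mul_right (mul_dvd_mul_left X ih) _

variable {S : Type*} [Ring S] [StarRing S]

theorem star_aeval_int {z : S} (hz : star z = z) (p : ℤ[X]) : star (aeval z p) = aeval z p := by
  induction p using Polynomial.induction_on' with
  | add p q hp hq => rw [map_add, star_add, hp, hq]
  | monomial n a =>
    rw [aeval_monomial, star_mul, star_pow, hz]
    simp only [algebraMap_int_eq, eq_intCast, star_intCast]
    exact (Int.cast_commute a _).symm

/-- With `z = -r/4` and `C = 1 + z C²`, one has `(1 - 2zC)² = 1 - 4zC + 4z(C - 1) = 1 - 4z = 1 + r`.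
The Catalan polynomials have integer coefficients, so `2` is the only integer to be inverted, and
the root is selfadjoint as an integer polynomial in the selfadjoint `r/4`. -/
theorem exists_selfadjoint_sqrt (h2 : IsUnit (2 : S)) {r : S} (hr : IsNilpotent r)
    (hs : star r = r) : ∃ v : Sˣ, star (v : S) = v ∧ (v * v : S) = 1 + r := by
  obtain ⟨u, hu⟩ := h2
  set t : S := ↑u⁻¹ with ht
  have ht2 : 2 * t = 1 := by rw [← hu, ht, Units.mul_inv]
  have htc : ∀ x : S, Commute t x := fun x => by
    have : Commute (u : S) x := by rw [hu]; exact Commute.ofNat_left 2 x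
    exact this.units_inv_left
  have hts : star t = t := by
    have h1 : star t * 2 = 1 := by
      have := congrArg star ht2
      simpa using this
    calc star t = star t * (2 * t) := by rw [ht2, mul_one]
      _ = t := by rw [← mul_assoc, h1, one_mul]
  obtain ⟨n, hn⟩ := hr
  set z : S := -(t * t * r) with hz
  have hzs : star z = z := by
    rw [hz, star_neg, star_mul, star_mul, hs, hts]
    rw [(((htc r).mul_left (htc r)).eq)]
  have hzn : z ^ n = 0 := by
    rw [hz, neg_pow, Commute.mul_pow ((htc r).mul_left (htc r)), hn, mul_zero, mul_zero]
  have h4z : 4 * z = -r := by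
    have : (4 : S) * (t * t) = 1 := by
      have h4 : (4 : S) = 2 * 2 := by norm_num
      rw [h4, mul_assoc, ← mul_assoc 2 t t, ht2, one_mul, ht2]
    rw [hz, mul_neg, ← mul_assoc, this, one_mul]
  set C : S := aeval z (catalanApprox n) with hC
  have hCz : 1 + z * (C * C) = C := by
    obtain ⟨q, hq⟩ := X_pow_dvd_catalanApprox n
    have := congrArg (aeval z) hq
    rw [map_sub, map_mul, map_pow, aeval_X, hzn, zero_mul, sub_eq_zero, catalanApprox, map_add,
      map_one, map_mul, map_pow, aeval_X, ← hC, pow_two] at this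
    exact this
  have hcomm : Commute z C := by
    have h : Commute (aeval z (X : ℤ[X])) (aeval z (catalanApprox n)) :=
      (Commute.all (X : ℤ[X]) _).map (aeval z)
    rwa [aeval_X] at h
  have hvs : star (1 - 2 * (z * C)) = 1 - 2 * (z * C) := by
    rw [star_sub, star_one, star_mul, star_mul, hzs, hC, star_aeval_int hzs, ← hC, star_ofNat,
      hcomm.eq]
    rw [(Commute.ofNat_right (C * z) 2).eq]
  have hv : (1 - 2 * (z * C)) * (1 - 2 * (z * C)) = 1 + r := by
    have h1 : (1 - 2 * (z * C)) * (1 - 2 * (z * C)) =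
        1 - 4 * (z * C) + 4 * (z * (C * z * C)) := by noncomm_ring
    rw [h1, ← hcomm.eq, mul_assoc z C C]
    have h3 : z * (C * C) = C - 1 := eq_sub_of_add_eq' hCz
    rw [h3]
    have h2 : 1 - 4 * (z * C) + 4 * (z * (C - 1)) = 1 - 4 * z := by noncomm_ring
    rw [h2, h4z, sub_neg_eq_add]
  have hunit : IsUnit (1 - 2 * (z * C)) := by
    rw [← isUnit_pow_iff two_ne_zero, pow_two, hv]
    exact IsNilpotent.isUnit_one_add ⟨n, hn⟩
  obtain ⟨v, hv'⟩ := hunit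
  exact ⟨v, by rw [hv', hvs], by rw [hv', hv]⟩

theorem exists_half (h2 : IsUnit (2 : S)) :
    ∃ t : S, t + t = 1 ∧ star t = t ∧ ∀ x, t * x = x * t := by
  obtain ⟨u, hu⟩ := h2
  have ht2 : 2 * (↑u⁻¹ : S) = 1 := by rw [← hu, Units.mul_inv]
  refine ⟨↑u⁻¹, by rw [← two_mul, ht2], ?_, fun x => ?_⟩
  · have h1 : star (↑u⁻¹ : S) * 2 = 1 := by
      have := congrArg star ht2
      simpa using this
    calc star (↑u⁻¹ : S) = star (↑u⁻¹ : S) * (2 * ↑u⁻¹) := by rw [ht2, mul_one]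
      _ = ↑u⁻¹ := by rw [← mul_assoc, h1, one_mul]
  · have : Commute (u : S) x := by rw [hu]; exact Commute.ofNat_left 2 x
    exact this.units_inv_left.eq

/-- An idempotent `e` with `e° e` nilpotent is conjugate to one that is orthogonal to its
adjoint. -/
theorem exists_hyperbolic_idempotent (h2 : IsUnit (2 : S)) {e : S} (he : e * e = e)
    (hn : IsNilpotent (star e * e)) :
    ∃ x y : S, e * (y * x) * e = e ∧ star (x * e * y) * (x * e * y) = 0 ∧
      (x * e * y) * star (x * e * y) = 0 := by
  obtain ⟨t, ht2, hts, htc⟩ := exists_half h2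
  -- Take `v² = 1 - e°e`. Then `e° v² e = e°e - e°e°ee = 0`, so the conjugate `f = v e v⁻¹`
  -- satisfies `f° f = 0`.
  obtain ⟨v, hvs, hvv⟩ := exists_selfadjoint_sqrt h2 hn.neg (by simp)
  have hws : star (↑v⁻¹ : S) = ↑v⁻¹ := by
    have h1 : star (↑v⁻¹ : S) * v = 1 := by
      have := congrArg star (v.mul_inv)
      rw [star_mul, hvs, star_one] at this
      exact this
    calc star (↑v⁻¹ : S) = star (↑v⁻¹ : S) * (v * ↑v⁻¹) := by rw [v.mul_inv, mul_one]
      _ = ↑v⁻¹ := by rw [← mul_assoc, h1, one_mul]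
  have hes : star e * star e = star e := by rw [← star_mul, he]
  have hev : star e * (v * (v * e)) = 0 := by
    rw [← mul_assoc (v : S), hvv, add_mul, one_mul, neg_mul, mul_add, mul_neg, mul_assoc, he,
      ← mul_assoc (star e), hes, add_neg_cancel]
  set f : S := v * e * ↑v⁻¹ with hf
  have hff : f * f = f := by
    rw [hf]
    simp only [mul_assoc, Units.inv_mul_cancel_left]
    rw [← mul_assoc e e, he]
  have hfs : star f = ↑v⁻¹ * (star e * v) := by rw [hf, star_mul, star_mul, hws, hvs]
  have hffs : star f * star f = star f := by rw [← star_mul, hff]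
  have hf0 : star f * f = 0 := by
    rw [hfs, hf]
    have : (↑v⁻¹ * (star e * v)) * (v * e * ↑v⁻¹) =
        ↑v⁻¹ * (star e * (v * (v * e))) * (↑v⁻¹ : S) := by
      simp only [mul_assoc]
    rw [this, hev, mul_zero, zero_mul]
  -- The correction `g = f - ½ f f°` keeps `g° g = 0` and also gives `g g° = f f° - ½ f f° - ½ f f°
  -- + ¼ f (f° f) f° = 0`.
  have hxy : v * e * (↑v⁻¹ * (1 - t * star f)) = f * (1 - t * star f) := by
    simp only [hf, mul_assoc]
  refine ⟨v, ↑v⁻¹ * (1 - t * star f), ?_, ?_, ?_⟩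
  -- Since `f°` kills `v e`, the correction factor is invisible in `e (y x) e`.
  · have h1 : star f * (v * e) = 0 := by
      rw [hfs, mul_assoc, mul_assoc, hev, mul_zero]
    have h3 : e * (↑v⁻¹ * (1 - t * star f) * v) * e =
        e * (↑v⁻¹ * (v * e)) - e * (↑v⁻¹ * (t * (star f * (v * e)))) := by
      simp only [mul_sub, sub_mul, mul_assoc, one_mul]
    rw [h3, h1, Units.inv_mul_cancel_left, he]
    simp
  · rw [hxy, star_mul, mul_assoc, ← mul_assoc (star f), hf0]
    simp
  · have e0 : star (f * (1 - t * star f)) = (1 - f * t) * star f := by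
      conv_lhs => rw [star_mul, star_sub, star_one, star_mul, star_star, hts]
    rw [hxy, e0]
    have h1 : f * (1 - t * star f) * ((1 - f * t) * star f) =
        f * star f - t * (f * (star f * star f)) - t * (f * f * star f) +
          t * (f * (star f * f) * (t * star f)) := by
      have e1 : f * t = t * f := (htc f).symm
      have e2 : star f * t = t * star f := (htc _).symm
      have e3 : f * (t * star f) = t * (f * star f) := by rw [← mul_assoc, e1, mul_assoc]
      rw [e1]
      simp only [mul_sub, sub_mul, mul_assoc, one_mul, mul_one, e3]
      have e4 : ∀ x : S, f * (t * x) = t * (f * x) := fun x => by rw [← mul_assoc, e1, mul_assoc]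
      have e5 : ∀ x : S, star f * (t * x) = t * (star f * x) := fun x => by
        rw [← mul_assoc, e2, mul_assoc]
      simp only [e4, e5]
      abel
    rw [h1, hffs, hff, hf0]
    have h3 : f * star f - t * (f * star f) - t * (f * star f) + t * (f * 0 * (t * star f)) =
      (1 - (t + t)) * (f * star f) := by noncomm_ring
    rw [h3, ht2, sub_self, zero_mul]

end SquareRoot

namespace Dograph

variable {D : Dograph.{w}} {F : Type u} [DivisionRing F] [StarRing F]

open QRep

/-! ### Orthogonal summands -/

theorem vert_congr {A B : D.Rep F} {f g : A.under ⟶ B.under} (h : f = g) (i) (x : A.V i) :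
    vert f i x = vert g i x := by rw [h]

/-- Selfadjoint idempotents are the projections on orthogonal summands. -/
theorem exists_isometry {X : D.Rep F} {g : X.under ⟶ X.under} (hg : g ≫ g = g)
    (hs : dag g = g) :
    ∃ (Y : D.Rep F) (j : Y.under ⟶ X.under), j ≫ dag j = 𝟙 _ ∧ dag j ≫ j = g := by
  have hgg : ∀ i x, vert g i (vert g i x) = vert g i x := fun i x => vert_congr hg i x
  have ha : ∀ a : D.Arrow, ∀ x ∈ LinearMap.range (vert g (D.arrSrc a)),
      X.arr a x ∈ LinearMap.range (vert g (D.arrTgt a)) := by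
    rintro a _ ⟨x, rfl⟩
    exact ⟨X.arr a x, vert_arr g a x⟩
  let j := fun i => (LinearMap.range (vert g i)).subtype
  let p := fun i => (vert g i).rangeRestrict
  have hjp : ∀ i x, j i (p i x) = vert g i x := fun i x => rfl
  have hgj : ∀ i x, vert g i (j i x) = j i x := by
    rintro i ⟨_, x, rfl⟩
    exact hgg i x
  have hpg : ∀ i x, p i (vert g i x) = p i x := fun i x => Subtype.ext (hgg i x)
  have hpj : ∀ i x, p i (j i x) = x := fun i x => Subtype.ext (hgj i x)
  -- The forms on `V_i × V_j` are restricted to the ranges, while for those on the dual spaces a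
  -- functional on a range is first extended through the projection `p`.
  let Y : D.Rep F :=
    { V := fun i => LinearMap.range (vert g i)
      arr := fun a => (X.arr a).restrict (ha a)
      line := fun b => SesqForm.ofMap (starMap (j _) ∘ₗ (X.line b).toMap ∘ₗ j _)
      bi := fun c => SesqForm.ofMap (starMap (starMap (p _)) ∘ₗ (X.bi c).toMap ∘ₗ starMap (p _)) }
  have hstar : ∀ i (φ : StarDual F (Y.V i)),
      starMap (vert g i) (starMap (p i) φ) = starMap (p i) φ := fun i φ =>
    LinearMap.ext fun x => congrArg φ (hpg i x)
  have hstar' : ∀ i (φ : StarDual F (X.V i)),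
      starMap (p i) (starMap (j i) φ) = starMap (vert g i) φ := fun i φ => rfl
  obtain ⟨f, hf1, hf2⟩ : ∃ f : Y.under ⟶ X.under, (∀ i x, vert f i x = j i x) ∧
      ∀ i x, vert (dag f) i x = p i x := by
    refine exists_hom (A := Y) j p (fun a x => rfl) (fun a y => Subtype.ext (vert_arr g a y))
      ?_ ?_ ?_ ?_
    · intro b x y
      change X.line b (j _ x) y = X.line b (j _ x) (vert g _ y)
      rw [line_vert_right, hs, hgj]
    · intro b x y
      change X.line b x (j _ y) = X.line b (vert g _ x) (j _ y)
      rw [line_vert_left, hs, hgj]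
    · intro c φ ψ
      change X.bi c (starMap (p _) (starMap (j _) φ)) (starMap (p _) ψ) = _
      rw [hstar', bi_vert_left, hs, hstar]
    · intro c φ ψ
      change X.bi c (starMap (p _) φ) (starMap (p _) (starMap (j _) ψ)) = _
      rw [hstar', bi_vert_right, hs, hstar]
  have h1 : ∀ i x, vert (f ≫ dag f) i x = x := fun i x => by
    rw [vert_comp, hf1, hf2, hpj]
  have h2 : ∀ i x, vert (dag f ≫ f) i x = vert g i x := fun i x => by
    rw [vert_comp, hf1, hf2, hjp]
  exact ⟨Y, f, under_ext h1 fun i x => by rw [dag_comp, dag_dag, h1, dag_id, vert_id],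
    under_ext h2 fun i x => by rw [dag_comp, dag_dag, h2, hs]⟩

/-- `X` is the orthogonal sum of the family `Y`. -/
def IsOrthoSum {κ : Type*} [Fintype κ] (X : D.Rep F) (Y : κ → D.Rep F) : Prop :=
  ∃ inc : ∀ k, (Y k).under ⟶ X.under, (∀ k, inc k ≫ dag (inc k) = 𝟙 _) ∧
    (∀ k l, k ≠ l → inc k ≫ dag (inc l) = 0) ∧ ∑ k, dag (inc k) ≫ inc k = 𝟙 _

theorem starMap_single_proj {ι : Type} [DecidableEq ι] {V : ι → Type u}
    [∀ k, AddCommGroup (V k)] [∀ k, Module Fᵐᵒᵖ (V k)]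
    (k : ι) (φ : StarDual F (V k)) :
    starMap (LinearMap.single Fᵐᵒᵖ V k) (starMap (LinearMap.proj (φ := V) k) φ) = φ :=
  LinearMap.ext fun x => by simp

theorem starMap_single_proj_of_ne {ι : Type} [DecidableEq ι] {V : ι → Type u}
    [∀ k, AddCommGroup (V k)]
    [∀ k, Module Fᵐᵒᵖ (V k)] {k l : ι} (φ : StarDual F (V k)) (h : l ≠ k) :
    starMap (LinearMap.single Fᵐᵒᵖ V l) (starMap (LinearMap.proj (φ := V) k) φ) = 0 :=
  LinearMap.ext fun x => by simp [Pi.single_eq_of_ne h.symm]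

section DirectSum

variable {ι : Type} [Fintype ι] [DecidableEq ι] (Y : ι → D.Rep F)

theorem directSum_line (b : D.Line) (x : ∀ k, (Y k).V (D.lineFst b))
    (y : ∀ k, (Y k).V (D.lineSnd b)) :
    (Rep.directSum Y).line b x y = ∑ k, (Y k).line b (x k) (y k) := by
  change (∑ k, starMap (LinearMap.proj k) ∘ₗ ((Y k).line b).toMap ∘ₗ LinearMap.proj k) y x = _
  rw [LinearMap.sum_apply, LinearMap.sum_apply]
  rfl

theorem directSum_bi (c : D.Biarrow) (φ : StarDual F (∀ k, (Y k).V (D.biFst c)))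
    (ψ : StarDual F (∀ k, (Y k).V (D.biSnd c))) :
    (Rep.directSum Y).bi c φ ψ = ∑ k, (Y k).bi c
      (starMap (LinearMap.single Fᵐᵒᵖ (fun k => (Y k).V (D.biFst c)) k) φ)
      (starMap (LinearMap.single Fᵐᵒᵖ (fun k => (Y k).V (D.biSnd c)) k) ψ) := by
  change (∑ k, starMap (starMap (LinearMap.single Fᵐᵒᵖ (fun k => (Y k).V (D.biFst c)) k)) ∘ₗ
    ((Y k).bi c).toMap ∘ₗ starMap (LinearMap.single Fᵐᵒᵖ (fun k => (Y k).V (D.biSnd c)) k)) ψ φ = _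
  rw [LinearMap.sum_apply, LinearMap.sum_apply]
  rfl

theorem exists_directSum_inc (k : ι) : ∃ f : (Y k).under ⟶ (Rep.directSum Y).under,
    (∀ i x, vert f i x = (LinearMap.single Fᵐᵒᵖ (fun k => (Y k).V i) k x : ∀ k, (Y k).V i)) ∧
    ∀ i (x : ∀ k, (Y k).V i), vert (dag f) i x = x k := by
  refine exists_hom (B := Rep.directSum Y) (fun i => LinearMap.single Fᵐᵒᵖ (fun k => (Y k).V i) k)
    (fun i => LinearMap.proj (φ := fun k => (Y k).V i) k) (fun a x => ?_) (fun a y => rfl)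
    (fun b x y => ?_) (fun b x y => ?_) (fun c φ ψ => ?_) (fun c φ ψ => ?_)
  · funext l
    change (Pi.single k ((Y k).arr a x) : ∀ l, (Y l).V _) l =
        (Y l).arr a ((Pi.single k x : ∀ l, (Y l).V _) l)
    exact (Pi.apply_single (fun l => (Y l).arr a) (fun l => map_zero _) k x l).symm
  · have key : ∑ l, (Y l).line b ((Pi.single k x : ∀ l, (Y l).V _) l)
        ((y : ∀ l, (Y l).V (D.lineSnd b)) l) = (Y k).line b x ((y : ∀ l, (Y l).V _) k) := by
      rw [Finset.sum_eq_single k]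
      · rw [Pi.single_eq_same]
      · intro l _ hl
        rw [Pi.single_eq_of_ne hl]
        simp
      · simp
    exact (directSum_line Y b _ _).trans key
  · have key : ∑ l, (Y l).line b ((x : ∀ l, (Y l).V (D.lineFst b)) l)
        ((Pi.single k y : ∀ l, (Y l).V _) l) = (Y k).line b ((x : ∀ l, (Y l).V _) k) y := by
      rw [Finset.sum_eq_single k]
      · rw [Pi.single_eq_same]
      · intro l _ hl
        rw [Pi.single_eq_of_ne hl]
        simp
      · simp
    exact (directSum_line Y b _ _).trans key
  · have key : ∑ l, (Y l).bi c
        (starMap (LinearMap.single Fᵐᵒᵖ (fun k => (Y k).V (D.biFst c)) l) φ)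
        (starMap (LinearMap.single Fᵐᵒᵖ (fun k => (Y k).V (D.biSnd c)) l)
          (starMap (LinearMap.proj (φ := fun k => (Y k).V (D.biSnd c)) k) ψ)) =
        (Y k).bi c (starMap (LinearMap.single Fᵐᵒᵖ (fun k => (Y k).V (D.biFst c)) k) φ) ψ := by
      rw [Finset.sum_eq_single k]
      · rw [starMap_single_proj]
      · intro l _ hl
        rw [starMap_single_proj_of_ne _ hl]
        simp
      · simp
    exact ((directSum_bi Y c _ _).trans key).symm
  · have key : ∑ l, (Y l).bi c
        (starMap (LinearMap.single Fᵐᵒᵖ (fun k => (Y k).V (D.biFst c)) l)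
          (starMap (LinearMap.proj (φ := fun k => (Y k).V (D.biFst c)) k) φ))
        (starMap (LinearMap.single Fᵐᵒᵖ (fun k => (Y k).V (D.biSnd c)) l) ψ) =
        (Y k).bi c φ (starMap (LinearMap.single Fᵐᵒᵖ (fun k => (Y k).V (D.biSnd c)) k) ψ) := by
      rw [Finset.sum_eq_single k]
      · rw [starMap_single_proj]
      · intro l _ hl
        rw [starMap_single_proj_of_ne _ hl]
        simp
      · simp
    exact ((directSum_bi Y c _ _).trans key).symm

theorem isOrthoSum_directSum : IsOrthoSum (Rep.directSum Y) Y := by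
  choose inc h1 h2 using exists_directSum_inc Y
  have e1 : ∀ k i x, vert (inc k ≫ dag (inc k)) i x = x := fun k i x => by
    rw [vert_comp, h1, h2]
    simp
  have e2 : ∀ k l, k ≠ l → ∀ i x, vert (inc k ≫ dag (inc l)) i x = 0 := fun k l hkl i x => by
    rw [vert_comp, h1, h2]
    simp [Pi.single_eq_of_ne hkl.symm]
  have e3 : ∀ i x, vert (∑ k, dag (inc k) ≫ inc k) i x = x := fun i x => by
    rw [vert_sum]
    simp only [vert_comp, h1]
    have : ∀ k, vert (dag (inc k)) i x = (x : ∀ k, (Y k).V i) k := fun k => h2 k i x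
    simp only [this]
    exact Finset.univ_sum_single (x : ∀ k, (Y k).V i)
  refine ⟨inc, fun k => ?_, fun k l hkl => ?_, ?_⟩
  · exact under_ext (e1 k) fun i x => by rw [dag_comp, dag_dag, e1, dag_id, vert_id]
  · exact under_ext (e2 k l hkl) fun i x => by
      rw [dag_comp, dag_dag, e2 l k hkl.symm, dag_zero, vert_zero]
  · refine under_ext e3 fun i x => ?_
    rw [dag_sum]
    simp only [dag_comp, dag_dag]
    rw [e3, dag_id, vert_id]

end DirectSum

/-! ### The representations `A^f` -/

/-- `A^f` has the spaces of `A`, and `θ` is the identity on them with adjoint `f⁻¹`. Thus `A^f` is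
`A̲` as a quiver representation, carrying `f` as Gram operator; all later arguments use only these
two identities and not the definition of the twist. -/
theorem exists_twist {A : D.Rep F} (f : (A.under.End)ˣ) (hf : star (f : A.under.End) = f) :
    ∃ θ : (A.twist f).under ⟶ A.under, θ ≫ A.under.toHom f ≫ dag θ = 𝟙 _ ∧
      dag θ ≫ θ = A.under.toHom (f⁻¹ : (A.under.End)ˣ) := by
  set f' : A.under ⟶ A.under := A.under.toHom f with hf'
  set g' : A.under ⟶ A.under := A.under.toHom (f⁻¹ : (A.under.End)ˣ) with hg'
  have hfg : f' ≫ g' = 𝟙 _ := toHom_comp_inv f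
  have hgf : g' ≫ f' = 𝟙 _ := toHom_inv_comp f
  have hfs : dag f' = f' := by rw [hf', ← toHom_star, hf]
  have hgs : dag g' = g' := by
    have := congrArg dag hfg
    rw [dag_comp, hfs, dag_id] at this
    calc dag g' = dag g' ≫ f' ≫ g' := by rw [hfg, Category.comp_id]
      _ = g' := by rw [reassoc_of% this]
  have hfg' : ∀ i x, vert g' i (vert f' i x) = x := fun i x => vert_congr hfg i x
  have hgf' : ∀ i x, vert f' i (vert g' i x) = x := fun i x => vert_congr hgf i x
  have hbi : ∀ c φ ψ, (A.twist f).bi c φ ψ = A.bi c (starMap (vert g' _) φ) ψ := fun c φ ψ => by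
    change star ((starMap (vert g' _) φ) ((starEvalEquiv F _).symm ((A.bi c).toMap ψ))) = _
    rw [apply_starEvalEquiv_symm, star_star]
    rfl
  have hline : ∀ b x y, (A.twist f).line b x y = A.line b x (vert f' _ y) := fun _ _ _ => rfl
  have hstar : ∀ i (φ : StarDual F (A.V i)),
      starMap (vert f' i) (starMap (vert g' i) φ) = φ := fun i φ =>
    LinearMap.ext fun x => congrArg φ (hfg' i x)
  obtain ⟨θ, h1, h2⟩ : ∃ θ : (A.twist f).under ⟶ A.under, (∀ i (x : A.V i), vert θ i x = x) ∧
      ∀ i x, vert (dag θ) i x = vert g' i x := by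
    refine exists_hom (A := A.twist f) (B := A) (fun i => LinearMap.id) (fun i => vert g' i)
      (fun a x => rfl) (fun a y => vert_arr g' a y) ?_ ?_ ?_ ?_
    · intro b x y
      change A.line b x y = A.line b x (vert f' _ (vert g' _ y))
      rw [hgf']
    · intro b x (y : A.V _)
      change A.line b x y = A.line b (vert g' _ x) (vert f' _ y)
      rw [line_vert_right, hfs, hgf']
    · intro c φ (ψ : StarDual F (A.V _))
      refine (hbi c _ ψ).trans ?_
      change A.bi c (starMap (vert g' _) φ) ψ = _
      rw [bi_vert_left, hgs]
      rfl
    · exact fun c φ ψ => hbi c φ _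
  have e1 : ∀ i x, vert (θ ≫ f' ≫ dag θ) i x = x := fun i x => by
    rw [vert_comp, vert_comp, h2]
    exact (hfg' i _).trans (h1 i x)
  have e2 : ∀ i x, vert (dag θ ≫ θ) i x = vert g' i x := fun i x => by
    rw [vert_comp, h2]
    exact h1 i _
  refine ⟨θ, under_ext e1 fun i x => ?_, under_ext e2 fun i x => ?_⟩
  · rw [dag_comp, dag_comp, dag_dag, hfs, Category.assoc, e1, dag_id, vert_id]
  · rw [dag_comp, dag_dag, e2, hgs]

/-! ### The representations `M^+` -/

/-- The map `V_j^* → V_i` of the form `M^+_γ`. -/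
def plusBiMap (M : D.QRep F) (c : D.Biarrow)
    (ψ : StarDual F (M.V (.vert (D.biSnd c)) × StarDual F (M.V (.dual (D.biSnd c))))) :
    M.V (.vert (D.biFst c)) × StarDual F (M.V (.dual (D.biFst c))) :=
  (M.map (QArrow.bi c) ((starEvalEquiv F _).symm (starMap (LinearMap.inr Fᵐᵒᵖ _ _) ψ)),
    starMap (M.map (QArrow.biDual c)) (starMap (LinearMap.inl Fᵐᵒᵖ _ _) ψ))

theorem plus_under_bi (M : D.QRep F) (c : D.Biarrow)
    (ψ : StarDual F (M.V (.vert (D.biSnd c)) × StarDual F (M.V (.dual (D.biSnd c))))) :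
    M.plus.under.map (QArrow.bi c) ψ = plusBiMap M c ψ :=
  (LinearEquiv.symm_apply_eq _).2 rfl

theorem apply_plus_under_biDual (M : D.QRep F) (c : D.Biarrow)
    (φ : StarDual F (M.V (.vert (D.biFst c)) × StarDual F (M.V (.dual (D.biFst c)))))
    (ψ : StarDual F (M.V (.vert (D.biSnd c)) × StarDual F (M.V (.dual (D.biSnd c))))) :
    ψ (M.plus.under.map (QArrow.biDual c) φ) = star (φ (plusBiMap M c ψ)) := by
  refine (apply_starEvalEquiv_symm ((M.plus.bi c).toMapStar φ) ψ).trans ?_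
  exact star_star (star (φ (plusBiMap M c ψ)))

/-- The inclusion `M → M^+`. -/
def plusInc (M : D.QRep F) : M ⟶ M.plus.under :=
  homMk (fun s => match s with
    | .vert i => LinearMap.inl Fᵐᵒᵖ (M.V (.vert i)) (StarDual F (M.V (.dual i)))
    | .dual i => starMap (LinearMap.snd Fᵐᵒᵖ (M.V (.vert i)) (StarDual F (M.V (.dual i)))) ∘ₗ
        (starEvalEquiv F (M.V (.dual i))).toLinearMap) fun {s t} a x => by
    change QArrow D s t at a
    cases a with
    | arr a => exact Prod.ext rfl (map_zero (starMap (M.map (QArrow.arrDual a)))).symm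
    | arrDual a => rfl
    | line b =>
      exact LinearMap.ext fun (y : _ × _) =>
        (zero_add (star (y.2 (M.map (QArrow.line b) x)))).symm
    | lineDual b =>
      refine LinearMap.ext fun (y : _ × _) => ?_
      change star (y.2 (M.map (QArrow.lineDual b) x)) =
        star (y.2 (M.map (QArrow.lineDual b) x) + star ((0 : StarDual F (M.V _)) _))
      simp
    | bi c =>
      refine Eq.trans ?_ (plus_under_bi M c _).symm
      refine Prod.ext ?_ ?_
      · exact congrArg (M.map (QArrow.bi c)) ((LinearEquiv.symm_apply_eq _).2 rfl).symm
      · exact LinearMap.ext fun y => (star_zero F).symm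
    | biDual c =>
      refine eq_of_starDual (F := F) (V := M.V (.vert _) × StarDual F (M.V (.dual _))) fun ψ => ?_
      refine Eq.trans ?_ (apply_plus_under_biDual M c _ ψ).symm
      exact (star_star _).symm

/-- The projection `M^+ → M`. -/
def plusProj (M : D.QRep F) : M.plus.under ⟶ M :=
  homMk (fun s => match s with
    | .vert i => LinearMap.fst Fᵐᵒᵖ (M.V (.vert i)) (StarDual F (M.V (.dual i)))
    | .dual i => (starEvalEquiv F (M.V (.dual i))).symm.toLinearMap ∘ₗ
        starMap (LinearMap.inr Fᵐᵒᵖ (M.V (.vert i)) (StarDual F (M.V (.dual i)))))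
    fun {s t} a x => by
    change QArrow D s t at a
    cases a with
    | arr a => rfl
    | arrDual a =>
      refine eq_of_starDual (F := F) fun ψ => ?_
      change StarDual F (M.V (.vert _) × StarDual F (M.V (.dual _))) at x
      change ψ ((starEvalEquiv F (M.V (.dual _))).symm _) =
        (starMap (M.map (QArrow.arrDual a)) ψ) ((starEvalEquiv F (M.V (.dual _))).symm _)
      rw [apply_starEvalEquiv_symm, apply_starEvalEquiv_symm]
      change star (x (M.map (QArrow.arr a) 0, starMap (M.map (QArrow.arrDual a)) ψ)) =
        star (x (0, starMap (M.map (QArrow.arrDual a)) ψ))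
      rw [map_zero]
    | line b =>
      refine eq_of_starDual (F := F) fun ψ => ?_
      change M.V (.vert _) × StarDual F (M.V (.dual _)) at x
      change ψ ((starEvalEquiv F (M.V (.dual _))).symm _) = ψ (M.map (QArrow.line b) x.1)
      rw [apply_starEvalEquiv_symm]
      change star (x.2 (M.map (QArrow.lineDual b) 0) + star (ψ (M.map (QArrow.line b) x.1))) = _
      simp
    | lineDual b =>
      refine eq_of_starDual (F := F) fun ψ => ?_
      change M.V (.vert _) × StarDual F (M.V (.dual _)) at x
      change ψ ((starEvalEquiv F (M.V (.dual _))).symm _) = ψ (M.map (QArrow.lineDual b) x.1)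
      rw [apply_starEvalEquiv_symm]
      change star (star (ψ (M.map (QArrow.lineDual b) x.1) +
        star (x.2 (M.map (QArrow.line b) 0)))) = _
      simp
    | bi c => exact congrArg Prod.fst (plus_under_bi M c x)
    | biDual c =>
      refine eq_of_starDual (F := F) fun χ => ?_
      change StarDual F (M.V (.vert _) × StarDual F (M.V (.dual _))) at x
      refine (apply_plus_under_biDual M c x (starMap (LinearMap.fst Fᵐᵒᵖ _ _) χ)).trans ?_
      refine Eq.trans ?_ (apply_starEvalEquiv_symm _ (starMap (M.map (QArrow.biDual c)) χ)).symm
      refine congrArg (fun z => star (x z)) (Prod.ext ?_ rfl)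
      have : (starMap (LinearMap.inr Fᵐᵒᵖ (M.V (.vert (D.biSnd c)))
          (StarDual F (M.V (.dual (D.biSnd c))))))
        ((starMap (LinearMap.fst Fᵐᵒᵖ (M.V (.vert (D.biSnd c)))
          (StarDual F (M.V (.dual (D.biSnd c)))))) χ) = 0 :=
        LinearMap.ext fun y => map_zero χ
      change M.map (QArrow.bi c) ((starEvalEquiv F _).symm _) = 0
      rw [this, map_zero, map_zero]

theorem plusInc_plusProj (M : D.QRep F) : plusInc M ≫ plusProj M = 𝟙 M := by
  ext s x
  cases s with
  | vert i => rfl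
  | dual i => exact (starEvalEquiv F (M.V (.dual i))).symm_apply_apply x

/-- At the vertex `i`, the idempotent is the projection of `M_i ⊕ (M_{i^*})^*` on the first summand
and its adjoint the projection on the second. With `plusInc_plusProj` this determines `M^+` up to
isomorphism, by `uiso_of_hyperbolic`. -/
theorem plus_total (M : D.QRep F) :
    plusProj M ≫ plusInc M + dag (A := M.plus) (B := M.plus) (plusProj M ≫ plusInc M) = 𝟙 _ := by
  have h : ∀ i x, vert (plusProj M ≫ plusInc M +
      dag (A := M.plus) (B := M.plus) (plusProj M ≫ plusInc M)) i x = x := fun i x => by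
    refine eq_of_starDual (F := F) fun φ => ?_
    have h2 : dualVert (A := M.plus) (B := M.plus) (plusProj M ≫ plusInc M) i φ x =
        φ (LinearMap.inr Fᵐᵒᵖ _ _ (Prod.snd x)) := by
      change star (Prod.snd x ((starEvalEquiv F _).symm _)) = _
      exact (congrArg star (apply_starEvalEquiv_symm _ (Prod.snd x))).trans (star_star _)
    rw [vert_add, map_add, apply_vert_dag, h2]
    exact (map_add φ _ _).symm.trans (congrArg φ (Prod.ext (add_zero _) (zero_add _)))
  refine under_ext h fun i x => ?_
  rw [dag_add, dag_dag, add_comm, h, dag_id, vert_id]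

/-- Two representations with the same hyperbolic decomposition are isomorphic. -/
theorem uiso_of_hyperbolic {M : D.QRep F} {P Q : D.Rep F} {j : M ⟶ P.under} {p : P.under ⟶ M}
    {j' : M ⟶ Q.under} {p' : Q.under ⟶ M} (h : j ≫ p = 𝟙 M) (h' : j' ≫ p' = 𝟙 M)
    (ht : p ≫ j + dag (p ≫ j) = 𝟙 _) (ht' : p' ≫ j' + dag (p' ≫ j') = 𝟙 _) : Uiso P Q := by
  have key : ∀ (P Q : D.Rep F) (j : M ⟶ P.under) (p : P.under ⟶ M) (j' : M ⟶ Q.under)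
      (p' : Q.under ⟶ M), j ≫ p = 𝟙 M → j' ≫ p' = 𝟙 M → p ≫ j + dag (p ≫ j) = 𝟙 _ →
      p' ≫ j' + dag (p' ≫ j') = 𝟙 _ →
      (p ≫ j' + dag (p' ≫ j)) ≫ dag (p ≫ j' + dag (p' ≫ j)) = 𝟙 _ := by
    intro P Q j p j' p' h h' ht ht'
    -- The copy of `M` in `Q` is isotropic: `E = p' ≫ j'` is idempotent and `dag E = 1 - E`, so `E ≫
    -- dag E = 0`. The same reason gives `z2`.
    have z1 : (p ≫ j') ≫ dag (p ≫ j') = 0 := by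
      have e1 : p ≫ j' = (p ≫ j') ≫ p' ≫ j' := by simp [reassoc_of% h']
      have e2 : (p' ≫ j') ≫ dag (p' ≫ j') = 0 := by
        rw [eq_sub_of_add_eq' ht', Preadditive.comp_sub]
        simp [reassoc_of% h']
      rw [e1, dag_comp, Category.assoc, ← Category.assoc (p' ≫ j'), e2]
      simp
    have z2 : dag (p' ≫ j) ≫ p' ≫ j = 0 := by
      have e1 : p' ≫ j = (p' ≫ j') ≫ p' ≫ j := by simp [reassoc_of% h']
      have e2 : dag (p' ≫ j') ≫ p' ≫ j' = 0 := by
        rw [eq_sub_of_add_eq' ht', Preadditive.sub_comp]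
        simp [reassoc_of% h']
      rw [e1, dag_comp, Category.assoc, ← Category.assoc (dag (p' ≫ j')), e2]
      simp
    rw [dag_add, dag_dag, Preadditive.comp_add, Preadditive.add_comp, Preadditive.add_comp, z1, z2,
      ← dag_comp]
    simpa [reassoc_of% h', add_comm] using ht
  -- The first term identifies the two copies of `M`, the second the two complementary isotropic
  -- summands. The adjoint has the same shape with `P` and `Q` exchanged, so one computation proves
  -- both identities.
  refine ⟨p ≫ j' + dag (p' ≫ j), key P Q j p j' p' h h' ht ht', ?_⟩
  have := key Q P j' p' j p h' h ht' ht
  simpa [add_comm] using this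

/-! ### Calculus of orthogonal sums -/

section OrthoSum

variable {κ κ' : Type*} [Fintype κ] [Fintype κ'] {X X' : D.Rep F} {Y Y' : κ → D.Rep F}

theorem IsOrthoSum.uiso (h : IsOrthoSum X Y) (h' : IsOrthoSum X' Y) : Uiso X X' := by
  obtain ⟨i, h1, h2, h3⟩ := h
  obtain ⟨i', h1', h2', h3'⟩ := h'
  have key : ∀ (X X' : D.Rep F) (i : ∀ k, (Y k).under ⟶ X.under)
      (i' : ∀ k, (Y k).under ⟶ X'.under), (∀ k, i' k ≫ dag (i' k) = 𝟙 _) →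
      (∀ k l, k ≠ l → i' k ≫ dag (i' l) = 0) → ∑ k, dag (i k) ≫ i k = 𝟙 _ →
      (∑ k, dag (i k) ≫ i' k) ≫ (∑ k, dag (i' k) ≫ i k) = 𝟙 _ := by
    intro X X' i i' h1 h2 h3
    rw [Preadditive.sum_comp, ← h3]
    refine Finset.sum_congr rfl fun k _ => ?_
    rw [Category.assoc, Preadditive.comp_sum, Finset.sum_eq_single k]
    · rw [reassoc_of% h1 k]
    · intro l _ hl
      rw [← Category.assoc, h2 k l hl.symm, Limits.zero_comp]
    · simp
  have hd : dag (∑ k, dag (i k) ≫ i' k) = ∑ k, dag (i' k) ≫ i k := by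
    rw [dag_sum]
    simp
  exact ⟨∑ k, dag (i k) ≫ i' k, by rw [hd, key X X' i i' h1' h2' h3],
    by rw [hd, key X' X i' i h1 h2 h3']⟩

theorem IsOrthoSum.congr (h : IsOrthoSum X Y) (w : ∀ k, Uiso (Y' k) (Y k)) : IsOrthoSum X Y' := by
  obtain ⟨i, h1, h2, h3⟩ := h
  choose v hv hv' using w
  refine ⟨fun k => v k ≫ i k, fun k => by simp [reassoc_of% h1 k, hv], fun k l hkl => ?_, ?_⟩
  · rw [dag_comp, Category.assoc, ← Category.assoc (i k), h2 k l hkl]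
    simp
  · rw [← h3]
    refine Finset.sum_congr rfl fun k _ => ?_
    simp [reassoc_of% hv' k]

theorem IsOrthoSum.reindex (h : IsOrthoSum X Y) (e : κ' ≃ κ) :
    IsOrthoSum X (fun k => Y (e k)) := by
  obtain ⟨i, h1, h2, h3⟩ := h
  refine ⟨fun k => i (e k), fun k => h1 _, fun k l hkl => h2 _ _ (e.injective.ne hkl), ?_⟩
  rw [← h3]
  exact e.sum_comp (fun k => dag (i k) ≫ i k)

theorem comp_eq_zero_of_total {Y Z : D.Rep F} {i : Y.under ⟶ X.under} {j : Z.under ⟶ X.under}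
    (hi : i ≫ dag i = 𝟙 _) (hj : j ≫ dag j = 𝟙 _) (h : dag i ≫ i + dag j ≫ j = 𝟙 _) :
    i ≫ dag j = 0 := by
  have := congrArg (fun z => i ≫ z ≫ dag j) h
  simp only [Preadditive.add_comp, Preadditive.comp_add, Category.assoc, hj,
    Category.comp_id, Category.id_comp, reassoc_of% hi] at this
  simpa using this

theorem IsOrthoSum.option {Y₀ Z : D.Rep F} {i : Y₀.under ⟶ X.under} {j : Z.under ⟶ X.under}
    (hi : i ≫ dag i = 𝟙 _) (hj : j ≫ dag j = 𝟙 _) (hij : dag i ≫ i + dag j ≫ j = 𝟙 _)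
    (h : IsOrthoSum Z Y) : IsOrthoSum X (fun o : Option κ => o.elim Y₀ Y) := by
  obtain ⟨k, h1, h2, h3⟩ := h
  have hz := comp_eq_zero_of_total hi hj hij
  have hz' : j ≫ dag i = 0 := by simpa using congrArg dag hz
  refine ⟨fun o => match o with
    | none => i
    | some l => k l ≫ j, ?_, ?_, ?_⟩
  · rintro (_ | l)
    · exact hi
    · change (k l ≫ j) ≫ dag (k l ≫ j) = _
      simpa [reassoc_of% hj] using h1 l
  · rintro (_ | l) (_ | m) hne
    · exact absurd rfl hne
    · change i ≫ dag (k m ≫ j) = 0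
      simp [reassoc_of% hz]
    · change (k l ≫ j) ≫ dag i = 0
      simp [hz']
    · change (k l ≫ j) ≫ dag (k m ≫ j) = 0
      simpa [reassoc_of% hj] using h2 l m fun h => hne (by rw [h])
  · rw [Fintype.sum_option, ← hij]
    change dag i ≫ i + ∑ l, dag (k l ≫ j) ≫ k l ≫ j = _
    have : ∀ m, dag (k m ≫ j) ≫ k m ≫ j = dag j ≫ (dag (k m) ≫ k m) ≫ j := fun m => by simp
    simp only [this]
    rw [← Preadditive.comp_sum, ← Preadditive.sum_comp, h3]
    simp

end OrthoSum

theorem exists_complement {X Y : D.Rep F} {i : Y.under ⟶ X.under} (hi : i ≫ dag i = 𝟙 _) :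
    ∃ (Z : D.Rep F) (j : Z.under ⟶ X.under), j ≫ dag j = 𝟙 _ ∧
      dag i ≫ i + dag j ≫ j = 𝟙 _ := by
  obtain ⟨Z, j, h1, h2⟩ := exists_isometry (g := 𝟙 X.under - dag i ≫ i)
    (by simp [reassoc_of% hi]) (by simp)
  exact ⟨Z, j, h1, by rw [h2]; abel⟩

/-! ### Radical and units of endomorphism rings -/

theorem QRep.IsRad.isNilpotent_of_toHom {M : D.QRep F} {f : M.End} (h : IsRad (M.toHom f)) :
    IsNilpotent f :=
  (isNilpotent_iff_ofEnd f).2 (IsRad.isNilpotent (f := M.ofEnd f) h)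

/-- Multiples of a radical `f` are nilpotent, so `1 + y f` is a unit for every `y`; conversely a
unit cannot lie in the Jacobson radical of a nonzero ring. -/
theorem isRad_toHom_iff {L : D.QRep F} (hL : L.Indecomposable) (f : L.End) :
    IsRad (L.toHom f) ↔ f ∈ Ring.jacobson L.End := by
  constructor
  · intro hf
    rw [← Ideal.jacobson_bot, Ideal.mem_jacobson_iff]
    intro y
    have h2 : IsNilpotent (y * f) :=
      IsRad.isNilpotent_of_toHom (by rw [toHom_mul]; exact hf.comp_right _)
    obtain ⟨v, hv⟩ := h2.isUnit_one_add
    refine ⟨↑v⁻¹, ?_⟩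
    rw [Ideal.mem_bot, sub_eq_zero, mul_assoc]
    calc (↑v⁻¹ * (y * f) + ↑v⁻¹ : L.End) = ↑v⁻¹ * (1 + y * f) := by rw [mul_add, mul_one, add_comm]
      _ = 1 := by rw [← hv, Units.inv_mul]
  · intro hf
    rw [hL.isRad_iff, ← isUnit_iff_isIso_toHom]
    rintro ⟨v, rfl⟩
    obtain ⟨z, hz⟩ := exists_right_inv_of_mem_jacobson
      ((Ring.jacobson L.End).neg_mem ((Ring.jacobson L.End).mul_mem_left (↑v⁻¹ : L.End) hf))
    rw [Units.inv_mul, add_neg_cancel, zero_mul] at hz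
    apply (indecomposable_iff.1 hL).1
    exact (congrArg L.toHom hz).symm

theorem isUnit_two_end (h2 : (2 : F) ≠ 0) (M : D.QRep F) : IsUnit (2 : M.End) := by
  have := (isUnit_two h2 M).map M.ofEnd.symm
  rwa [map_ofNat] at this

/-- A morphism that is unitary modulo the radical can be replaced by a unitary one. -/
theorem uiso_of_isRad (h2 : (2 : F) ≠ 0) {X Y : D.Rep F} (g : X.under ⟶ Y.under)
    (h : Y.under ⟶ X.under) (h₁ : IsRad (g ≫ h - 𝟙 _)) (h₂ : IsRad (h ≫ g - 𝟙 _))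
    (h₃ : IsRad (g ≫ dag g - 𝟙 _)) : Uiso X Y := by
  have hiso : ∀ (Z : D.QRep F) (f : Z ⟶ Z), IsRad (f - 𝟙 _) → IsIso f := fun Z f hf => by
    let f' : CategoryTheory.End Z := f - 𝟙 Z
    have h1 : IsNilpotent f' := hf.isNilpotent
    have h2 := h1.isUnit_one_add
    have h3 : (1 : CategoryTheory.End Z) + f' = f := add_sub_cancel (𝟙 Z) f
    rw [h3] at h2
    exact (isUnit_iff_isIso _).1 h2
  have i1 := hiso _ _ h₁
  have i2 := hiso _ _ h₂
  have hg : IsIso g := by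
    have e1 : g ≫ h ≫ inv (g ≫ h) = 𝟙 _ := by rw [← Category.assoc, IsIso.hom_inv_id]
    have e2 : (inv (h ≫ g) ≫ h) ≫ g = 𝟙 _ := by rw [Category.assoc, IsIso.inv_hom_id]
    have e3 : inv (h ≫ g) ≫ h = h ≫ inv (g ≫ h) := by
      calc inv (h ≫ g) ≫ h = (inv (h ≫ g) ≫ h) ≫ g ≫ h ≫ inv (g ≫ h) := by
            rw [e1, Category.comp_id]
        _ = _ := by rw [← Category.assoc, e2, Category.id_comp]
    exact ⟨h ≫ inv (g ≫ h), e1, by rw [← e3, e2]⟩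
  -- Polar decomposition: `g ≫ dag g = 1 + r` has a selfadjoint square root `v`, and correcting `g`
  -- by `v⁻¹` makes it unitary on one side. The other side follows because `g` is invertible.
  set r : X.under.End := X.under.ofHom (g ≫ dag g - 𝟙 _) with hr
  have hr' : X.under.toHom r = g ≫ dag g - 𝟙 _ := rfl
  have hrn : IsNilpotent r := by
    refine IsRad.isNilpotent_of_toHom ?_
    rwa [hr']
  have hrs : star r = r := by
    apply toHom_injective
    rw [toHom_star, hr']
    simp
  obtain ⟨v, hvs, hvv⟩ := exists_selfadjoint_sqrt (isUnit_two_end h2 _) hrn hrs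
  have hVV : X.under.toHom v ≫ X.under.toHom v = g ≫ dag g := by
    rw [← toHom_mul, hvv, toHom_add, hr', toHom_one]
    exact add_sub_cancel _ _
  set W : X.under ⟶ X.under := X.under.toHom (v⁻¹ : (X.under.End)ˣ) with hW
  set V : X.under ⟶ X.under := X.under.toHom v with hV
  have hVs : dag V = V := by rw [hV, ← toHom_star, hvs]
  have hVW : V ≫ W = 𝟙 _ := toHom_comp_inv v
  have hWV : W ≫ V = 𝟙 _ := toHom_inv_comp v
  have hWs : dag W = W := by
    have := congrArg dag hVW
    rw [dag_comp, hVs, dag_id] at this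
    calc dag W = dag W ≫ V ≫ W := by rw [hVW, Category.comp_id]
      _ = W := by rw [reassoc_of% this]
  have hWi : IsIso W := ⟨V, hWV, hVW⟩
  have e1 : (W ≫ g) ≫ dag (W ≫ g) = 𝟙 _ := by
    rw [dag_comp, hWs, Category.assoc, ← Category.assoc g, ← hVV, Category.assoc,
      reassoc_of% hWV, hVW]
  refine ⟨W ≫ g, e1, ?_⟩
  rw [IsIso.eq_inv_of_hom_inv_id e1, IsIso.inv_hom_id]

/-! ### Orthogonal summands with indecomposable selfadjoint representations -/

/-- Polarization: if all `i ≫ dag i` were radical, then so would be the cross terms of `i = j + dag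
p`. They are `j ≫ p + dag p ≫ dag j = 2`, a unit. -/
theorem exists_isIso_gram (h2 : (2 : F) ≠ 0) {A X : D.Rep F} (hA : A.under.Indecomposable)
    {j : A.under ⟶ X.under} {p : X.under ⟶ A.under} (hjp : j ≫ p = 𝟙 _) :
    ∃ i : A.under ⟶ X.under, IsIso (i ≫ dag i) := by
  by_contra! h
  have hr : ∀ i : A.under ⟶ X.under, IsRad (i ≫ dag i) := fun i => hA.isRad_iff.2 (h i)
  have h4 := ((hr (j + dag p)).sub (hr j)).sub (hr (dag p))
  have h5 : dag p ≫ dag j = 𝟙 _ := by rw [← dag_comp, hjp, dag_id]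
  have h6 : (j + dag p) ≫ dag (j + dag p) - j ≫ dag j - dag p ≫ dag (dag p) =
      ((2 : CategoryTheory.End A.under) : A.under ⟶ A.under) := by
    have : ((2 : CategoryTheory.End A.under) : A.under ⟶ A.under) = 𝟙 _ + 𝟙 _ :=
      (one_add_one_eq_two (R := CategoryTheory.End A.under)).symm
    rw [this]
    simp only [dag_add, dag_dag, Preadditive.add_comp, Preadditive.comp_add, hjp, h5]
    abel
  rw [h6, hA.isRad_iff, ← CategoryTheory.isUnit_iff_isIso] at h4
  exact h4 (isUnit_two h2 _)

/-- The twist by `f = i ≫ dag i` is made to absorb this Gram operator, so `θ ≫ i` is an isometry. -/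
theorem exists_twist_inc {A X : D.Rep F} {i : A.under ⟶ X.under} (hi : IsIso (i ≫ dag i)) :
    ∃ f : (A.under.End)ˣ, star (f : A.under.End) = f ∧
      ∃ j : (A.twist f).under ⟶ X.under, j ≫ dag j = 𝟙 _ := by
  have hu : IsUnit (A.under.ofHom (i ≫ dag i)) := by
    rw [isUnit_iff_isIso_toHom, toHom_ofHom]
    exact hi
  obtain ⟨f, hf⟩ := hu
  have hf' : A.under.toHom f = i ≫ dag i := by rw [hf, toHom_ofHom]
  have hfs : star (f : A.under.End) = f := by
    apply toHom_injective
    rw [toHom_star, hf']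
    simp
  obtain ⟨θ, h1, -⟩ := exists_twist f hfs
  refine ⟨f, hfs, θ ≫ i, ?_⟩
  rw [hf'] at h1
  simpa using h1

theorem toT_eq_iff {A : D.Rep F} (hA : A.under.Indecomposable) (f g : A.under.End) :
    A.toT f = A.toT g ↔
      IsRad (A.under.toHom f - A.under.toHom g) := by
  have h : A.under.toHom f - A.under.toHom g = A.under.toHom (f - g) := rfl
  rw [h, isRad_toHom_iff hA]
  exact Ideal.Quotient.mk_eq_mk_iff_sub_mem f g

/-- The isomorphism `u = θ ≫ g ≫ dag η` has `u ≫ dag u - 1 = θ ≫ (g - f) ≫ dag θ`, which is radical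
when `f` and `g` have the same class. So the choice of `f_a` in its class is immaterial. -/
theorem uiso_twist (h2 : (2 : F) ≠ 0) {A : D.Rep F} (hA : A.under.Indecomposable)
    {f g : (A.under.End)ˣ} (hf : star (f : A.under.End) = f) (hg : star (g : A.under.End) = g)
    (h : A.toT f = A.toT g) : Uiso (A.twist f) (A.twist g) := by
  obtain ⟨θ, h1, h3⟩ := exists_twist f hf
  obtain ⟨η, h4, h5⟩ := exists_twist g hg
  rw [toT_eq_iff hA] at h
  have hf' : dag (A.under.toHom f) = A.under.toHom f := by rw [← toHom_star, hf]
  have hg' : dag (A.under.toHom g) = A.under.toHom g := by rw [← toHom_star, hg]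
  have f1 := toHom_inv_comp f
  have f2 := toHom_comp_inv f
  have g1 := toHom_inv_comp g
  have g2 := toHom_comp_inv g
  refine uiso_of_isRad h2 (θ ≫ A.under.toHom g ≫ dag η) (η ≫ A.under.toHom f ≫ dag θ) ?_ ?_ ?_
  · have : (θ ≫ A.under.toHom g ≫ dag η) ≫ (η ≫ A.under.toHom f ≫ dag θ) = 𝟙 _ := by
      simp only [Category.assoc, reassoc_of% h5, reassoc_of% g2, h1]
    rw [this, sub_self]
    exact isRad_zero
  · have : (η ≫ A.under.toHom f ≫ dag θ) ≫ (θ ≫ A.under.toHom g ≫ dag η) = 𝟙 _ := by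
      simp only [Category.assoc, reassoc_of% h3, reassoc_of% f2, h4]
    rw [this, sub_self]
    exact isRad_zero
  · have : (θ ≫ A.under.toHom g ≫ dag η) ≫ dag (θ ≫ A.under.toHom g ≫ dag η) - 𝟙 _ =
        (θ ≫ (-(A.under.toHom f - A.under.toHom g))) ≫ dag θ := by
      simp only [dag_comp, dag_dag, hg', Category.assoc, reassoc_of% h5, reassoc_of% g2]
      rw [← h1]
      simp only [neg_sub, Preadditive.comp_sub, Preadditive.sub_comp]
    rw [this]
    exact (h.neg.comp_left _).comp_right _

/-! ### Hyperbolic summands -/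

/-- The morphism `X̲ → M°` corresponding to `M → X̲`. -/
def toAdj {M : D.QRep F} {X : D.Rep F} (j : M ⟶ X.under) : X.under ⟶ M.adjoint :=
  X.selfDual.hom ≫ adj j

/-- The morphism `M° → X̲` corresponding to `X̲ → M`. -/
def ofAdj {M : D.QRep F} {X : D.Rep F} (p : X.under ⟶ M) : M.adjoint ⟶ X.under :=
  adj p ≫ X.selfDual.inv

theorem toAdj_ofAdj {M : D.QRep F} {X : D.Rep F} (j : M ⟶ X.under) (p : X.under ⟶ M) :
    toAdj j ≫ ofAdj p = dag (p ≫ j) := by simp [toAdj, ofAdj, dag]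

theorem ofAdj_toAdj {M : D.QRep F} {X : D.Rep F} {j : M ⟶ X.under} {p : X.under ⟶ M}
    (h : j ≫ p = 𝟙 M) : ofAdj p ≫ toAdj j = 𝟙 _ := by
  simp [toAdj, ofAdj, ← adj_comp, h]

/-- The morphism `α : M ⟶ M°` is the form of `X` restricted to `M`. If it is nondegenerate, then `y`
is the orthogonal projection of `X` on `M`, so `M` is isomorphic to the selfadjoint representation
on the range of `y`. -/
theorem isoSelfadjoint_of_isIso {M : D.QRep F} {X : D.Rep F} {j : M ⟶ X.under}
    {p : X.under ⟶ M} (hjp : j ≫ p = 𝟙 M) (h : IsIso (j ≫ toAdj j)) : M.IsoSelfadjoint := by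
  set α := j ≫ toAdj j with hα
  set y : X.under ⟶ X.under := toAdj j ≫ inv α ≫ j with hy
  have hjy : j ≫ y = j := by
    rw [hy, ← Category.assoc, ← hα, IsIso.hom_inv_id_assoc]
  have hyy : y ≫ y = y := by
    conv_lhs => rw [hy]
    rw [Category.assoc, Category.assoc, hjy]
  set e : X.under ⟶ X.under := p ≫ j with he
  have hde : dag e = toAdj j ≫ ofAdj p := (toAdj_ofAdj j p).symm
  have hpj := ofAdj_toAdj hjp
  have h1 : e ≫ dag e ≫ y = e := by
    rw [hde, hy, he]
    simp only [Category.assoc]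
    rw [reassoc_of% hpj, ← Category.assoc j, ← hα, IsIso.hom_inv_id_assoc]
  have h2 : y ≫ e ≫ dag e = dag e := by
    rw [hde, hy, he]
    simp only [Category.assoc]
    rw [reassoc_of% hjp, ← Category.assoc j, ← hα, IsIso.inv_hom_id_assoc]
  have h3 : y ≫ e = y := by
    rw [hy, he]
    simp only [Category.assoc]
    rw [reassoc_of% hjp]
  have h4 : dag e ≫ y = y := by
    rw [hde, hy, Category.assoc, reassoc_of% hpj]
  have h5 : e ≫ dag e ≫ dag y = e := by
    have := congrArg dag h2
    simpa using this
  -- Symmetry of `α` would have to be stated through `M ≅ M°°`; it is bypassed by comparing `y` with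
  -- the idempotent `e` and its adjoint.
  have hys : dag y = y := by
    calc dag y = dag (y ≫ e) := by rw [h3]
      _ = dag e ≫ dag y := by rw [dag_comp]
      _ = y ≫ e ≫ dag e ≫ dag y := by rw [reassoc_of% h2]
      _ = y := by rw [h5, h3]
  obtain ⟨Y, k, hk, hk'⟩ := exists_isometry hyy hys
  refine ⟨Y, isomorphic_iff.2 ⟨⟨j ≫ dag k, k ≫ toAdj j ≫ inv α, ?_, ?_⟩⟩⟩
  · rw [Category.assoc, reassoc_of% hk', reassoc_of% hjy, ← Category.assoc, ← hα, IsIso.hom_inv_id]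
  · have : (k ≫ toAdj j ≫ inv α) ≫ j ≫ dag k = k ≫ y ≫ dag k := by
      rw [hy]; simp only [Category.assoc]
    rw [this, ← hk']
    simp [hk]

/-- The restricted form `j ≫ toAdj j` is not invertible, hence radical, so the idempotent `e = p ≫
j` has `e° e` nilpotent and can be made orthogonal to its adjoint. This also covers `M ≅ M°`, as
long as `M` is not isomorphic to a selfadjoint representation. -/
theorem exists_plus_inc (h2 : (2 : F) ≠ 0) {M : D.QRep F} {X : D.Rep F} (hM : M.Indecomposable)
    (hns : ¬ M.IsoSelfadjoint) {j : M ⟶ X.under} {p : X.under ⟶ M} (hjp : j ≫ p = 𝟙 M) :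
    ∃ i : M.plus.under ⟶ X.under, i ≫ dag i = 𝟙 _ := by
  have hα : IsRad (j ≫ toAdj j) :=
    isRad_of_not_isIso hM hM.adjoint fun h => hns (isoSelfadjoint_of_isIso hjp h)
  set e : X.under.End := X.under.ofHom (p ≫ j) with he
  have he' : X.under.toHom e = p ≫ j := rfl
  have hee : e * e = e := by
    apply toHom_injective
    rw [toHom_mul, he']
    simp [reassoc_of% hjp]
  have hn : IsNilpotent (star e * e) := by
    refine IsRad.isNilpotent_of_toHom ?_
    rw [toHom_mul, toHom_star, he', ← toAdj_ofAdj]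
    have := (hα.comp_right (ofAdj p)).comp_left p
    simpa using this
  obtain ⟨x, y, h1, h3, h4⟩ := exists_hyperbolic_idempotent (isUnit_two_end h2 _) hee hn
  set x' : X.under ⟶ X.under := X.under.toHom x with hx'
  set y' : X.under ⟶ X.under := X.under.toHom y with hy'
  have hj : (j ≫ x') ≫ (y' ≫ p) = 𝟙 M := by
    have h5 := congrArg X.under.toHom h1
    rw [toHom_mul, toHom_mul, toHom_mul, he', ← hx', ← hy'] at h5
    have h6 := congrArg (fun z => j ≫ z ≫ p) h5
    simpa [reassoc_of% hjp, hjp] using h6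
  have hE : X.under.toHom (x * e * y) = (y' ≫ p) ≫ (j ≫ x') := by
    rw [toHom_mul, toHom_mul, he']
    simp [hx', hy']
  generalize j ≫ x' = j' at hj hE
  generalize y' ≫ p = p' at hj hE
  set E : X.under ⟶ X.under := p' ≫ j' with hEdef
  have hz1 : E ≫ dag E = 0 := by
    have := congrArg X.under.toHom h3
    rwa [toHom_mul, toHom_star, hE, toHom_zero] at this
  have hz2 : dag E ≫ E = 0 := by
    have := congrArg X.under.toHom h4
    rwa [toHom_mul, toHom_star, hE, toHom_zero] at this
  have hEE : E ≫ E = E := by simp [hEdef, reassoc_of% hj]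
  have hEE' : dag E ≫ dag E = dag E := by rw [← dag_comp, hEE]
  -- `E` and `dag E` are orthogonal idempotents, so their sum is a selfadjoint idempotent. On its
  -- range they give a hyperbolic decomposition, which identifies the range with `M^+`.
  obtain ⟨P, k, hk, hk'⟩ := exists_isometry (g := E + dag E)
    (by simp [Preadditive.add_comp, Preadditive.comp_add, hz1, hz2, hEE, hEE'])
    (by simp [add_comm])
  have hjE : j' ≫ E = j' := by rw [hEdef, reassoc_of% hj]
  have hjE' : j' ≫ dag E = 0 := by rw [← hjE, Category.assoc, hz1, Limits.comp_zero]
  have e1 : (j' ≫ dag k) ≫ k ≫ p' = 𝟙 M := by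
    have : (j' ≫ dag k) ≫ k ≫ p' = (j' ≫ (dag k ≫ k)) ≫ p' := by simp
    rw [this, hk', Preadditive.comp_add, hjE, hjE', add_zero, hj]
  have e2 : (k ≫ p') ≫ (j' ≫ dag k) + dag ((k ≫ p') ≫ (j' ≫ dag k)) = 𝟙 _ := by
    have h5 : (k ≫ p') ≫ (j' ≫ dag k) = k ≫ E ≫ dag k := by simp [hEdef]
    have h6 : k ≫ E ≫ dag k + dag (k ≫ E ≫ dag k) = k ≫ (E + dag E) ≫ dag k := by simp
    rw [h5, h6, ← hk']
    simp [hk]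
  obtain ⟨v, hv, -⟩ := uiso_of_hyperbolic (plusInc_plusProj M) e1 (plus_total M) e2
  exact ⟨v ≫ k, by simp [reassoc_of% hk, hv]⟩

/-! ### Relations -/

theorem QRep.evalPath_app {M N : D.QRep F} (f : M ⟶ N) {s t : QVert D} (p : Quiver.Path s t)
    (x : M.V s) : N.evalPath p (app f s x) = app f t (M.evalPath p x) := by
  induction p with
  | nil => rfl
  | cons p a ih =>
    change N.map a (N.evalPath p (app f s x)) = app f _ (M.map a (M.evalPath p x))
    rw [ih, app_map]

theorem QRep.evalPath_comp (M : D.QRep F) {s t v : QVert D} (p : Quiver.Path s t)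
    (q : Quiver.Path t v) (x : M.V s) :
    M.evalPath (p.comp q) x = M.evalPath q (M.evalPath p x) := by
  induction q with
  | nil => rfl
  | cons q a ih =>
    change M.map a (M.evalPath (p.comp q) x) = M.map a (M.evalPath q (M.evalPath p x))
    rw [ih]

theorem QRep.evalPath_adjoint (M : D.QRep F) {s t : QVert D} (p : Quiver.Path s t)
    (φ : StarDual F (M.V s.inv)) :
    (M.adjoint.evalPath p φ : StarDual F (M.V t.inv)) = starMap (M.evalPath (pathInv p)) φ := by
  induction p with
  | nil => rfl
  | cons p a ih =>
    refine LinearMap.ext fun x => ?_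
    have h1 : M.evalPath (pathInv (p.cons a)) x =
        M.evalPath (pathInv p) (M.map (QArrow.inv a) x) := by
      rw [pathInv, evalPath_comp]
      rfl
    rw [starMap_apply, h1]
    exact LinearMap.congr_fun ih (M.map (QArrow.inv a) x)

theorem QRep.SatisfiesRel.of_summand {M N : D.QRep F} {r : D.Relation F} (h : M.SatisfiesRel r)
    {j : N ⟶ M} {p : M ⟶ N} (hjp : j ≫ p = 𝟙 N) : N.SatisfiesRel r := fun x => by
  have h1 := congrArg (app p r.tgt) (h (app j r.src x))
  rw [Finsupp.sum, map_sum, map_zero] at h1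
  rw [Finsupp.sum, ← h1]
  refine Finset.sum_congr rfl fun q _ => ?_
  rw [map_smul, evalPath_app, ← app_comp, hjp, app_id]

theorem QRep.SatisfiesAdjointRel.of_summand {M N : D.QRep F} {r : D.Relation F}
    (h : M.SatisfiesAdjointRel r) {j : N ⟶ M} {p : M ⟶ N} (hjp : j ≫ p = 𝟙 N) :
    N.SatisfiesAdjointRel r := fun x => by
  have h1 := congrArg (app p r.src.inv) (h (app j r.tgt.inv x))
  rw [Finsupp.sum, map_sum, map_zero] at h1
  rw [Finsupp.sum, ← h1]
  refine Finset.sum_congr rfl fun q _ => ?_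
  rw [map_smul, evalPath_app, ← app_comp, hjp, app_id]

theorem QRep.Satisfies.of_summand {M N : D.QRep F} {R : Finset (D.Relation F)}
    (h : M.Satisfies R) {j : N ⟶ M} {p : M ⟶ N} (hjp : j ≫ p = 𝟙 N) : N.Satisfies R :=
  fun r hr => ⟨(h r hr).1.of_summand hjp, (h r hr).2.of_summand hjp⟩

/-- Evaluating on functionals turns paths in `M°` into reversed paths in `M`. The coefficients end
up on the other side of the values, which is harmless because they are central. -/
theorem QRep.SatisfiesRel.of_adjoint {M : D.QRep F} {r : D.Relation F}
    (h : M.adjoint.SatisfiesRel r) : M.SatisfiesAdjointRel r := fun x => by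
  refine eq_of_starDual (F := F) fun φ => ?_
  have h1 : (r.coeff.sum fun p c =>
      (MulOpposite.op (c : F) • starMap (M.evalPath (pathInv p)) φ)) = 0 := by
    refine Eq.trans (Finset.sum_congr rfl fun p _ => ?_) (h φ)
    exact congrArg _ (evalPath_adjoint M p φ).symm
  have h2 := LinearMap.congr_fun h1 x
  rw [Finsupp.sum, LinearMap.sum_apply] at h2
  rw [Finsupp.sum, map_sum, map_zero]
  refine Eq.trans (Finset.sum_congr rfl fun p _ => ?_) h2
  rw [LinearMap.map_smulₛₗ, conjOp_apply, MulOpposite.unop_op, star_star]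
  exact ((Subring.mem_center_iff.1 (r.coeff p).2) _).symm

/-- The adjoint relations come for free because `A̲ ≅ A̲°`. -/
theorem Rep.Satisfies.under {A : D.Rep F} {R : Finset (D.Relation F)} (h : A.Satisfies R) :
    A.under.Satisfies R := fun r hr =>
  ⟨h r hr, QRep.SatisfiesRel.of_adjoint ((h r hr).of_summand A.selfDual.inv_hom_id)⟩

theorem Rep.Satisfies.of_summand {X Y : D.Rep F} {R : Finset (D.Relation F)} (h : X.Satisfies R)
    {j : Y.under ⟶ X.under} {p : X.under ⟶ Y.under} (hjp : j ≫ p = 𝟙 _) : Y.Satisfies R :=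
  fun r hr => (h r hr).of_summand hjp

/-! ### The ring `T(A)` -/

theorem toT_eq_zero_iff {A : D.Rep F} (hA : A.under.Indecomposable) (f : A.under.End) :
    A.toT f = 0 ↔ ¬ IsUnit f := by
  rw [← map_zero A.toT, toT_eq_iff hA, toHom_zero, sub_zero, hA.isRad_iff, isUnit_iff_isIso_toHom]

theorem nontrivial_T {A : D.Rep F} (hA : A.under.Indecomposable) : Nontrivial A.T :=
  ⟨⟨A.toT 1, 0, fun h => (toT_eq_zero_iff hA 1).1 h isUnit_one⟩⟩

theorem isUnit_T {A : D.Rep F} (hA : A.under.Indecomposable) {a : A.T} (ha : a ≠ 0) :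
    IsUnit a := by
  obtain ⟨f, rfl⟩ := A.toT_surjective a
  rw [ne_eq, toT_eq_zero_iff hA, not_not] at ha
  exact ha.map A.toT

/-- Average any lift with its adjoint: the class is unchanged, and being nonzero it consists of
units. -/
theorem exists_selfadjoint_lift (h2 : (2 : F) ≠ 0) {A : D.Rep F} (hA : A.under.Indecomposable)
    {a : A.T} (ha : a ≠ 0) (hs : star a = a) :
    ∃ f : (A.under.End)ˣ, star (f : A.under.End) = f ∧ A.toT f = a := by
  obtain ⟨g, rfl⟩ := A.toT_surjective a
  obtain ⟨t, ht, hts, htc⟩ := exists_half (isUnit_two_end h2 A.under)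
  have h1 : A.toT (t * (g + star g)) = A.toT g := by
    rw [map_mul, map_add, ← A.star_toT, hs, ← map_add, ← map_mul, mul_add, ← add_mul, ht, one_mul]
  have h3 : IsUnit (t * (g + star g)) := by
    by_contra h
    rw [← h1] at ha
    exact ha ((toT_eq_zero_iff hA _).2 h)
  obtain ⟨f, hf⟩ := h3
  refine ⟨f, ?_, by rw [hf, h1]⟩
  rw [hf, star_mul, star_add, star_star, hts, htc, add_comm]

/-! ### Existence of the decomposition -/

theorem IsOrthoSum.sum_sigma {α β : Type*} [Fintype α] [Fintype β] {μ : β → Type*}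
    [∀ k, Fintype (μ k)] {X : D.Rep F} {Y₁ : α → D.Rep F} {Y₂ : β → D.Rep F}
    {Z : ∀ k, μ k → D.Rep F} (h : IsOrthoSum X (Sum.elim Y₁ Y₂))
    (hZ : ∀ k, IsOrthoSum (Y₂ k) (Z k)) :
    IsOrthoSum X (Sum.elim Y₁ fun s : Σ k, μ k => Z s.1 s.2) := by
  obtain ⟨i, h1, h2, h3⟩ := h
  let i₁ : ∀ k, (Y₁ k).under ⟶ X.under := fun k => i (.inl k)
  let i₂ : ∀ k, (Y₂ k).under ⟶ X.under := fun k => i (.inr k)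
  have h1₁ : ∀ k, i₁ k ≫ dag (i₁ k) = 𝟙 _ := fun k => h1 (.inl k)
  have h1₂ : ∀ k, i₂ k ≫ dag (i₂ k) = 𝟙 _ := fun k => h1 (.inr k)
  have h2₁ : ∀ k l, k ≠ l → i₁ k ≫ dag (i₁ l) = 0 := fun k l hkl => h2 (.inl k) (.inl l) (by simpa)
  have h2₂ : ∀ k l, k ≠ l → i₂ k ≫ dag (i₂ l) = 0 := fun k l hkl => h2 (.inr k) (.inr l) (by simpa)
  have h21 : ∀ k l, i₂ k ≫ dag (i₁ l) = 0 := fun k l => h2 (.inr k) (.inl l) (by simp)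
  have h12 : ∀ k l, i₁ k ≫ dag (i₂ l) = 0 := fun k l => h2 (.inl k) (.inr l) (by simp)
  have h3' : ∑ k, dag (i₁ k) ≫ i₁ k + ∑ k, dag (i₂ k) ≫ i₂ k = 𝟙 _ := by
    rw [← h3, Fintype.sum_sum_type]
    rfl
  choose j g1 g2 g3 using hZ
  refine ⟨fun s => match s with
    | .inl k => i₁ k
    | .inr s => j s.1 s.2 ≫ i₂ s.1, ?_, ?_, ?_⟩
  · rintro (k | ⟨k, m⟩)
    · exact h1₁ k
    · change (j k m ≫ i₂ k) ≫ dag (j k m ≫ i₂ k) = 𝟙 _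
      simp [reassoc_of% h1₂ k, g1]
  · rintro (k | ⟨k, m⟩) (l | ⟨l, n⟩) hne
    · exact h2₁ k l fun h => hne (by rw [h])
    · change i₁ k ≫ dag (j l n ≫ i₂ l) = 0
      simp [reassoc_of% h12 k l]
    · change (j k m ≫ i₂ k) ≫ dag (i₁ l) = 0
      simp [h21]
    · change (j k m ≫ i₂ k) ≫ dag (j l n ≫ i₂ l) = 0
      by_cases hkl : k = l
      · subst hkl
        have : m ≠ n := fun h => hne (by rw [h])
        simp [reassoc_of% h1₂ k, g2 k m n this]
      · simp [reassoc_of% h2₂ k l hkl]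
  · rw [Fintype.sum_sum_type, Fintype.sum_sigma, ← h3']
    change ∑ k, dag (i₁ k) ≫ i₁ k + ∑ k, ∑ m, dag (j k m ≫ i₂ k) ≫ j k m ≫ i₂ k = _
    congr 1
    refine Finset.sum_congr rfl fun k _ => ?_
    have : ∀ m, dag (j k m ≫ i₂ k) ≫ j k m ≫ i₂ k = dag (i₂ k) ≫ (dag (j k m) ≫ j k m) ≫ i₂ k :=
      fun m => by simp
    simp only [this]
    rw [← Preadditive.comp_sum, ← Preadditive.sum_comp, g3]
    simp

variable {ind₀ : Set (D.Rep F)} {ind₁ : Set (D.QRep F)}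

/-- The index type of the summands `M_i^+` and `A_j^a`. -/
abbrev Decomp.Idx (d : Decomp ind₀ ind₁) : Type := Fin d.p ⊕ Σ j : Fin d.q, Fin (d.φ j).r

/-- The summands `M_i^+` and `A_j^a`. -/
def Decomp.term (f : ∀ A : D.Rep F, A.T → (A.under.End)ˣ) (d : Decomp ind₀ ind₁) :
    d.Idx → D.Rep F :=
  Sum.elim (fun i => (d.M i).plus) fun s => (d.A s.1).twist (f (d.A s.1) ((d.φ s.1).a s.2))

theorem Decomp.isOrthoSum (f : ∀ A : D.Rep F, A.T → (A.under.End)ˣ) (d : Decomp ind₀ ind₁) :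
    IsOrthoSum (d.sum f) (d.term f) :=
  (isOrthoSum_directSum _).sum_sigma fun _ => isOrthoSum_directSum _

theorem one_ne_zero_plus {M : D.QRep F} (hM : M.Indecomposable) : 𝟙 M.plus.under ≠ 0 := fun h => by
  apply (indecomposable_iff.1 hM).1
  rw [← plusInc_plusProj, ← Category.comp_id (plusInc M), h]
  simp

theorem one_ne_zero_twist {A : D.Rep F} (hA : A.under.Indecomposable) {f : (A.under.End)ˣ}
    (hf : star (f : A.under.End) = f) : 𝟙 (A.twist f).under ≠ 0 := fun h => by
  obtain ⟨θ, -, h1⟩ := exists_twist f hf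
  apply (indecomposable_iff.1 hA).1
  rw [← toHom_inv_comp f, ← h1, ← Category.id_comp θ, h]
  simp

/-- The summands that occur in the decompositions. -/
def IsTerm (f : ∀ A : D.Rep F, A.T → (A.under.End)ˣ) (ind₀ : Set (D.Rep F))
    (ind₁ : Set (D.QRep F)) (Z : D.Rep F) : Prop :=
  (∃ M ∈ ind₁, Z = M.plus) ∨
    ∃ A ∈ ind₀, ∃ a : A.T, a ≠ 0 ∧ star a = a ∧ Z = A.twist (f A a)

/-- The inductive step of existence: one indecomposable quiver summand of `X̲` yields one orthogonal
summand of `X` of the prescribed form. -/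
theorem exists_term_inc (h2 : (2 : F) ≠ 0) {R : Finset (D.Relation F)}
    (hind : IsIndPair R ind₀ ind₁) {f : ∀ A : D.Rep F, A.T → (A.under.End)ˣ}
    (hf : IsOrbitChoice ind₀ f) {X : D.Rep F} (hX : X.Satisfies R) (h0 : 𝟙 X.under ≠ 0) :
    ∃ Z : D.Rep F, IsTerm f ind₀ ind₁ Z ∧ 𝟙 Z.under ≠ 0 ∧
      ∃ i : Z.under ⟶ X.under, i ≫ dag i = 𝟙 _ := by
  obtain ⟨L, j, p, hL, hjp⟩ := exists_indecomposable_summand h0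
  have hLR : L.Satisfies R := hX.under.of_summand hjp
  by_cases hs : L.IsoSelfadjoint
  · obtain ⟨A, ⟨hA, hLA⟩, -⟩ := hind.existsUnique₀ L hL hLR hs
    obtain ⟨e⟩ := isomorphic_iff.1 hLA
    have hAi := (hind.indec₀ A hA).1
    obtain ⟨i, hi⟩ := exists_isIso_gram h2 hAi (j := e.inv ≫ j) (p := p ≫ e.hom)
      (by simp [reassoc_of% hjp])
    obtain ⟨g, hg, k, hk⟩ := exists_twist_inc hi
    have ha : A.toT g ≠ 0 := fun h => (toT_eq_zero_iff hAi _).1 h g.isUnit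
    have hsa : star (A.toT g) = A.toT g := by rw [A.star_toT, hg]
    obtain ⟨hc1, hc2⟩ := hf A hA _ ha hsa
    -- The automorphism `g` found in `X` is exchanged for the prescribed representative of its
    -- class.
    obtain ⟨v, hv, -⟩ := uiso_twist h2 hAi hc1 hg hc2
    exact ⟨_, Or.inr ⟨A, hA, _, ha, hsa, rfl⟩, one_ne_zero_twist hAi hc1, v ≫ k, by
      simp [reassoc_of% hk, hv]⟩
  · obtain ⟨M, ⟨hM, hLM⟩, -⟩ := hind.existsUnique₁ L hL hLR hs
    obtain ⟨hMi, -, hMs⟩ := hind.indec₁ M hM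
    have : ∃ (j : M ⟶ X.under) (p : X.under ⟶ M), j ≫ p = 𝟙 M := by
      rcases hLM with hLM | hLM
      · obtain ⟨e⟩ := isomorphic_iff.1 hLM
        exact ⟨e.inv ≫ j, p ≫ e.hom, by simp [reassoc_of% hjp]⟩
      -- If `L ≅ M°`, dualizing makes `M ≅ M°°` a summand of `X̲° ≅ X̲`.
      · obtain ⟨e⟩ := isomorphic_iff.1 hLM
        have h3 : (e.inv ≫ j) ≫ p ≫ e.hom = 𝟙 _ := by simp [reassoc_of% hjp]
        exact ⟨M.biadj.hom ≫ ofAdj (p ≫ e.hom), toAdj (e.inv ≫ j) ≫ M.biadj.inv, by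
          simp [reassoc_of% (ofAdj_toAdj h3)]⟩
    obtain ⟨j', p', hjp'⟩ := this
    obtain ⟨i, hi⟩ := exists_plus_inc h2 hMi hMs hjp'
    exact ⟨_, Or.inl ⟨M, hM, rfl⟩, one_ne_zero_plus hMi, i, hi⟩

theorem exists_isOrthoSum_terms (h2 : (2 : F) ≠ 0) {R : Finset (D.Relation F)}
    (hind : IsIndPair R ind₀ ind₁) {f : ∀ A : D.Rep F, A.T → (A.under.End)ˣ}
    (hf : IsOrbitChoice ind₀ f) (X : D.Rep F) (hX : X.Satisfies R) :
    ∃ (κ : Type) (_ : Fintype κ) (Z : κ → D.Rep F), (∀ k, IsTerm f ind₀ ind₁ (Z k)) ∧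
      IsOrthoSum X Z := by
  induction hn : X.under.dim using Nat.strong_induction_on generalizing X with
  | _ n ih =>
    by_cases h0 : 𝟙 X.under = 0
    · exact ⟨Empty, inferInstance, Empty.elim, fun k => k.elim, fun k => k.elim, fun k => k.elim,
        fun k => k.elim, by rw [h0]; simp⟩
    · obtain ⟨Y, hY, hY0, i, hi⟩ := exists_term_inc h2 hind hf hX h0
      obtain ⟨W, j, hj, hij⟩ := exists_complement hi
      have hd := dim_eq_of_iso (prodIso hi hj hij)
      rw [dim_prod] at hd
      have hd0 : Y.under.dim ≠ 0 := fun h => hY0 (isZero_iff.1 (dim_eq_zero.1 h))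
      obtain ⟨κ, hκ, Z, hZ, hWZ⟩ := ih W.under.dim (by omega) W (hX.of_summand hj) rfl
      refine ⟨Option κ, inferInstance, fun o => o.elim Y Z, ?_, hWZ.option hi hj hij⟩
      rintro (_ | k)
      · exact hY
      · exact hZ k

theorem twist_cast (f : ∀ A : D.Rep F, A.T → (A.under.End)ˣ) {A B : D.Rep F} (h : A = B)
    (a : A.T) : A.twist (f A a) = B.twist (f B (h ▸ a)) := by
  subst h; rfl

theorem exists_decomp (h2 : (2 : F) ≠ 0) {R : Finset (D.Relation F)}
    (hind : IsIndPair R ind₀ ind₁) {f : ∀ A : D.Rep F, A.T → (A.under.End)ˣ}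
    (hf : IsOrbitChoice ind₀ f) (X : D.Rep F) (hX : X.Satisfies R) :
    ∃ d : Decomp ind₀ ind₁, Uiso X (d.sum f) := by
  classical
  obtain ⟨κ, _, Z, hZ, hXZ⟩ := exists_isOrthoSum_terms h2 hind hf X hX
  -- A term that has both shapes is counted among the `M^+`, so the index set is properly
  -- partitioned.
  let P : κ → Prop := fun k => ∃ M ∈ ind₁, Z k = M.plus
  choose M hM hZM using fun k : {k // P k} => k.2
  choose A hA a ha hs hZA using fun k : {k // ¬ P k} => (hZ k).resolve_left k.2
  let q := Fintype.card (Set.range A)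
  let eq : Fin q ≃ Set.range A := (Fintype.equivFin _).symm
  -- The twists of the same `A` are collected into one diagonal Hermitian form; `fib j` indexes its
  -- entries and is nonempty, whence `r ≥ 1`. As `T(A)` depends on `A`, the entries are transported
  -- along equalities of representations.
  let fib : Fin q → Type := fun j => {k // A k = (eq j).1}
  have hfib : ∀ j, Nonempty (fib j) := fun j => by
    obtain ⟨k, hk⟩ := (eq j).2
    exact ⟨k, hk⟩
  let er : ∀ j, Fin (Fintype.card (fib j)) ≃ fib j := fun j => (Fintype.equivFin _).symm
  let d : Decomp ind₀ ind₁ :=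
    { p := Fintype.card {k // P k}
      M := fun i => M ((Fintype.equivFin _).symm i)
      M_mem := fun i => hM _
      q := q
      A := fun j => (eq j).1
      A_mem := fun j => by
        obtain ⟨k, hk⟩ := (eq j).2
        rw [← hk]; exact hA k
      A_injective := fun i j h => eq.injective (Subtype.ext h)
      φ := fun j =>
        { r := Fintype.card (fib j)
          r_pos := Fintype.card_pos
          a := fun k => (er j k).2 ▸ a (er j k).1
          a_ne_zero := fun k => by
            have key : ∀ (A B : D.Rep F) (h : A = B) (a : A.T), a ≠ 0 → (h ▸ a : B.T) ≠ 0 := by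
              rintro A _ rfl a ha; exact ha
            exact key _ _ _ _ (ha _)
          star_a := fun k => by
            have key : ∀ (A B : D.Rep F) (h : A = B) (a : A.T), star a = a →
                star (h ▸ a : B.T) = h ▸ a := by
              rintro A _ rfl a ha; exact ha
            exact key _ _ _ _ (hs _) } }
  refine ⟨d, IsOrthoSum.uiso ?_ (d.isOrthoSum f)⟩
  let e2 : (Σ j : Fin q, Fin (Fintype.card (fib j))) ≃ {k // ¬ P k} :=
    (Equiv.sigmaCongrRight er).trans
      { toFun := fun s => s.2.1
        invFun := fun k => ⟨eq.symm ⟨A k, k, rfl⟩, k, by simp⟩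
        left_inv := by
          rintro ⟨j, k, hk⟩
          have : eq.symm ⟨A k, k, rfl⟩ = j := by
            rw [Equiv.symm_apply_eq]; exact Subtype.ext hk
          subst this
          rfl
        right_inv := fun k => rfl }
  let e : d.Idx ≃ κ := (Equiv.sumCongr (Fintype.equivFin _).symm e2).trans (Equiv.sumCompl P)
  convert hXZ.reindex e using 1
  funext s
  rcases s with i | ⟨j, k⟩
  · exact (hZM _).symm
  · refine Eq.trans ?_ (hZA (e2 ⟨j, k⟩)).symm
    exact (twist_cast f (er j k).2 (a (er j k).1)).symm

/-! ### Coordinates of `Hom(L, X)` modulo the radical -/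

theorem QRep.ofHom_comp {L : D.QRep F} (s t : L ⟶ L) :
    L.ofHom (s ≫ t) = L.ofHom t * L.ofHom s := rfl

theorem QRep.ofHom_sum {L : D.QRep F} {κ : Type*} (s : Finset κ) (f : κ → (L ⟶ L)) :
    L.ofHom (∑ k ∈ s, f k) = ∑ k ∈ s, L.ofHom (f k) :=
  toHom_injective (by rw [toHom_sum]; rfl)

/-- `T` is the quotient of the ring `End L` by its radical. -/
structure IsResidueMap (L : D.QRep F) {T : Type*} [Ring T] (π : L.End →+* T) : Prop where
  surjective : Function.Surjective π
  eq_zero_iff : ∀ f : L ⟶ L, π (L.ofHom f) = 0 ↔ IsRad f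

theorem IsResidueMap.eq_iff {L : D.QRep F} {T : Type*} [Ring T] {π : L.End →+* T}
    (hπ : IsResidueMap L π) {f g : L ⟶ L} : π (L.ofHom f) = π (L.ofHom g) ↔ IsRad (f - g) := by
  rw [← hπ.eq_zero_iff, ← sub_eq_zero, ← map_sub]
  rfl

/-- Multiplicities are also needed for members of `ind₁`, for which `Rep.T` has no meaning; hence
the abstract residue map. -/
theorem isResidueMap_mk {L : D.QRep F} (hL : L.Indecomposable) :
    IsResidueMap L (Ideal.Quotient.mk (Ring.jacobson L.End)) :=
  ⟨Ideal.Quotient.mk_surjective, fun f => by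
    rw [Ideal.Quotient.eq_zero_iff_mem, ← isRad_toHom_iff hL, toHom_ofHom]⟩

theorem isResidueMap_toT {A : D.Rep F} (hA : A.under.Indecomposable) :
    IsResidueMap A.under A.toT :=
  isResidueMap_mk hA

/-- The morphisms `i a : L → X` are, modulo the radical, a basis of `Hom(L, X)`, with the dual
basis `p a : X → L`. -/
structure IsFrame {L X : D.QRep F} {ι : Type*} [Fintype ι] (i : ι → (L ⟶ X))
    (p : ι → (X ⟶ L)) : Prop where
  comp_self : ∀ a, i a ≫ p a = 𝟙 L
  comp_ne : ∀ a b, a ≠ b → i a ≫ p b = 0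
  isRad : ∀ g : L ⟶ X, IsRad (g - ∑ a, (g ≫ p a) ≫ i a)

section Coord

variable {L X X' : D.QRep F} {T : Type*} [Ring T] {π : L.End →+* T} {ι ι' : Type*} [Fintype ι]
  [Fintype ι'] {i : ι → (L ⟶ X)} {p : ι → (X ⟶ L)} {i' : ι' → (L ⟶ X')} {p' : ι' → (X' ⟶ L)}

/-- The coordinates of `g : L → X` modulo the radical. -/
def coord (π : L.End →+* T) (p : ι → (X ⟶ L)) (g : L ⟶ X) (a : ι) : T := π (L.ofHom (g ≫ p a))

theorem IsFrame.coord_sum (hi : IsFrame i p) (x : ι → L.End) :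
    coord π p (∑ a, L.toHom (x a) ≫ i a) = fun a => π (x a) := by
  funext a
  rw [coord, Preadditive.sum_comp, Finset.sum_eq_single a]
  · rw [Category.assoc, hi.comp_self, Category.comp_id, ofHom_toHom]
  · intro b _ hb
    rw [Category.assoc, hi.comp_ne b a hb, Limits.comp_zero]
  · simp

theorem IsFrame.coord_surjective (hi : IsFrame i p) (hπ : IsResidueMap L π) :
    Function.Surjective (coord π p) := fun x => by
  choose y hy using fun a => hπ.surjective (x a)
  exact ⟨_, (hi.coord_sum y).trans (funext hy)⟩

/-- Modulo the radical `g` is the combination of the `i a` with its coordinates, so composing with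
any `z` acts on coordinates as a row vector. Matrices of morphisms and Hermitian forms are both
computed from this. -/
theorem IsFrame.sum_mul_coord (hi : IsFrame i p) (hπ : IsResidueMap L π) (g : L ⟶ X)
    (z : X ⟶ L) : ∑ a, π (L.ofHom (i a ≫ z)) * coord π p g a = π (L.ofHom (g ≫ z)) := by
  have h : ∀ a, π (L.ofHom (i a ≫ z)) * coord π p g a =
      π (L.ofHom (((g ≫ p a) ≫ i a) ≫ z)) := fun a => by
    rw [coord, ← map_mul, ← ofHom_comp]
    simp only [Category.assoc]
  simp only [h]
  rw [← map_sum, ← ofHom_sum, hπ.eq_iff, ← Preadditive.sum_comp, ← Preadditive.sub_comp,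
    ← neg_sub, Preadditive.neg_comp]
  exact ((hi.isRad g).comp_right z).neg

/-- The matrices of `u` and `u⁻¹` in the two frames are mutually inverse over `T`. -/
theorem IsFrame.exists_equiv (hi : IsFrame i p) (hi' : IsFrame i' p') (hπ : IsResidueMap L π)
    (u : X ≅ X') : ∃ e : (ι → T) ≃ₗ[Tᵐᵒᵖ] (ι' → T),
      ∀ g, e (coord π p g) = coord π p' (g ≫ u.hom) := by
  have h1 : ∀ g, (fun b => ∑ a, π (L.ofHom (i a ≫ u.hom ≫ p' b)) * coord π p g a) =
      coord π p' (g ≫ u.hom) := fun g => funext fun b => by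
    rw [hi.sum_mul_coord hπ, coord, Category.assoc]
  have h2 : ∀ g, (fun a => ∑ b, π (L.ofHom (i' b ≫ u.inv ≫ p a)) * coord π p' g b) =
      coord π p (g ≫ u.inv) := fun g => funext fun b => by
    rw [hi'.sum_mul_coord hπ, coord, Category.assoc]
  refine ⟨
    { toFun := fun x b => ∑ a, π (L.ofHom (i a ≫ u.hom ≫ p' b)) * x a
      invFun := fun y a => ∑ b, π (L.ofHom (i' b ≫ u.inv ≫ p a)) * y b
      map_add' := fun x y => funext fun b => by simp [mul_add, Finset.sum_add_distrib]
      map_smul' := fun t x => funext fun b => by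
        simp [Finset.sum_mul, mul_assoc]
      left_inv := fun x => ?_
      right_inv := fun y => ?_ }, h1⟩
  · obtain ⟨g, rfl⟩ := hi.coord_surjective hπ x
    refine ((congrArg (fun (y : ι' → T) a => ∑ b, π (L.ofHom (i' b ≫ u.inv ≫ p a)) * y b)
      (h1 g)).trans (h2 _)).trans ?_
    rw [Category.assoc, u.hom_inv_id, Category.comp_id]
  · obtain ⟨g, rfl⟩ := hi'.coord_surjective hπ y
    refine ((congrArg (fun (x : ι → T) b => ∑ a, π (L.ofHom (i a ≫ u.hom ≫ p' b)) * x a)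
      (h2 g)).trans (h1 _)).trans ?_
    rw [Category.assoc, u.inv_hom_id, Category.comp_id]

end Coord

theorem IsResidueMap.card_eq {L : D.QRep F} {T : Type*} [Ring T] {π : L.End →+* T}
    (hπ : IsResidueMap L π) (hL : L.Indecomposable) {α β : Type*} [Fintype α] [Fintype β]
    (e : (α → T) ≃ₗ[Tᵐᵒᵖ] (β → T)) : Fintype.card α = Fintype.card β := by
  have hT : ∀ a : T, IsUnit a ∨ a = 0 := fun a => by
    obtain ⟨f, rfl⟩ := hπ.surjective a
    by_cases hf : IsUnit f
    · exact Or.inl (hf.map _)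
    · refine Or.inr ((hπ.eq_zero_iff (L.toHom f)).2 ?_)
      rwa [hL.isRad_iff, ← isUnit_iff_isIso_toHom]
  have : Nontrivial T := ⟨⟨1, 0, fun h => by
    have h1 : π (L.ofHom (𝟙 L)) = 0 := (map_one π).trans h
    rw [hπ.eq_zero_iff, hL.isRad_iff] at h1
    exact h1 inferInstance⟩⟩
  let _ : DivisionRing T := DivisionRing.ofIsUnitOrEqZero hT
  -- As a right space `T` is free of rank one over `Tᵐᵒᵖ`, so invariance of dimension applies.
  let o : T ≃ₗ[Tᵐᵒᵖ] Tᵐᵒᵖ := MulOpposite.opLinearEquiv Tᵐᵒᵖ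
  exact card_eq_of_linearEquiv Tᵐᵒᵖ
    ((LinearEquiv.piCongrRight fun _ : α => o).symm.trans
      (e.trans (LinearEquiv.piCongrRight fun _ : β => o)))

/-! ### Multiplicities -/

/-- The indecomposable representation `L` occurs `n` times in `X`. -/
def HasMult (L X : D.QRep F) (n : ℕ) : Prop :=
  ∃ (i : Fin n → (L ⟶ X)) (p : Fin n → (X ⟶ L)), IsFrame i p

theorem IsFrame.hasMult {L X : D.QRep F} {ι : Type*} [Fintype ι] {i : ι → (L ⟶ X)}
    {p : ι → (X ⟶ L)} (h : IsFrame i p) : HasMult L X (Fintype.card ι) := by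
  let e := (Fintype.equivFin ι).symm
  refine ⟨fun a => i (e a), fun a => p (e a), fun a => h.comp_self _,
    fun a b hab => h.comp_ne _ _ (e.injective.ne hab), fun g => ?_⟩
  rw [e.sum_comp (fun a => (g ≫ p a) ≫ i a)]
  exact h.isRad g

theorem hasMult_zero_iff {L X : D.QRep F} : HasMult L X 0 ↔ ∀ g : L ⟶ X, IsRad g := by
  constructor
  · rintro ⟨i, p, h⟩ g
    simpa using h.isRad g
  · intro h
    exact ⟨Fin.elim0, Fin.elim0, fun a => a.elim0, fun a => a.elim0, fun g => by simpa using h g⟩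

/-- The multiplicity is the dimension of `Hom(L, X)` modulo the radical over the division ring `End
L / Rad`. -/
theorem HasMult.unique {L X X' : D.QRep F} (hL : L.Indecomposable) {n n' : ℕ}
    (h : HasMult L X n) (h' : HasMult L X' n') (u : X ≅ X') : n = n' := by
  obtain ⟨i, p, h⟩ := h
  obtain ⟨i', p', h'⟩ := h'
  obtain ⟨e, -⟩ := h.exists_equiv h' (isResidueMap_mk hL) u
  simpa using (isResidueMap_mk hL).card_eq hL e

open Classical in
theorem hasMult_indecomposable {L N : D.QRep F} (hL : L.Indecomposable) (hN : N.Indecomposable) :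
    HasMult L N (if Nonempty (L ≅ N) then 1 else 0) := by
  split_ifs with h
  · obtain ⟨e⟩ := h
    exact ⟨fun _ => e.hom, fun _ => e.inv, fun _ => e.hom_inv_id,
      fun a b hab => absurd (Subsingleton.elim a b) hab, fun g => by simpa using isRad_zero⟩
  · exact hasMult_zero_iff.2 (isRad_of_isEmpty_iso hL hN h)

theorem HasMult.sum {κ : Type*} [Fintype κ] {L X : D.QRep F} {Y : κ → D.QRep F}
    {inc : ∀ k, Y k ⟶ X} {proj : ∀ k, X ⟶ Y k} (h1 : ∀ k, inc k ≫ proj k = 𝟙 _)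
    (h2 : ∀ k l, k ≠ l → inc k ≫ proj l = 0) (h3 : ∑ k, proj k ≫ inc k = 𝟙 X) {n : κ → ℕ}
    (h : ∀ k, HasMult L (Y k) (n k)) : HasMult L X (∑ k, n k) := by
  choose i p hi using h
  have : IsFrame (fun s : Σ k, Fin (n k) => i s.1 s.2 ≫ inc s.1)
      (fun s : Σ k, Fin (n k) => proj s.1 ≫ p s.1 s.2) := by
    refine ⟨fun s => ?_, ?_, fun g => ?_⟩
    · rw [Category.assoc, reassoc_of% h1 s.1, (hi s.1).comp_self]
    · rintro ⟨k, a⟩ ⟨l, b⟩ hne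
      by_cases hkl : k = l
      · subst hkl
        have : a ≠ b := fun h => hne (by rw [h])
        rw [Category.assoc, reassoc_of% h1 k, (hi k).comp_ne a b this]
      · rw [Category.assoc, reassoc_of% h2 k l hkl]
        simp
    · have : g - ∑ s : Σ k, Fin (n k), (g ≫ proj s.1 ≫ p s.1 s.2) ≫ i s.1 s.2 ≫ inc s.1 =
          ∑ k, (g ≫ proj k - ∑ a, ((g ≫ proj k) ≫ p k a) ≫ i k a) ≫ inc k := by
        simp only [Preadditive.sub_comp, Finset.sum_sub_distrib, Preadditive.sum_comp,
          Category.assoc]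
        rw [Fintype.sum_sigma, ← Preadditive.comp_sum, h3, Category.comp_id]
      rw [this]
      exact isRad_sum _ _ fun k _ => ((hi k).isRad _).comp_right _
  simpa using this.hasMult

theorem IsOrthoSum.hasMult {κ : Type*} [Fintype κ] {L : D.QRep F} {X : D.Rep F} {Y : κ → D.Rep F}
    (h : IsOrthoSum X Y) {n : κ → ℕ} (hn : ∀ k, HasMult L (Y k).under (n k)) :
    HasMult L X.under (∑ k, n k) := by
  obtain ⟨i, h1, h2, h3⟩ := h
  exact HasMult.sum h1 h2 h3 hn

theorem HasMult.of_iso {L X X' : D.QRep F} {n : ℕ} (h : HasMult L X n) (u : X ≅ X') :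
    HasMult L X' n := by
  have := HasMult.sum (L := L) (κ := Unit) (inc := fun _ => u.hom) (proj := fun _ => u.inv)
    (by simp) (fun k l h => absurd rfl h) (by simp) (fun _ => h)
  simpa using this

/-- As a quiver representation `M^+` is `M ⊕ M°`; the vanishing of the cross compositions follows
from `plus_total`. -/
theorem hasMult_plus {L M : D.QRep F} {m n : ℕ} (hm : HasMult L M m)
    (hn : HasMult L M.adjoint n) : HasMult L M.plus.under (m + n) := by
  have h1 := plusInc_plusProj M
  have h2 := plus_total M
  have h3 := ofAdj_toAdj h1
  rw [← toAdj_ofAdj] at h2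
  have h4 : plusInc M ≫ toAdj (plusInc M) ≫ ofAdj (plusProj M) = 0 := by
    have := congrArg (fun z => plusInc M ≫ z) h2
    simpa [reassoc_of% h1] using this
  have h5 : plusInc M ≫ toAdj (plusInc M) = 0 := by
    have := congrArg (fun z => z ≫ toAdj (plusInc M)) h4
    simpa [h3] using this
  have h6 : ofAdj (plusProj M) ≫ plusProj M ≫ plusInc M = 0 := by
    have := congrArg (fun z => ofAdj (plusProj M) ≫ z) h2
    simpa [reassoc_of% h3] using this
  have h7 : ofAdj (plusProj M) ≫ plusProj M = 0 := by
    have := congrArg (fun z => z ≫ plusProj M) h6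
    simpa [h1] using this
  have := HasMult.sum (L := L) (X := M.plus.under) (κ := Bool)
    (Y := fun b => match b with
      | true => M
      | false => M.adjoint)
    (inc := fun b => match b with
      | true => plusInc M
      | false => ofAdj (plusProj M))
    (proj := fun b => match b with
      | true => plusProj M
      | false => toAdj (plusInc M))
    (n := fun b => match b with
      | true => m
      | false => n)
    (by rintro (_ | _); exacts [h3, h1])
    (by
      rintro (_ | _) (_ | _) h
      · exact absurd rfl h
      · exact h7
      · exact h5
      · exact absurd rfl h)
    (by
      rw [Fintype.sum_bool]
      exact h2)
    (by rintro (_ | _); exacts [hn, hm])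
  rwa [Fintype.sum_bool] at this

/-! ### Hermitian forms -/

/-- The Hermitian form `φ` over `T(A)` is, in the coordinates given by the morphisms
`i k : A̲ → X̲`, the form `(g, h) ↦ h ≫ g° + Rad` on `Hom(A̲, X̲)` modulo the radical. -/
structure IsHermFrame {A X : D.Rep F} (φ : HermForm A.T) (i : Fin φ.r → (A.under ⟶ X.under))
    (f : Fin φ.r → (A.under.End)ˣ) : Prop where
  isFrame : IsFrame i fun k => dag (i k) ≫ A.under.toHom ((f k)⁻¹ : (A.under.End)ˣ)
  gram : ∀ k, i k ≫ dag (i k) = A.under.toHom (f k)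
  toT : ∀ k, A.toT (f k) = φ.a k

theorem dag_toHom_inv {A X : D.Rep F} {i : A.under ⟶ X.under} {f : (A.under.End)ˣ}
    (h : i ≫ dag i = A.under.toHom f) :
    dag (A.under.toHom (f⁻¹ : (A.under.End)ˣ)) = A.under.toHom (f⁻¹ : (A.under.End)ˣ) := by
  have hf : star f = f := by
    apply Units.ext
    apply toHom_injective
    rw [Units.coe_star, toHom_star, ← h]
    simp
  rw [← toHom_star, ← Units.coe_star, star_inv, hf]

section HermFrame

variable {A X X' : D.Rep F} {φ ψ : HermForm A.T} {i : Fin φ.r → (A.under ⟶ X.under)}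
  {f : Fin φ.r → (A.under.End)ˣ} {i' : Fin ψ.r → (A.under ⟶ X'.under)}
  {f' : Fin ψ.r → (A.under.End)ˣ}

/-- The coordinate of `g` at `k` is the class of `g ≫ dag (i k) ≫ f_k⁻¹`, so its adjoint times `a_k`
is the class of `i k ≫ dag g`. The description of `φ` on the right is free of coordinates. -/
theorem IsHermFrame.val_coord (h : IsHermFrame φ i f) (hA : A.under.Indecomposable)
    (g g' : A.under ⟶ X.under) :
    φ.val (coord A.toT (fun k => dag (i k) ≫ A.under.toHom ((f k)⁻¹ : (A.under.End)ˣ)) g)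
      (coord A.toT (fun k => dag (i k) ≫ A.under.toHom ((f k)⁻¹ : (A.under.End)ˣ)) g') =
      A.toT (A.under.ofHom (g' ≫ dag g)) := by
  have hπ := isResidueMap_toT hA
  rw [← h.isFrame.sum_mul_coord hπ g' (dag g), HermForm.val]
  refine Finset.sum_congr rfl fun k _ => ?_
  congr 1
  rw [← h.toT k, coord, A.star_toT, ← map_mul]
  congr 1
  apply toHom_injective
  rw [toHom_mul, toHom_star, toHom_ofHom, toHom_ofHom]
  simp only [dag_comp, dag_dag, dag_toHom_inv (h.gram k), Category.assoc]
  rw [reassoc_of% toHom_comp_inv (f k)]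

/-- A unitary `u` preserves `g' ≫ dag g`, so the map it induces on coordinates is an isometry of the
forms. -/
theorem IsHermFrame.equivalent (h : IsHermFrame φ i f) (h' : IsHermFrame ψ i' f')
    (hA : A.under.Indecomposable) (u : Uiso X X') : φ.Equivalent ψ := by
  have hπ := isResidueMap_toT hA
  obtain ⟨u, hu, hu'⟩ := u
  obtain ⟨e, he⟩ := h.isFrame.exists_equiv h'.isFrame hπ ⟨u, dag u, hu, hu'⟩
  refine ⟨e, fun x y => ?_⟩
  obtain ⟨g, rfl⟩ := h.isFrame.coord_surjective hπ x
  obtain ⟨g', rfl⟩ := h.isFrame.coord_surjective hπ y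
  rw [he, he, h'.val_coord hA, h.val_coord hA]
  simp [reassoc_of% hu]

theorem isRad_of_coord {L X : D.QRep F} {T : Type*} [Ring T] {π : L.End →+* T}
    (hπ : IsResidueMap L π) {ι : Type*} [Fintype ι] {i : ι → (L ⟶ X)} {p : ι → (X ⟶ L)}
    (hi : IsFrame i p) {g : L ⟶ X} (hg : coord π p g = 0) : IsRad g := by
  have h1 : IsRad (∑ a, (g ≫ p a) ≫ i a) :=
    isRad_sum _ _ fun a _ => ((hπ.eq_zero_iff _).1 (congrFun hg a)).comp_right _
  simpa using (hi.isRad g).add h1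

/-- When `X` is a sum of copies of `L`, membership in the radical can be tested on morphisms from
`L`, that is, on coordinates. -/
theorem isRad_of_total {L X Y : D.QRep F} {ι : Type*} [Fintype ι] {i : ι → (L ⟶ X)}
    {p : ι → (X ⟶ L)} (ht : ∑ a, p a ≫ i a = 𝟙 X) {z : X ⟶ Y} (hz : ∀ g : L ⟶ X, IsRad (g ≫ z)) :
    IsRad z := by
  rw [← Category.id_comp z, ← ht, Preadditive.sum_comp]
  refine isRad_sum _ _ fun a _ => ?_
  rw [Category.assoc]
  exact (hz _).comp_left _

theorem coord_sub {L X : D.QRep F} {T : Type*} [Ring T] (π : L.End →+* T)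
    {ι : Type*} (p : ι → (X ⟶ L)) (g h : L ⟶ X) :
    coord π p (g - h) = coord π p g - coord π p h := funext fun a => by
  rw [coord, Preadditive.sub_comp]
  exact map_sub π _ _

/-- Linear maps between the coordinate spaces are induced by morphisms. -/
theorem exists_hom_of_linearMap {L X X' : D.QRep F} {T : Type*} [Ring T] {π : L.End →+* T}
    (hπ : IsResidueMap L π) {ι ι' : Type*} [Fintype ι] [Fintype ι']
    {p : ι → (X ⟶ L)} {i' : ι' → (L ⟶ X')} {p' : ι' → (X' ⟶ L)} (hi' : IsFrame i' p')
    (e : (ι → T) →ₗ[Tᵐᵒᵖ] (ι' → T)) :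
    ∃ g : X ⟶ X', ∀ t, coord π p' (t ≫ g) = e (coord π p t) := by
  classical
  -- The entries of the matrix of `e`, lifted from `T` to `End L`.
  choose z hz using fun (a : ι) (b : ι') => hπ.surjective (e (Pi.single a 1) b)
  refine ⟨∑ a, p a ≫ ∑ b, L.toHom (z a b) ≫ i' b, fun t => ?_⟩
  have h1 : t ≫ ∑ a, p a ≫ ∑ b, L.toHom (z a b) ≫ i' b =
      ∑ b, L.toHom (∑ a, z a b * L.ofHom (t ≫ p a)) ≫ i' b := by
    simp only [toHom_sum, toHom_mul, toHom_ofHom, Preadditive.comp_sum, Preadditive.sum_comp,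
      Category.assoc]
    exact Finset.sum_comm
  rw [h1, hi'.coord_sum]
  funext b
  have h2 : coord π p t = ∑ a, MulOpposite.op (coord π p t a) • Pi.single a (1 : T) := by
    funext c
    simp [Finset.sum_apply, Pi.single_apply]
  rw [h2, map_sum e, Finset.sum_apply, map_sum π]
  refine Finset.sum_congr rfl fun a _ => ?_
  rw [map_smul, Pi.smul_apply, map_mul, hz]
  rfl

/-- The equivalence and its inverse lift to morphisms that are inverse to each other and unitary
modulo the radical; `uiso_of_isRad` does the rest. -/
theorem IsHermFrame.uiso (h2 : (2 : F) ≠ 0) (h : IsHermFrame φ i f) (h' : IsHermFrame ψ i' f')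
    (hA : A.under.Indecomposable)
    (ht : ∑ k, (dag (i k) ≫ A.under.toHom ((f k)⁻¹ : (A.under.End)ˣ)) ≫ i k = 𝟙 X.under)
    (ht' : ∑ k, (dag (i' k) ≫ A.under.toHom ((f' k)⁻¹ : (A.under.End)ˣ)) ≫ i' k = 𝟙 X'.under)
    (he : φ.Equivalent ψ) : Uiso X X' := by
  have hπ := isResidueMap_toT hA
  obtain ⟨e, he⟩ := he
  obtain ⟨g, hg⟩ := exists_hom_of_linearMap hπ
    (p := fun k => dag (i k) ≫ A.under.toHom ((f k)⁻¹ : (A.under.End)ˣ)) h'.isFrame e.toLinearMap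
  obtain ⟨g', hg'⟩ := exists_hom_of_linearMap hπ
    (p := fun k => dag (i' k) ≫ A.under.toHom ((f' k)⁻¹ : (A.under.End)ˣ)) h.isFrame
    e.symm.toLinearMap
  refine uiso_of_isRad h2 g g' (isRad_of_total ht fun t => ?_) (isRad_of_total ht' fun t => ?_)
    (isRad_of_total ht fun t => ?_)
  · rw [Preadditive.comp_sub, Category.comp_id]
    refine isRad_of_coord hπ h.isFrame ?_
    rw [coord_sub, ← Category.assoc, hg', hg]
    simp
  · rw [Preadditive.comp_sub, Category.comp_id]
    refine isRad_of_coord hπ h'.isFrame ?_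
    rw [coord_sub, ← Category.assoc, hg, hg']
    simp
  -- Paired with `i k`, the defect of `g` compares the values of `ψ` and `φ`, which agree.
  · have h1 : ∀ k, IsRad ((t ≫ (g ≫ dag g - 𝟙 _)) ≫ dag (i k)) := fun k => by
      have h3 : (t ≫ (g ≫ dag g - 𝟙 _)) ≫ dag (i k) =
          (t ≫ g) ≫ dag (i k ≫ g) - t ≫ dag (i k) := by simp
      rw [h3, ← hπ.eq_iff, ← h'.val_coord hA, ← h.val_coord hA, hg, hg]
      exact he _ _
    generalize t ≫ (g ≫ dag g - 𝟙 _) = y at h1 ⊢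
    rw [← Category.comp_id y, ← ht, Preadditive.comp_sum]
    refine isRad_sum _ _ fun k _ => ?_
    simpa only [Category.assoc] using
      ((h1 k).comp_right (A.under.toHom ((f k)⁻¹ : (A.under.End)ˣ))).comp_right (i k)

end HermFrame

theorem exists_twist_iso {A : D.Rep F} {f : (A.under.End)ˣ} (hf : star (f : A.under.End) = f) :
    ∃ v : A.under ≅ (A.twist f).under, v.hom ≫ dag v.hom = A.under.toHom f ∧
      v.inv = dag v.hom ≫ A.under.toHom (f⁻¹ : (A.under.End)ˣ) := by
  obtain ⟨θ, h1, h3⟩ := exists_twist f hf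
  have hf' : dag (A.under.toHom f) = A.under.toHom f := by rw [← toHom_star, hf]
  refine ⟨⟨A.under.toHom f ≫ dag θ, θ, ?_, h1⟩, ?_, ?_⟩
  · rw [Category.assoc, h3, toHom_comp_inv]
  · simp only [dag_comp, dag_dag, hf', Category.assoc]
    rw [reassoc_of% h3, reassoc_of% toHom_comp_inv f]
  · simp [hf', toHom_comp_inv]

/-- Orthogonal summands `A^f` of `X` give an `IsHermFrame` if the other summands are not
isomorphic to `A`. -/
theorem exists_isHermFrame {A X : D.Rep F} {κ : Type*} [Fintype κ] {Y : κ → D.Rep F}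
    (h : IsOrthoSum X Y) (φ : HermForm A.T) {e : Fin φ.r → κ} (he : Function.Injective e)
    {f : Fin φ.r → (A.under.End)ˣ} (hfs : ∀ k, star (f k : A.under.End) = f k)
    (hf : ∀ k, A.toT (f k) = φ.a k) (hY : ∀ k, Y (e k) = A.twist (f k))
    (h0 : ∀ k, (∀ a, e a ≠ k) → HasMult A.under (Y k).under 0) :
    ∃ i : Fin φ.r → (A.under ⟶ X.under), IsHermFrame φ i f ∧
      (Function.Surjective e →
        ∑ k, (dag (i k) ≫ A.under.toHom ((f k)⁻¹ : (A.under.End)ˣ)) ≫ i k = 𝟙 X.under) := by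
  classical
  have hv : ∀ k, ∃ v : A.under ≅ (Y (e k)).under, v.hom ≫ dag v.hom = A.under.toHom (f k) ∧
      v.inv = dag v.hom ≫ A.under.toHom ((f k)⁻¹ : (A.under.End)ˣ) := fun k => by
    rw [hY k]
    exact exists_twist_iso (hfs k)
  choose v hv1 hv2 using hv
  obtain ⟨inc, h1, h2, h3⟩ := h
  have hp : ∀ k, dag ((v k).hom ≫ inc (e k)) ≫ A.under.toHom ((f k)⁻¹ : (A.under.End)ˣ) =
      dag (inc (e k)) ≫ (v k).inv := fun k => by rw [hv2]; simp
  have hpi : ∀ k, (dag ((v k).hom ≫ inc (e k)) ≫ A.under.toHom ((f k)⁻¹ : (A.under.End)ˣ)) ≫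
      (v k).hom ≫ inc (e k) = dag (inc (e k)) ≫ inc (e k) := fun k => by rw [hp]; simp
  refine ⟨fun k => (v k).hom ≫ inc (e k), ⟨⟨fun k => ?_, fun k l hkl => ?_, fun g => ?_⟩,
    fun k => ?_, hf⟩, fun hs => ?_⟩
  · rw [hp]
    simp [reassoc_of% h1 (e k)]
  · rw [hp, Category.assoc, ← Category.assoc (inc (e k)), h2 _ _ (he.ne hkl)]
    simp
  · simp only [Category.assoc] at hpi
    simp only [Category.assoc, hpi]
    rw [← Preadditive.comp_sum]
    have h4 : ∑ k, dag (inc (e k)) ≫ inc (e k) =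
        ∑ k ∈ Finset.univ.map ⟨e, he⟩, dag (inc k) ≫ inc k := by
      rw [Finset.sum_map]
      rfl
    -- What the frame misses of `g` factors through the other summands, in which `A` does not occur,
    -- so it is radical.
    have h5 := Finset.sum_add_sum_compl (Finset.univ.map ⟨e, he⟩) fun k => dag (inc k) ≫ inc k
    rw [h3, ← h4] at h5
    have h6 : g - g ≫ ∑ k, dag (inc (e k)) ≫ inc (e k) =
        ∑ k ∈ (Finset.univ.map ⟨e, he⟩)ᶜ, (g ≫ dag (inc k)) ≫ inc k := by
      simp only [Category.assoc]
      rw [← Preadditive.comp_sum, sub_eq_iff_eq_add, ← Preadditive.comp_add, add_comm, h5,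
        Category.comp_id]
    rw [h6]
    refine isRad_sum _ _ fun k hk => IsRad.comp_right (hasMult_zero_iff.1 (h0 k ?_) _) _
    simpa using hk
  · simp [reassoc_of% h1 (e k), hv1]
  · simp only [hpi]
    rw [← h3]
    exact (Equiv.ofBijective e ⟨he, hs⟩).sum_comp fun k => dag (inc k) ≫ inc k

variable {R : Finset (D.Relation F)}

/-! ### Representatives -/

theorem IsIndPair.eq_of_iso₀ (hind : IsIndPair R ind₀ ind₁) {A B : D.Rep F} (hA : A ∈ ind₀)
    (hB : B ∈ ind₀) (e : A.under ≅ B.under) : A = B := by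
  obtain ⟨hAi, hAR⟩ := hind.indec₀ A hA
  exact (hind.existsUnique₀ A.under hAi hAR.under ⟨A, isomorphic_iff.2 ⟨Iso.refl _⟩⟩).unique
    ⟨hA, isomorphic_iff.2 ⟨Iso.refl _⟩⟩ ⟨hB, isomorphic_iff.2 ⟨e⟩⟩

theorem IsIndPair.eq_of_iso₁ (hind : IsIndPair R ind₀ ind₁) {M N : D.QRep F} (hM : M ∈ ind₁)
    (hN : N ∈ ind₁) (h : Nonempty (M ≅ N) ∨ Nonempty (M ≅ N.adjoint)) : M = N := by
  obtain ⟨hMi, hMR, hMs⟩ := hind.indec₁ M hM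
  exact (hind.existsUnique₁ M hMi hMR hMs).unique ⟨hM, Or.inl (isomorphic_iff.2 ⟨Iso.refl _⟩)⟩
    ⟨hN, h.imp isomorphic_iff.2 isomorphic_iff.2⟩

theorem IsIndPair.isEmpty_iso (hind : IsIndPair R ind₀ ind₁) {A : D.Rep F} {M : D.QRep F}
    (hM : M ∈ ind₁) : ¬ Nonempty (M ≅ A.under) := fun h =>
  (hind.indec₁ M hM).2.2 ⟨A, isomorphic_iff.2 h⟩

/-- Otherwise `M ≅ M°° ≅ A̲° ≅ A̲`. -/
theorem IsIndPair.isEmpty_iso_adjoint (hind : IsIndPair R ind₀ ind₁) {A : D.Rep F} {M : D.QRep F}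
    (hM : M ∈ ind₁) : ¬ Nonempty (M.adjoint ≅ A.under) := fun ⟨e⟩ =>
  hind.isEmpty_iso hM ⟨M.biadj ≪≫ (adjIso e).symm ≪≫ A.selfDual.symm⟩

/-! ### Multiplicities in the direct sums -/

open Classical in
/-- The multiplicity of `M` in `M^+`. -/
def plusMult (M : D.QRep F) : ℕ := 1 + if Nonempty (M ≅ M.adjoint) then 1 else 0

-- Each `M^+` contributes `1` or `2` copies of `M`: the second occurs when `M ≅ M°`, which is
-- possible even though `M` is not isomorphic to a selfadjoint representation. The other summands
-- contribute none.
open Classical in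
theorem Decomp.hasMult₁ (hind : IsIndPair R ind₀ ind₁) {f : ∀ A : D.Rep F, A.T → (A.under.End)ˣ}
    (hf : IsOrbitChoice ind₀ f) (d : Decomp ind₀ ind₁) {M : D.QRep F} (hM : M ∈ ind₁) :
    HasMult M (d.sum f).under (Fintype.card {i // d.M i = M} * plusMult M) := by
  have hMi := (hind.indec₁ M hM).1
  have h := (d.isOrthoSum f).hasMult (L := M)
    (n := Sum.elim (fun i => if d.M i = M then plusMult M else 0) fun _ => 0) (by
      rintro (i | ⟨j, k⟩)
      · have hN := (hind.indec₁ _ (d.M_mem i)).1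
        have h1 := hasMult_plus (hasMult_indecomposable hMi hN)
          (hasMult_indecomposable hMi hN.adjoint)
        change HasMult M (d.M i).plus.under (if d.M i = M then plusMult M else 0)
        by_cases hi : d.M i = M
        · rw [hi] at h1 ⊢
          rw [if_pos rfl]
          rwa [if_pos ⟨Iso.refl M⟩] at h1
        · have h2 := fun h => hi (hind.eq_of_iso₁ hM (d.M_mem i) h).symm
          rw [if_neg hi]
          rwa [if_neg fun h => h2 (Or.inl h), if_neg fun h => h2 (Or.inr h)] at h1
      · change HasMult M ((d.A j).twist (f (d.A j) ((d.φ j).a k))).under 0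
        obtain ⟨v, -⟩ := exists_twist_iso
          (hf (d.A j) (d.A_mem j) _ ((d.φ j).a_ne_zero k) ((d.φ j).star_a k)).1
        have h1 := hasMult_indecomposable hMi (hind.indec₀ _ (d.A_mem j)).1
        rw [if_neg (hind.isEmpty_iso hM)] at h1
        exact h1.of_iso v)
  have h1 : ∑ k : d.Idx, (Sum.elim (fun i => if d.M i = M then plusMult M else 0) fun _ => 0) k =
      Fintype.card {i // d.M i = M} * plusMult M := by
    rw [Fintype.sum_sum_type]
    simp [Finset.sum_ite, Fintype.card_subtype]
  rwa [h1] at h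

theorem Decomp.hasMult_plus_zero (hind : IsIndPair R ind₀ ind₁) {A : D.Rep F} (hA : A ∈ ind₀)
    {M : D.QRep F} (hM : M ∈ ind₁) : HasMult A.under M.plus.under 0 := by
  have hAi := (hind.indec₀ _ hA).1
  have hMi := (hind.indec₁ _ hM).1
  have h := hasMult_plus (hasMult_indecomposable hAi hMi) (hasMult_indecomposable hAi hMi.adjoint)
  rwa [if_neg fun ⟨e⟩ => hind.isEmpty_iso hM ⟨e.symm⟩,
    if_neg fun ⟨e⟩ => hind.isEmpty_iso_adjoint hM ⟨e.symm⟩] at h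

theorem Decomp.hasMult_twist_zero (hind : IsIndPair R ind₀ ind₁)
    {f : ∀ A : D.Rep F, A.T → (A.under.End)ˣ} (hf : IsOrbitChoice ind₀ f) (d : Decomp ind₀ ind₁)
    {A : D.Rep F} (hA : A ∈ ind₀) {j : Fin d.q} (hj : d.A j ≠ A) (k : Fin (d.φ j).r) :
    HasMult A.under ((d.A j).twist (f (d.A j) ((d.φ j).a k))).under 0 := by
  obtain ⟨v, -⟩ := exists_twist_iso
    (hf (d.A j) (d.A_mem j) _ ((d.φ j).a_ne_zero k) ((d.φ j).star_a k)).1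
  have h1 := hasMult_indecomposable (hind.indec₀ _ hA).1 (hind.indec₀ _ (d.A_mem j)).1
  rw [if_neg fun ⟨e⟩ => hj (hind.eq_of_iso₀ hA (d.A_mem j) e).symm] at h1
  exact h1.of_iso v

theorem Decomp.hasMult_zero (hind : IsIndPair R ind₀ ind₁)
    {f : ∀ A : D.Rep F, A.T → (A.under.End)ˣ} (hf : IsOrbitChoice ind₀ f) (d : Decomp ind₀ ind₁)
    {A : D.Rep F} (hA : A ∈ ind₀) (h : ∀ j, d.A j ≠ A) : HasMult A.under (d.sum f).under 0 := by
  have := (d.isOrthoSum f).hasMult (L := A.under) (n := fun _ => 0) (by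
    rintro (i | ⟨j, k⟩)
    · exact hasMult_plus_zero hind hA (d.M_mem i)
    · exact d.hasMult_twist_zero hind hf hA (h j) k)
  simpa using this

theorem Decomp.exists_isHermFrame (hind : IsIndPair R ind₀ ind₁)
    {f : ∀ A : D.Rep F, A.T → (A.under.End)ˣ} (hf : IsOrbitChoice ind₀ f) (d : Decomp ind₀ ind₁)
    (j : Fin d.q) : ∃ i : Fin (d.φ j).r → ((d.A j).under ⟶ (d.sum f).under),
      IsHermFrame (d.φ j) i fun k => f (d.A j) ((d.φ j).a k) := by
  have hc := fun k => hf (d.A j) (d.A_mem j) _ ((d.φ j).a_ne_zero k) ((d.φ j).star_a k)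
  obtain ⟨i, hi, -⟩ := Dograph.exists_isHermFrame (d.isOrthoSum f) (d.φ j)
    (e := fun k => .inr ⟨j, k⟩) (fun k l h => by simpa using h) (fun k => (hc k).1)
    (fun k => (hc k).2) (fun k => rfl) (by
      rintro (i | ⟨l, k⟩) hk
      · exact hasMult_plus_zero hind (d.A_mem j) (d.M_mem i)
      · refine d.hasMult_twist_zero hind hf (d.A_mem j) (fun h => ?_) k
        obtain rfl := d.A_injective h
        exact hk k rfl)
  exact ⟨i, hi⟩

/-! ### Uniqueness -/

theorem exists_perm_of_card_fiber_eq {α : Type*} {ι ι' : Type*} [Fintype ι] [Fintype ι']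
    {g : ι → α} {g' : ι' → α}
    (h : ∀ a, Nat.card {i // g i = a} = Nat.card {i // g' i = a}) :
    ∃ σ : ι ≃ ι', ∀ i, g i = g' (σ i) := by
  let e : ∀ a, {i // g i = a} ≃ {i // g' i = a} := fun a => (Finite.card_eq.1 (h a)).some
  refine ⟨((Equiv.sigmaFiberEquiv g).symm.trans (Equiv.sigmaCongrRight e)).trans
    (Equiv.sigmaFiberEquiv g'), fun i => ?_⟩
  exact (e (g i) ⟨i, rfl⟩).2.symm

theorem exists_equiv_of_uiso (hind : IsIndPair R ind₀ ind₁)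
    {f : ∀ A : D.Rep F, A.T → (A.under.End)ˣ} (hf : IsOrbitChoice ind₀ f)
    {d d' : Decomp ind₀ ind₁} (u : Uiso (d.sum f) (d'.sum f)) :
    ∃ σ : Fin d.p ≃ Fin d'.p, ∀ i, d.M i = d'.M (σ i) := by
  classical
  obtain ⟨u⟩ := u.iso
  refine exists_perm_of_card_fiber_eq fun M => ?_
  by_cases hM : M ∈ ind₁
  · have h := (d.hasMult₁ hind hf hM).unique (hind.indec₁ M hM).1 (d'.hasMult₁ hind hf hM) u
    -- `plusMult M` is positive, so it cancels from the two multiplicities and leaves the numbers of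
    -- summands.
    rw [Nat.card_eq_fintype_card, Nat.card_eq_fintype_card]
    exact Nat.eq_of_mul_eq_mul_right (by unfold plusMult; omega) h
  · have h1 : IsEmpty {i // d.M i = M} := ⟨fun i => hM (i.2 ▸ d.M_mem i)⟩
    have h2 : IsEmpty {i // d'.M i = M} := ⟨fun i => hM (i.2 ▸ d'.M_mem i)⟩
    simp

/-- The multiplicity of `A_j` is the rank `r ≥ 1` of its form, so `A_j` cannot be absent from the
other sum. -/
theorem exists_mem_of_uiso (hind : IsIndPair R ind₀ ind₁)
    {f : ∀ A : D.Rep F, A.T → (A.under.End)ˣ} (hf : IsOrbitChoice ind₀ f)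
    {d d' : Decomp ind₀ ind₁} (u : Uiso (d.sum f) (d'.sum f)) (j : Fin d.q) :
    ∃ l, d'.A l = d.A j := by
  by_contra! h
  obtain ⟨i, hi⟩ := d.exists_isHermFrame hind hf j
  obtain ⟨u⟩ := u.iso
  have := hi.isFrame.hasMult.unique (hind.indec₀ _ (d.A_mem j)).1
    (d'.hasMult_zero hind hf (d.A_mem j) h) u
  rw [Fintype.card_fin] at this
  exact (d.φ j).r_pos.ne' this

theorem sameTerm_of_isHermFrame {A B X X' : D.Rep F} (hA : A.under.Indecomposable) (h : A = B)
    {φ : HermForm A.T} {ψ : HermForm B.T} {i : Fin φ.r → (A.under ⟶ X.under)}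
    {f : Fin φ.r → (A.under.End)ˣ} {i' : Fin ψ.r → (B.under ⟶ X'.under)}
    {f' : Fin ψ.r → (B.under.End)ˣ} (hi : IsHermFrame φ i f) (hi' : IsHermFrame ψ i' f')
    (u : Uiso X X') : SameTerm A B φ ψ := by
  subst h
  exact SameTerm.mk A φ ψ (hi.equivalent hi' hA u)

theorem same_of_uiso (hind : IsIndPair R ind₀ ind₁)
    {f : ∀ A : D.Rep F, A.T → (A.under.End)ˣ} (hf : IsOrbitChoice ind₀ f)
    {d d' : Decomp ind₀ ind₁} (u : Uiso (d.sum f) (d'.sum f)) : d.Same d' := by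
  refine ⟨exists_equiv_of_uiso hind hf u, ?_⟩
  choose τ hτ using exists_mem_of_uiso hind hf u
  choose ρ hρ using exists_mem_of_uiso hind hf u.symm
  -- The matchings in the two directions are inverse to each other because the `A_j` within one sum
  -- are distinct.
  refine ⟨⟨τ, ρ, fun j => d.A_injective (by rw [hρ, hτ]), fun l => d'.A_injective (by rw [hτ, hρ])⟩,
    fun j => ?_⟩
  obtain ⟨i, hi⟩ := d.exists_isHermFrame hind hf j
  obtain ⟨i', hi'⟩ := d'.exists_isHermFrame hind hf (τ j)
  exact sameTerm_of_isHermFrame (hind.indec₀ _ (d.A_mem j)).1 (hτ j).symm hi hi' u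

theorem exists_isHermFrame_hermSum {f : ∀ A : D.Rep F, A.T → (A.under.End)ˣ}
    (hf : IsOrbitChoice ind₀ f) {A : D.Rep F} (hA : A ∈ ind₀) (φ : HermForm A.T) :
    ∃ i : Fin φ.r → (A.under ⟶ (A.hermSum f φ).under),
      IsHermFrame φ i (fun k => f A (φ.a k)) ∧
      ∑ k, (dag (i k) ≫ A.under.toHom ((f A (φ.a k))⁻¹ : (A.under.End)ˣ)) ≫ i k = 𝟙 _ := by
  have hc := fun k => hf A hA _ (φ.a_ne_zero k) (φ.star_a k)
  obtain ⟨i, hi, hs⟩ := Dograph.exists_isHermFrame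
    (isOrthoSum_directSum fun k => A.twist (f A (φ.a k))) φ (e := id) Function.injective_id
    (fun k => (hc k).1) (fun k => (hc k).2) (fun k => rfl) (fun k hk => absurd rfl (hk k))
  exact ⟨i, hi, hs Function.surjective_id⟩

theorem SameTerm.uiso (h2 : (2 : F) ≠ 0) (hind : IsIndPair R ind₀ ind₁)
    {f : ∀ A : D.Rep F, A.T → (A.under.End)ˣ} (hf : IsOrbitChoice ind₀ f) {A B : D.Rep F}
    {φ : HermForm A.T} {ψ : HermForm B.T} (h : SameTerm A B φ ψ) (hA : A ∈ ind₀) :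
    Uiso (A.hermSum f φ) (B.hermSum f ψ) := by
  obtain ⟨φ, ψ, h⟩ := h
  obtain ⟨i, hi, ht⟩ := exists_isHermFrame_hermSum hf hA φ
  obtain ⟨i', hi', ht'⟩ := exists_isHermFrame_hermSum hf hA ψ
  exact hi.uiso h2 hi' (hind.indec₀ A hA).1 ht ht' h

theorem Decomp.Same.uiso (h2 : (2 : F) ≠ 0) (hind : IsIndPair R ind₀ ind₁)
    {f : ∀ A : D.Rep F, A.T → (A.under.End)ˣ} (hf : IsOrbitChoice ind₀ f)
    {d d' : Decomp ind₀ ind₁} (h : d.Same d') : Uiso (d.sum f) (d'.sum f) := by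
  obtain ⟨⟨σ, hσ⟩, τ, hτ⟩ := h
  refine IsOrthoSum.uiso (isOrthoSum_directSum _)
    (((isOrthoSum_directSum _).reindex (Equiv.sumCongr σ τ)).congr ?_)
  rintro (i | j)
  · change Uiso (d.M i).plus (d'.M (σ i)).plus
    rw [hσ]
    exact Uiso.refl _
  · exact (hτ j).uiso h2 hind hf (d.A_mem j)

end Dograph

end

/-! ### The classification theorem -/

theorem theorem3p1 {F : Type u} [DivisionRing F] [StarRing F] (h2 : (2 : F) ≠ 0)
    (D : Dograph.{w}) (R : Finset (D.Relation F))
    (ind₀ : Set (D.Rep F)) (ind₁ : Set (D.QRep F)) (hind : Dograph.IsIndPair R ind₀ ind₁) :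
    (∀ A ∈ ind₀, Nontrivial A.T ∧ (∀ a : A.T, a ≠ 0 → IsUnit a) ∧
      ∀ a : A.T, a ≠ 0 → star a = a →
        ∃ f : (A.under.End)ˣ, star (f : A.under.End) = f ∧ A.toT f = a) ∧
    ∀ f : ∀ A : D.Rep F, A.T → (A.under.End)ˣ, Dograph.IsOrbitChoice ind₀ f →
      (∀ X : D.Rep F, X.Satisfies R →
        ∃ d : Dograph.Decomp ind₀ ind₁, X.Isomorphic (d.sum f)) ∧
      (∀ d d' : Dograph.Decomp ind₀ ind₁, (d.sum f).Isomorphic (d'.sum f) ↔ d.Same d') := by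
  refine ⟨fun A hA => ?_, fun f hf => ⟨fun X hX => ?_, fun d d' => ⟨fun h => ?_, fun h => ?_⟩⟩⟩
  · have hAi := (hind.indec₀ A hA).1
    exact ⟨Dograph.nontrivial_T hAi, fun a => Dograph.isUnit_T hAi,
      fun a => Dograph.exists_selfadjoint_lift h2 hAi⟩
  · obtain ⟨d, hd⟩ := Dograph.exists_decomp h2 hind hf X hX
    exact ⟨d, Dograph.isomorphic_iff_uiso.2 hd⟩
  · exact Dograph.same_of_uiso hind hf (Dograph.isomorphic_iff_uiso.1 h)
  · exact Dograph.isomorphic_iff_uiso.2 (h.uiso h2 hind hf)
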